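/- Let $k$ be a field of characteristic $2$, let $X/k$ be an elliptic curve with identity $\mathrm{O}$, let $T\in X(k)$ be a $k$-rational point of order $4$, and suppose that $c\in k$ satisfies $j(X)=c^8$. For $e\in k$ let $E_e\subset\mathbb{P}^3$ be the curve $$X_0^2-X_1^2+X_2^2-X_3^2=e\,X_0X_2=e\,X_1X_3$$ ($\mathbf{Z}/4\mathbf{Z}$-normal form, with identity $(1:0:0:1)$), and let $C_c\subset\mathbb{P}^3$ be the curve $$X_0^2-X_2^2=c^2X_1X_3,\qquad X_1^2-X_3^2=c^2X_0X_2$$ (split $\mu_4$-normal form, with identity $(c:1:0:1)$). 1. The curve $E_{c^2}$ is smooth, and there exists a unique isomorphism over $k$ of $X$ with $E_{c^2}$ sending $\mathrm{O}$ to $(1:0:0:1)$ and $T$ to $(1:1:0:0)$. 2. The curve $C_c$ is smooth, and there exists a unique isomorphism over $k$ of $X$ with $C_c$ sending $\mathrm{O}$ to $(c:1:0:1)$ and $T$ to $(1:c:1:0)$. 3. Suppose that $X$ is embedded over $k$ in $\mathbb{P}^3$ as a symmetric quartic model; that is, the image is contained in no plane, every plane (over $\bar k$) meets it in exactly $4$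 points of $X(\bar k)$ counted with multiplicities, and the inversion $[-1]$ is induced by a projective linear transformation of $\mathbb{P}^3$. Then the isomorphism of $X$ with $E_{c^2}$ in 1 or the isomorphism of $X$ with $C_c$ in 2 is induced by a linear automorphism of $\mathbb{P}^3$ defined over $k$. -/

import Mathlib

open MvPolynomial

open scoped LinearAlgebra.Projectivization

noncomputable section

namespace NormalForm

/-! ## Projective varieties over `k`, through their points over an algebraically closed field `K`

Throughout, `k` is the base field and `K` a field containing `k`; in the theorem `K` is the
algebraic closure of `k`. -/

/-- Projective `n`-space over `K`. -/
abbrev PSpace (K : Type*) [Field K] (n : ℕ) : Type _ := ℙ K (Fin (n + 1) → K)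

/-- The closed subset of projective `n`-space over `K` defined by a family of forms over `k`
(only used for homogeneous polynomials, for which the chosen representative is irrelevant). -/
def zeroLocus {k : Type*} (K : Type*) [Field k] [Field K] [Algebra k K] {n m : ℕ}
    (F : Fin m → MvPolynomial (Fin (n + 1)) k) : Set (PSpace K n) :=
  {P | ∀ j, aeval P.rep (F j) = 0}

/-- Jacobian criterion: the projective scheme over `k` defined by the forms `F` is smooth of
dimension `n - m` at each of its points over `K`. -/
def IsSmoothCompleteIntersection {k : Type*} (K : Type*) [Field k] [Field K] [Algebra k K]
    {n m : ℕ} (F : Fin m → MvPolynomial (Fin (n + 1)) k) : Prop :=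
  ∀ P ∈ zeroLocus K F,
    LinearIndependent K (fun (j : Fin m) (i : Fin (n + 1)) => aeval P.rep (pderiv i (F j)))

/-- A map `φ` from `X ⊆ ℙᵐ` to `Y ⊆ ℙⁿ` is a morphism over `k` if near each point of `X` it is
given by a tuple of forms of the same degree with coefficients in `k`: the tuple
`(p₀ : … : pₙ)` defines `φ` on the complement in `X` of the common zeros of the `pᵢ`, and these
complements cover `X`. -/
def IsMorphism (k : Type*) {K : Type*} [Field k] [Field K] [Algebra k K] {m n : ℕ}
    {X : Set (PSpace K m)} {Y : Set (PSpace K n)} (φ : X → Y) : Prop :=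
  ∀ P : X, ∃ (d : ℕ) (p : Fin (n + 1) → MvPolynomial (Fin (m + 1)) k),
    (∀ i, (p i).IsHomogeneous d) ∧
    (fun i => aeval (P : PSpace K m).rep (p i)) ≠ (0 : Fin (n + 1) → K) ∧
    ∀ (Q : X) (hQ : (fun i => aeval (Q : PSpace K m).rep (p i)) ≠ (0 : Fin (n + 1) → K)),
      (φ Q : PSpace K n) = Projectivization.mk K _ hQ

/-- An isomorphism over `k` from `X ⊆ ℙᵐ` to `Y ⊆ ℙⁿ`. -/
@[ext]
structure Iso (k : Type*) {K : Type*} [Field k] [Field K] [Algebra k K] {m n : ℕ}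
    (X : Set (PSpace K m)) (Y : Set (PSpace K n)) where
  /-- The underlying bijection on points. -/
  toEquiv : X ≃ Y
  isMorphism_toFun : IsMorphism k (toEquiv : X → Y)
  isMorphism_invFun : IsMorphism k (toEquiv.symm : Y → X)

/-- The projective linear transformation of `ℙⁿ` given by an invertible matrix. -/
def linAut {K : Type*} [Field K] {n : ℕ} (A : Matrix.GeneralLinearGroup (Fin (n + 1)) K)
    (P : PSpace K n) : PSpace K n :=
  Matrix.GeneralLinearGroup.toLin A • P

/-! ## Elliptic curves as plane projective curves -/

/-- The plane projective curve of a Weierstrass equation. -/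
def curve {k : Type*} (K : Type*) [Field k] [Field K] [Algebra k K]
    (W : WeierstrassCurve k) : Set (PSpace K 2) :=
  zeroLocus K (fun _ : Fin 1 => W.toProjective.polynomial)

/-- The point of the projective plane over `K` given by a point with coordinates in a subfield
`F`: the zero of the group law is `(0 : 1 : 0)` and `(x, y)` is `(x : y : 1)`. -/
def planePoint {F : Type*} (K : Type*) [Field F] [Field K] [Algebra F K]
    (W : WeierstrassCurve F) : W.toAffine.Point → PSpace K 2
  | .zero => Projectivization.mk K ![0, 1, 0] (fun h => one_ne_zero (congrFun h 1))
  | .some x y _ => Projectivization.mk K ![algebraMap F K x, algebraMap F K y, 1]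
      (fun h => one_ne_zero (congrFun h 2))

lemma mk_mem_curve {k K : Type*} [Field k] [Field K] [Algebra k K] (W : WeierstrassCurve k)
    (v : Fin 3 → K) (hv : v ≠ 0) (h : aeval v W.toProjective.polynomial = 0) :
    Projectivization.mk K v hv ∈ curve K W := by
  intro _
  obtain ⟨a, ha⟩ := Projectivization.exists_smul_eq_mk_rep K v hv
  rw [← ha]
  simp [WeierstrassCurve.Projective.polynomial, Units.smul_def] at h ⊢
  linear_combination (a : K) ^ 3 * h

lemma planePoint_mem_curve {k : Type*} (K : Type*) [Field k] [Field K] [Algebra k K]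
    (W : WeierstrassCurve k) (P : W.toAffine.Point) : planePoint K W P ∈ curve K W := by
  cases P with
  | zero =>
    apply mk_mem_curve
    simp [WeierstrassCurve.Projective.polynomial]
  | some x y h =>
    apply mk_mem_curve
    have h1 := congrArg (algebraMap k K) ((WeierstrassCurve.Affine.equation_iff _ _).1 h.1)
    simp [WeierstrassCurve.Projective.polynomial] at h1 ⊢
    linear_combination h1

lemma planePoint_baseChange_mem_curve {k : Type*} (K : Type*) [Field k] [Field K] [Algebra k K]
    (W : WeierstrassCurve k) (P : (W.baseChange K).toAffine.Point) :
    planePoint K (W.baseChange K) P ∈ curve K W := by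
  cases P with
  | zero =>
    apply mk_mem_curve
    simp [WeierstrassCurve.Projective.polynomial]
  | some x y h =>
    apply mk_mem_curve
    have h1 := (WeierstrassCurve.Affine.equation_iff _ _).1 h.1
    simp [WeierstrassCurve.Projective.polynomial, WeierstrassCurve.baseChange] at h1 ⊢
    linear_combination h1

/-- A rational point of an elliptic curve as a point of its projective curve. -/
def ratPoint {k : Type*} (K : Type*) [Field k] [Field K] [Algebra k K]
    (W : WeierstrassCurve k) (P : W.toAffine.Point) : curve K W :=
  ⟨planePoint K W P, planePoint_mem_curve K W P⟩

/-- A point over `K` of an elliptic curve over `k` as a point of its projective curve. -/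
def geomPoint {k : Type*} (K : Type*) [Field k] [Field K] [Algebra k K]
    (W : WeierstrassCurve k) (P : (W.baseChange K).toAffine.Point) : curve K W :=
  ⟨planePoint K (W.baseChange K) P, planePoint_baseChange_mem_curve K W P⟩

/-! ## The two normal forms -/

/-- The equations of the `ℤ/4ℤ`-normal form with parameter `e`:
`X₀² - X₁² + X₂² - X₃² = e X₀ X₂ = e X₁ X₃`. -/
def z4Forms {k : Type*} [Field k] (e : k) : Fin 2 → MvPolynomial (Fin 4) k :=
  ![X 0 ^ 2 - X 1 ^ 2 + X 2 ^ 2 - X 3 ^ 2 - C e * X 0 * X 2,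
    X 0 ^ 2 - X 1 ^ 2 + X 2 ^ 2 - X 3 ^ 2 - C e * X 1 * X 3]

/-- The curve `E_e` in `ℤ/4ℤ`-normal form. -/
def z4Curve {k : Type*} (K : Type*) [Field k] [Field K] [Algebra k K] (e : k) :
    Set (PSpace K 3) :=
  zeroLocus K (z4Forms e)

/-- The equations of the split `μ₄`-normal form with parameter `c`:
`X₀² - X₂² = c² X₁ X₃` and `X₁² - X₃² = c² X₀ X₂`. -/
def mu4Forms {k : Type*} [Field k] (c : k) : Fin 2 → MvPolynomial (Fin 4) k :=
  ![X 0 ^ 2 - X 2 ^ 2 - C (c ^ 2) * X 1 * X 3,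
    X 1 ^ 2 - X 3 ^ 2 - C (c ^ 2) * X 0 * X 2]

/-- The curve `C_c` in split `μ₄`-normal form. -/
def mu4Curve {k : Type*} (K : Type*) [Field k] [Field K] [Algebra k K] (c : k) :
    Set (PSpace K 3) :=
  zeroLocus K (mu4Forms c)

/-- The isomorphism `φ` from the elliptic curve `W` to `E_e` sends the identity to
`(1 : 0 : 0 : 1)` and `T` to `(1 : 1 : 0 : 0)`. -/
def IsZ4Marked {k K : Type*} [Field k] [Field K] [Algebra k K] {W : WeierstrassCurve k} {e : k}
    (T : W.toAffine.Point) (φ : Iso k (curve K W) (z4Curve K e)) : Prop :=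
  (φ.toEquiv (ratPoint K W 0) : PSpace K 3) =
    Projectivization.mk K ![1, 0, 0, 1] (fun h => one_ne_zero (congrFun h 0)) ∧
  (φ.toEquiv (ratPoint K W T) : PSpace K 3) =
    Projectivization.mk K ![1, 1, 0, 0] (fun h => one_ne_zero (congrFun h 0))

/-- The isomorphism `ψ` from the elliptic curve `W` to `C_c` sends the identity to
`(c : 1 : 0 : 1)` and `T` to `(1 : c : 1 : 0)`. -/
def IsMu4Marked {k K : Type*} [Field k] [Field K] [Algebra k K] {W : WeierstrassCurve k} {c : k}
    (T : W.toAffine.Point) (ψ : Iso k (curve K W) (mu4Curve K c)) : Prop :=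
  (ψ.toEquiv (ratPoint K W 0) : PSpace K 3) =
    Projectivization.mk K ![algebraMap k K c, 1, 0, 1] (fun h => one_ne_zero (congrFun h 1)) ∧
  (ψ.toEquiv (ratPoint K W T) : PSpace K 3) =
    Projectivization.mk K ![1, algebraMap k K c, 1, 0] (fun h => one_ne_zero (congrFun h 0))

/-! ## Symmetric quartic models in `ℙ³` -/

/-- The homogeneous prime ideal of a point `P = (v₀ : … : vₙ)`: the polynomials `f` with
`f(v₀ t, …, vₙ t) = 0` in `K[t]`, i.e. all of whose homogeneous components vanish at `P`. -/
def pointIdeal {K : Type*} [Field K] {n : ℕ} (P : PSpace K n) :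
    Ideal (MvPolynomial (Fin (n + 1)) K) :=
  RingHom.ker (aeval (fun i => Polynomial.C (P.rep i) * Polynomial.X) :
    MvPolynomial (Fin (n + 1)) K →ₐ[K] Polynomial K)

/-- The homogeneous ideal of a set of points of `ℙⁿ`. -/
def homogeneousIdeal {K : Type*} [Field K] {n : ℕ} (Y : Set (PSpace K n)) :
    Ideal (MvPolynomial (Fin (n + 1)) K) :=
  ⨅ P ∈ Y, pointIdeal P

/-- The multiplicity at `P ∈ Y` of the zero of the form `F` on the smooth curve `Y`: the largest
`r` such that, in the local ring at `P`, `F` lies in the `r`-th power of the maximal ideal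
modulo the equations of `Y` (and `⊤` if `F` vanishes on `Y` near `P`). -/
def multiplicityAt {K : Type*} [Field K] {n : ℕ} (Y : Set (PSpace K n)) (P : PSpace K n)
    (F : MvPolynomial (Fin (n + 1)) K) : ℕ∞ :=
  ⨆ (r : ℕ) (_ : ∃ s, s ∉ pointIdeal P ∧ s * F ∈ homogeneousIdeal Y ⊔ pointIdeal P ^ r), (r : ℕ∞)

/-- The linear form with coefficients `a`. -/
def linearForm {K : Type*} [Field K] {n : ℕ} (a : Fin (n + 1) → K) :
    MvPolynomial (Fin (n + 1)) K :=
  ∑ i, C (a i) * X i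

/-- A smooth genus one curve `Y ⊆ ℙ³` is a quartic model, embedded with respect to a complete
linear system of degree `4`, if it is contained in no plane and every plane meets it in exactly
four points, counted with multiplicities. -/
structure IsQuarticModel {K : Type*} [Field K] (Y : Set (PSpace K 3)) : Prop where
  nondegenerate : ∀ a : Fin 4 → K, a ≠ 0 → ∃ P ∈ Y, linearForm a ∉ pointIdeal P
  degree_eq : ∀ a : Fin 4 → K, a ≠ 0 → ∑ᶠ P : Y, multiplicityAt Y P (linearForm a) = 4

/-- The embedding `ι` of the elliptic curve `W` onto `Y ⊆ ℙ³` is symmetric: `[-1]` is induced by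
a projective linear transformation of `ℙ³` (which may have coefficients in `K`). -/
def IsSymmetric {k K : Type*} [Field k] [Field K] [Algebra k K] {W : WeierstrassCurve k}
    {Y : Set (PSpace K 3)} (ι : Iso k (curve K W) Y) : Prop :=
  ∃ B : Matrix.GeneralLinearGroup (Fin 4) K, ∀ P : (W.baseChange K).toAffine.Point,
    (ι.toEquiv (geomPoint K W (-P)) : PSpace K 3) = linAut B (ι.toEquiv (geomPoint K W P))

/-- The isomorphism `φ` from `W` to `Z ⊆ ℙ³` is induced, with respect to the embedding `ι` of `W`
onto `Y ⊆ ℙ³`, by a linear automorphism of `ℙ³` over `k`. -/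
def IsInducedByLinear {k K : Type*} [Field k] [Field K] [Algebra k K] {W : WeierstrassCurve k}
    {Y Z : Set (PSpace K 3)} (ι : Iso k (curve K W) Y) (φ : Iso k (curve K W) Z) : Prop :=
  ∃ A : Matrix.GeneralLinearGroup (Fin 4) k, ∀ P : curve K W,
    (φ.toEquiv P : PSpace K 3) =
      linAut (Matrix.GeneralLinearGroup.map (algebraMap k K) A) (ι.toEquiv P)

end NormalForm

end

/-! Everything reduces to one curve. In characteristic 2 a Weierstrass curve with a rational point T
of order 4 can be brought to the form y² + e x y = x³ + e² with T = (e, e), and j = c⁸ corresponds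
to e = c² (`exists_variableChange`). Its only point of order two is S = (0, e) = 2T, and the divisor
of x is 2S − 2O.

The coordinates of the split μ₄-form are a basis of L(4O), the span of 1, x, y, x². Those of the
ℤ/4ℤ-form are a basis of L(3O + S), which multiplication by x turns into L(5O − S). The isomorphisms
are therefore explicit: several tuples of forms in each direction, whose compatibility and mutual
inversion are polynomial identities modulo the equations (`exists_iso_mu4Curve`,
`exists_iso_z4Curve`).

Two isomorphisms with the same markings differ by an automorphism of the model that fixes O and T.
It acts on the affine coordinate ring and preserves pole orders at O, so x ↦ a x + b and y ↦ α y + β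
x + γ. The curve equation leaves only x ↦ x, y ↦ y + β x, and fixing T gives β = 0
(`algEquiv_modelCurve`, `eq_refl_of_modelCurve`).

For a quartic model, the four coordinates of ℙ³ pull back to functions f_i in the coordinate ring R,
generating an ideal I with N = dim R/I. The ring R is Dedekind and dim R/(w) is the pole order of w,
so the pole order of a combination w of the f_i is N plus the number of its further affine zeros.
The latter are bounded by the multiplicities of a plane section, hence by 4
(`le_multiplicityAt_of_dehom_mem_pow`, `sum_count_le_four`). Three linear conditions on four
coefficients produce a w of pole order at most N + 1, which identifies the class of plane sections
as that of 4O or of 3O + Q for an affine point Q (`exists_generator_of_isQuarticModel`).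

If [−1] is linear, it preserves this class, so Q = −Q because distinct points have distinct ideal
classes (`eq_negY_of_symmetric`); thus Q = S. Up to a common factor, the f_i are then linear
combinations over K of the coordinates of one of the two normal forms (`exists_relation`). A
k-linear functional K → k applied to the coefficients makes the transformation rational over k
(`isInducedByLinear_of_relation`). -/

noncomputable section

namespace NormalForm

open WeierstrassCurve.Affine (CoordinateRing)
open WeierstrassCurve.Affine.CoordinateRing (XYIdeal XIdeal XClass YClass)

/-! ### Morphisms of projective sets given by tuples of forms -/

section Forms

variable {k K : Type*} [Field k] [Field K] [Algebra k K]

/-- Proportionality of two vectors. -/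
def Prop2 {n : ℕ} (v w : Fin n → K) : Prop := ∀ i j, v i * w j = v j * w i

lemma Prop2.symm {n : ℕ} {v w : Fin n → K} (h : Prop2 v w) : Prop2 w v := fun i j => by
  linear_combination -(h i j)

lemma prop2_self {n : ℕ} (v : Fin n → K) : Prop2 v v := fun _ _ => mul_comm _ _

lemma exists_apply_ne_zero {n : ℕ} {v : Fin n → K} (hv : v ≠ 0) : ∃ i, v i ≠ 0 := by
  by_contra! h
  exact hv (funext h)

lemma Prop2.exists_smul {n : ℕ} {v w : Fin n → K} (h : Prop2 v w) (hw : w ≠ 0) :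
    ∃ t : K, t • w = v := by
  obtain ⟨i, hi⟩ := exists_apply_ne_zero hw
  refine ⟨v i / w i, funext fun j => ?_⟩
  have := h i j
  simp only [Pi.smul_apply, smul_eq_mul]
  field_simp
  linear_combination this

lemma mk_eq_mk_iff_prop2 {n : ℕ} {v w : Fin (n + 1) → K} (hv : v ≠ 0) (hw : w ≠ 0) :
    (Projectivization.mk K v hv : PSpace K n) = Projectivization.mk K w hw ↔ Prop2 v w := by
  rw [Projectivization.mk_eq_mk_iff']
  constructor
  · rintro ⟨t, rfl⟩ i j
    simp only [Pi.smul_apply, smul_eq_mul]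
    ring
  · exact fun h => h.exists_smul hw

lemma aeval_smul_of_isHomogeneous {σ S : Type*} [CommRing S] [Algebra k S] {F : MvPolynomial σ k}
    {d : ℕ} (hF : F.IsHomogeneous d) (t : S) (v : σ → S) :
    aeval (t • v) F = t ^ d * aeval v F := by
  classical
  rw [aeval_def, aeval_def, eval₂_eq, eval₂_eq, Finset.mul_sum]
  refine Finset.sum_congr rfl fun m hm => ?_
  have h1 : ∑ i ∈ m.support, m i = d := by
    have := hF (mem_support_iff.1 hm)
    rw [← this, Finsupp.weight_apply, Finsupp.sum]
    simp
  simp only [Pi.smul_apply, smul_eq_mul, mul_pow, Finset.prod_mul_distrib,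
    Finset.prod_pow_eq_pow_sum, h1]
  ring

/-- The values of a tuple of polynomials at a vector. -/
def evalTuple {m n : ℕ} (p : Fin n → MvPolynomial (Fin m) k) (v : Fin m → K) : Fin n → K :=
  fun i => aeval v (p i)

lemma evalTuple_smul {m n : ℕ} {p : Fin n → MvPolynomial (Fin m) k} {d : ℕ}
    (hp : ∀ i, (p i).IsHomogeneous d) (t : K) (v : Fin m → K) :
    evalTuple p (t • v) = t ^ d • evalTuple p v :=
  funext fun i => aeval_smul_of_isHomogeneous (hp i) t v

lemma exists_rep_eq {n : ℕ} {v : Fin (n + 1) → K} (hv : v ≠ 0) :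
    ∃ t : K, t ≠ 0 ∧ (Projectivization.mk K v hv : PSpace K n).rep = t • v := by
  obtain ⟨a, ha⟩ := Projectivization.exists_smul_eq_mk_rep K v hv
  exact ⟨a, a.ne_zero, ha.symm⟩

lemma mk_mem_zeroLocus {n m : ℕ} {F : Fin m → MvPolynomial (Fin (n + 1)) k} {d : Fin m → ℕ}
    (hF : ∀ j, (F j).IsHomogeneous (d j)) {v : Fin (n + 1) → K} (hv : v ≠ 0) :
    Projectivization.mk K v hv ∈ zeroLocus K F ↔ ∀ j, aeval v (F j) = 0 := by
  obtain ⟨t, ht, h⟩ := exists_rep_eq hv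
  simp only [zeroLocus, Set.mem_ofPred_eq, h, aeval_smul_of_isHomogeneous (hF _), mul_eq_zero,
    pow_eq_zero_iff', ht, false_and, false_or]

/-- The tuple of forms `p` of degree `d` describes the map `φ` wherever it does not vanish. -/
structure Represents {m n : ℕ} {X : Set (PSpace K m)} {Y : Set (PSpace K n)} (φ : X → Y) (d : ℕ)
    (p : Fin (n + 1) → MvPolynomial (Fin (m + 1)) k) : Prop where
  isHomogeneous : ∀ i, (p i).IsHomogeneous d
  eq_mk : ∀ (v : Fin (m + 1) → K) (hv : v ≠ 0) (hX : Projectivization.mk K v hv ∈ X)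
    (h : evalTuple p v ≠ 0), (φ ⟨_, hX⟩ : PSpace K n) = Projectivization.mk K _ h

/-- Homogeneity makes the choice of representatives immaterial. This version, with arbitrary nonzero
vectors, is the one that explicit computations can use. -/
lemma isMorphism_iff {m n : ℕ} {X : Set (PSpace K m)} {Y : Set (PSpace K n)} {φ : X → Y} :
    IsMorphism k φ ↔ ∀ (v : Fin (m + 1) → K) (hv : v ≠ 0), Projectivization.mk K v hv ∈ X →
      ∃ (d : ℕ) (p : Fin (n + 1) → MvPolynomial (Fin (m + 1)) k),
        Represents φ d p ∧ evalTuple p v ≠ 0 := by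
  constructor
  · intro h v hv hX
    obtain ⟨d, p, hp, h0, h1⟩ := h ⟨_, hX⟩
    refine ⟨d, p, ⟨hp, fun w hw hwX hpw => ?_⟩, ?_⟩
    · obtain ⟨t, ht, hrep⟩ := exists_rep_eq hw
      have h2 : evalTuple p (Projectivization.mk K w hw : PSpace K m).rep ≠ 0 := by
        rw [hrep, evalTuple_smul hp]
        exact smul_ne_zero (pow_ne_zero _ ht) hpw
      refine (h1 ⟨_, hwX⟩ h2).trans ((mk_eq_mk_iff_prop2 _ _).2 fun i j => ?_)
      change evalTuple p (Projectivization.mk K w hw : PSpace K m).rep i * _ =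
        evalTuple p (Projectivization.mk K w hw : PSpace K m).rep j * _
      rw [hrep, evalTuple_smul hp]
      simp only [Pi.smul_apply, smul_eq_mul]
      ring
    · obtain ⟨t, ht, hrep⟩ := exists_rep_eq hv
      intro h3
      apply h0
      change evalTuple p (Projectivization.mk K v hv : PSpace K m).rep = 0
      rw [hrep, evalTuple_smul hp, h3, smul_zero]
  · intro h P
    obtain ⟨d, p, hp, h0⟩ := h (P : PSpace K m).rep (Projectivization.rep_nonzero _)
      (by rw [Projectivization.mk_rep]; exact P.2)
    refine ⟨d, p, hp.isHomogeneous, h0, fun Q hQ => ?_⟩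
    have := hp.eq_mk (Q : PSpace K m).rep (Projectivization.rep_nonzero _)
      (by rw [Projectivization.mk_rep]; exact Q.2) hQ
    simp only [Projectivization.mk_rep] at this
    exact this

lemma aeval_evalTuple {m n : ℕ} (p : Fin n → MvPolynomial (Fin m) k) (v : Fin m → K)
    (F : MvPolynomial (Fin n) k) : aeval (evalTuple p v) F = aeval v (aeval p F) := by
  have : (aeval (evalTuple p v) : MvPolynomial (Fin n) k →ₐ[k] K) =
      (aeval v).comp (aeval p) := by
    ext i
    simp [evalTuple]
  rw [this]
  rfl

/-- The composition of two tuples of polynomials. -/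
def compTuple {l m n : ℕ} (q : Fin n → MvPolynomial (Fin m) k)
    (p : Fin m → MvPolynomial (Fin l) k) : Fin n → MvPolynomial (Fin l) k :=
  fun i => aeval p (q i)

lemma evalTuple_compTuple {l m n : ℕ} (q : Fin n → MvPolynomial (Fin m) k)
    (p : Fin m → MvPolynomial (Fin l) k) (v : Fin l → K) :
    evalTuple (compTuple q p) v = evalTuple q (evalTuple p v) :=
  funext fun i => (aeval_evalTuple p v (q i)).symm

lemma Represents.comp {l m n : ℕ} {X : Set (PSpace K l)} {Y : Set (PSpace K m)}
    {Z : Set (PSpace K n)} {φ : X → Y} {ψ : Y → Z} {d d' : ℕ}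
    {p : Fin (m + 1) → MvPolynomial (Fin (l + 1)) k}
    {q : Fin (n + 1) → MvPolynomial (Fin (m + 1)) k}
    (hψ : Represents ψ d' q) (hφ : Represents φ d p) {v : Fin (l + 1) → K} (hv : v ≠ 0)
    (hX : Projectivization.mk K v hv ∈ X) (hp : evalTuple p v ≠ 0)
    (h : evalTuple (compTuple q p) v ≠ 0) :
    (ψ (φ ⟨_, hX⟩) : PSpace K n) = Projectivization.mk K _ h := by
  have h1 := hφ.eq_mk v hv hX hp
  have h2 : Projectivization.mk K _ hp ∈ Y := h1 ▸ (φ ⟨_, hX⟩).2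
  have h3 : φ ⟨_, hX⟩ = ⟨_, h2⟩ := Subtype.ext h1
  have h4 : evalTuple q (evalTuple p v) ≠ 0 := by rwa [← evalTuple_compTuple]
  rw [h3, hψ.eq_mk _ hp h2 h4]
  congr 1
  exact (evalTuple_compTuple q p v).symm

lemma IsMorphism.comp {l m n : ℕ} {X : Set (PSpace K l)} {Y : Set (PSpace K m)}
    {Z : Set (PSpace K n)} {ψ : Y → Z} {φ : X → Y} (hψ : IsMorphism k ψ) (hφ : IsMorphism k φ) :
    IsMorphism k (ψ ∘ φ) := by
  rw [isMorphism_iff] at *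
  intro v hv hX
  obtain ⟨d, p, hp, hp0⟩ := hφ v hv hX
  have h1 := hp.eq_mk v hv hX hp0
  obtain ⟨d', q, hq, hq0⟩ := hψ (evalTuple p v) hp0 (h1 ▸ (φ ⟨_, hX⟩).2)
  obtain ⟨j, hj⟩ := exists_apply_ne_zero hp0
  have hval : ∀ w : Fin (l + 1) → K, evalTuple (fun i => p j * compTuple q p i) w =
      evalTuple p w j • evalTuple (compTuple q p) w := fun w => by
    ext i
    simp [evalTuple]
  -- The tuple `compTuple q p` alone could be nonzero where `p` vanishes, namely when `d' = 0`. The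
  -- factor `p j` excludes such points from the domain of the tuple.
  refine ⟨d + d * d', fun i => p j * compTuple q p i,
    ⟨fun i => (hp.isHomogeneous j).mul ((hq.isHomogeneous i).aeval _ hp.isHomogeneous),
      fun w hw hwX hw0 => ?_⟩, ?_⟩
  · rw [hval] at hw0
    obtain ⟨h2, h3⟩ := smul_ne_zero_iff.1 hw0
    rw [Function.comp_apply, hq.comp hp hw hwX (fun h => h2 (congrFun h j)) h3,
      mk_eq_mk_iff_prop2, hval]
    intro i i'
    simp only [Pi.smul_apply, smul_eq_mul]
    ring
  · rw [hval, evalTuple_compTuple]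
    exact smul_ne_zero hj hq0

lemma exists_eq_mk {n : ℕ} {Z : Set (PSpace K n)} (P : Z) :
    ∃ (v : Fin (n + 1) → K) (hv : v ≠ 0) (hZ : Projectivization.mk K v hv ∈ Z),
      P = ⟨Projectivization.mk K v hv, hZ⟩ := by
  have h := Projectivization.mk_rep (P : PSpace K n)
  exact ⟨_, Projectivization.rep_nonzero _, h.symm ▸ P.2, Subtype.ext h.symm⟩

lemma Represents.comp_eq_self {m n : ℕ} {X : Set (PSpace K m)} {Y : Set (PSpace K n)}
    {φ : X → Y} {ψ : Y → X} {d d' : ℕ} {p : Fin (n + 1) → MvPolynomial (Fin (m + 1)) k}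
    {q : Fin (m + 1) → MvPolynomial (Fin (n + 1)) k} (hψ : Represents ψ d' q)
    (hφ : Represents φ d p) {v : Fin (m + 1) → K} (hv : v ≠ 0)
    (hX : Projectivization.mk K v hv ∈ X) (hp : evalTuple p v ≠ 0)
    (hq : evalTuple q (evalTuple p v) ≠ 0) (h : Prop2 (evalTuple q (evalTuple p v)) v) :
    ψ (φ ⟨_, hX⟩) = ⟨_, hX⟩ := by
  rw [← evalTuple_compTuple] at hq h
  exact Subtype.ext ((hψ.comp hφ hv hX hp hq).trans ((mk_eq_mk_iff_prop2 _ _).2 h))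

/-- The inverse of an isomorphism. -/
def Iso.symm {m n : ℕ} {X : Set (PSpace K m)} {Y : Set (PSpace K n)} (φ : Iso k X Y) :
    Iso k Y X :=
  ⟨φ.toEquiv.symm, φ.isMorphism_invFun, φ.isMorphism_toFun⟩

/-- The composition of two isomorphisms. -/
def Iso.trans {l m n : ℕ} {X : Set (PSpace K l)} {Y : Set (PSpace K m)} {Z : Set (PSpace K n)}
    (φ : Iso k X Y) (ψ : Iso k Y Z) : Iso k X Z :=
  ⟨φ.toEquiv.trans ψ.toEquiv, ψ.isMorphism_toFun.comp φ.isMorphism_toFun,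
    φ.isMorphism_invFun.comp ψ.isMorphism_invFun⟩

/-- A family of tuples of forms (indexed by `J`) that glue to a map from `X` to `Y`. -/
structure IsAtlas {m n : ℕ} (X : Set (PSpace K m)) (Y : Set (PSpace K n)) {J : Type*} (d : J → ℕ)
    (p : J → Fin (n + 1) → MvPolynomial (Fin (m + 1)) k) : Prop where
  isHomogeneous : ∀ j i, (p j i).IsHomogeneous (d j)
  covers : ∀ (v : Fin (m + 1) → K) (hv : v ≠ 0), Projectivization.mk K v hv ∈ X →
    ∃ j, evalTuple (p j) v ≠ 0
  compatible : ∀ (v : Fin (m + 1) → K) (hv : v ≠ 0), Projectivization.mk K v hv ∈ X →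
    ∀ j j', Prop2 (evalTuple (p j) v) (evalTuple (p j') v)
  mapsTo : ∀ (v : Fin (m + 1) → K) (hv : v ≠ 0), Projectivization.mk K v hv ∈ X →
    ∀ j (h : evalTuple (p j) v ≠ 0), Projectivization.mk K _ h ∈ Y

lemma IsAtlas.exists_map {m n : ℕ} {X : Set (PSpace K m)} {Y : Set (PSpace K n)} {J : Type*}
    {d : J → ℕ} {p : J → Fin (n + 1) → MvPolynomial (Fin (m + 1)) k} (h : IsAtlas X Y d p) :
    ∃ φ : X → Y, IsMorphism k φ ∧ ∀ j, Represents φ (d j) (p j) := by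
  have key : ∀ P : X, ∃ j, evalTuple (p j) (P : PSpace K m).rep ≠ 0 := fun P =>
    h.covers _ (Projectivization.rep_nonzero _) (by rw [Projectivization.mk_rep]; exact P.2)
  choose j hj using key
  let φ : X → Y := fun P => ⟨Projectivization.mk K _ (hj P),
    h.mapsTo _ (Projectivization.rep_nonzero _) (by rw [Projectivization.mk_rep]; exact P.2) _ _⟩
  have hrep : ∀ j, Represents φ (d j) (p j) := by
    refine fun i => ⟨h.isHomogeneous i, fun v hv hX h0 => ?_⟩
    obtain ⟨t, ht, hr⟩ := exists_rep_eq hv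
    change (Projectivization.mk K _ (hj ⟨_, hX⟩) : PSpace K n) = _
    rw [mk_eq_mk_iff_prop2]
    have h1 := hj ⟨_, hX⟩
    simp only [hr, evalTuple_smul (h.isHomogeneous _)] at h1 ⊢
    intro a b
    have := h.compatible v hv hX (j ⟨_, hX⟩) i a b
    simp only [Pi.smul_apply, smul_eq_mul]
    linear_combination t ^ d (j ⟨_, hX⟩) * this
  refine ⟨φ, isMorphism_iff.2 fun v hv hX => ?_, hrep⟩
  obtain ⟨i, hi⟩ := h.covers v hv hX
  exact ⟨d i, p i, hrep i, hi⟩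

lemma IsAtlas.exists_iso {m n : ℕ} {X : Set (PSpace K m)} {Y : Set (PSpace K n)} {J J' : Type*}
    {d : J → ℕ} {p : J → Fin (n + 1) → MvPolynomial (Fin (m + 1)) k}
    {d' : J' → ℕ} {q : J' → Fin (m + 1) → MvPolynomial (Fin (n + 1)) k}
    (h : IsAtlas X Y d p) (h' : IsAtlas Y X d' q)
    (hqp : ∀ (v : Fin (m + 1) → K) (hv : v ≠ 0), Projectivization.mk K v hv ∈ X →
      ∃ j l, evalTuple (p j) v ≠ 0 ∧ evalTuple (q l) (evalTuple (p j) v) ≠ 0 ∧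
        Prop2 (evalTuple (q l) (evalTuple (p j) v)) v)
    (hpq : ∀ (v : Fin (n + 1) → K) (hv : v ≠ 0), Projectivization.mk K v hv ∈ Y →
      ∃ j l, evalTuple (q j) v ≠ 0 ∧ evalTuple (p l) (evalTuple (q j) v) ≠ 0 ∧
        Prop2 (evalTuple (p l) (evalTuple (q j) v)) v) :
    ∃ φ : Iso k X Y, ∀ j, Represents φ.toEquiv (d j) (p j) := by
  obtain ⟨φ, hφ, hφr⟩ := h.exists_map
  obtain ⟨ψ, hψ, hψr⟩ := h'.exists_map
  refine ⟨⟨⟨φ, ψ, fun P => ?_, fun P => ?_⟩, hφ, hψ⟩, hφr⟩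
  · obtain ⟨v, hv, hX, rfl⟩ := exists_eq_mk P
    obtain ⟨j, l, h1, h2, h3⟩ := hqp v hv hX
    exact (hψr l).comp_eq_self (hφr j) hv hX h1 h2 h3
  · obtain ⟨v, hv, hX, rfl⟩ := exists_eq_mk P
    obtain ⟨j, l, h1, h2, h3⟩ := hpq v hv hX
    exact (hφr l).comp_eq_self (hψr j) hv hX h1 h2 h3

end Forms

/-! ### The affine coordinate ring: points, evaluation, pole orders -/

section CoordinateRing

variable {K : Type*} [Field K] {W : WeierstrassCurve.Affine K}

variable (W) in
/-- The coordinate function `x`. -/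
def xFun : W.CoordinateRing := CoordinateRing.mk W (Polynomial.C Polynomial.X)

variable (W) in
/-- The coordinate function `y`. -/
def yFun : W.CoordinateRing := CoordinateRing.mk W Polynomial.X

lemma algebraMap_eq_mk (a : K) : algebraMap K W.CoordinateRing a =
    CoordinateRing.mk W (Polynomial.C (Polynomial.C a)) := rfl

lemma smul_one_eq_aeval (p : Polynomial K) :
    p • (1 : W.CoordinateRing) = Polynomial.aeval (xFun W) p := by
  induction p using Polynomial.induction_on' with
  | add p q hp hq => rw [add_smul, hp, hq, map_add]
  | monomial n a =>
    rw [Polynomial.aeval_monomial, CoordinateRing.smul, mul_one, xFun, algebraMap_eq_mk, ← map_pow,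
      ← map_mul, ← Polynomial.C_pow, ← Polynomial.C_mul, Polynomial.C_mul_X_pow_eq_monomial]

lemma smul_basis_eq_aeval (p q : Polynomial K) :
    p • (1 : W.CoordinateRing) + q • CoordinateRing.mk W Polynomial.X =
      Polynomial.aeval (xFun W) p + Polynomial.aeval (xFun W) q * yFun W := by
  rw [← smul_one_eq_aeval, ← smul_one_eq_aeval, smul_mul_assoc, one_mul, yFun]

lemma exists_eq_aeval (f : W.CoordinateRing) : ∃ p q : Polynomial K,
    f = Polynomial.aeval (xFun W) p + Polynomial.aeval (xFun W) q * yFun W := by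
  obtain ⟨p, q, rfl⟩ := CoordinateRing.exists_smul_basis_eq f
  exact ⟨p, q, smul_basis_eq_aeval p q⟩

lemma algHom_ext_xy {A : Type*} [CommRing A] [Algebra K A] {g h : W.CoordinateRing →ₐ[K] A}
    (hx : g (xFun W) = h (xFun W)) (hy : g (yFun W) = h (yFun W)) : g = h := by
  refine AlgHom.ext fun f => ?_
  obtain ⟨p, q, rfl⟩ := exists_eq_aeval f
  simp only [map_add, map_mul, ← Polynomial.aeval_algHom_apply, hx, hy]

lemma equation_xy : yFun W ^ 2 + algebraMap K _ W.a₁ * xFun W * yFun W +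
    algebraMap K _ W.a₃ * yFun W = xFun W ^ 3 + algebraMap K _ W.a₂ * xFun W ^ 2 +
    algebraMap K _ W.a₄ * xFun W + algebraMap K _ W.a₆ := by
  have h : CoordinateRing.mk W (Polynomial.X ^ 2 +
      Polynomial.C (Polynomial.C W.a₁ * Polynomial.X + Polynomial.C W.a₃) * Polynomial.X -
      Polynomial.C (Polynomial.X ^ 3 + Polynomial.C W.a₂ * Polynomial.X ^ 2 +
        Polynomial.C W.a₄ * Polynomial.X + Polynomial.C W.a₆)) = 0 := AdjoinRoot.mk_self
  simp only [map_add, map_sub, map_mul, map_pow] at h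
  simp only [xFun, yFun, algebraMap_eq_mk]
  linear_combination h

/-- Evaluation of functions at an affine point. -/
def evalAt {x y : K} (h : W.Equation x y) : W.CoordinateRing →ₐ[K] K :=
  (CoordinateRing.quotientXYIdealEquiv (y := Polynomial.C y) h : _ →ₐ[K] K).comp
    (Ideal.Quotient.mkₐ K (XYIdeal W x (Polynomial.C y)))

lemma evalAt_eq_zero_iff {x y : K} (h : W.Equation x y) (f : W.CoordinateRing) :
    evalAt h f = 0 ↔ f ∈ XYIdeal W x (Polynomial.C y) := by
  simp [evalAt, Ideal.Quotient.eq_zero_iff_mem]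

lemma XClass_eq (x : K) : XClass W x = xFun W - algebraMap K _ x := by
  simp [XClass, xFun, algebraMap_eq_mk]

lemma YClass_eq (y : K) : YClass W (Polynomial.C y) = yFun W - algebraMap K _ y := by
  simp [YClass, yFun, algebraMap_eq_mk]

@[simp]
lemma evalAt_xFun {x y : K} (h : W.Equation x y) : evalAt h (xFun W) = x := by
  have : evalAt h (XClass W x) = 0 := (evalAt_eq_zero_iff h _).2 (Ideal.subset_span (by simp))
  rw [XClass_eq, map_sub, AlgHom.commutes, sub_eq_zero] at this
  simpa using this

@[simp]
lemma evalAt_yFun {x y : K} (h : W.Equation x y) : evalAt h (yFun W) = y := by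
  have : evalAt h (YClass W (Polynomial.C y)) = 0 :=
    (evalAt_eq_zero_iff h _).2 (Ideal.subset_span (by simp))
  rw [YClass_eq, map_sub, AlgHom.commutes, sub_eq_zero] at this
  simpa using this

lemma isMaximal_XYIdeal {x y : K} (h : W.Equation x y) :
    (XYIdeal W x (Polynomial.C y)).IsMaximal := by
  have : XYIdeal W x (Polynomial.C y) = RingHom.ker (evalAt h) := by
    ext f
    rw [RingHom.mem_ker, evalAt_eq_zero_iff]
  rw [this]
  exact RingHom.ker_isMaximal_of_surjective _ fun a => ⟨algebraMap K _ a, AlgHom.commutes _ a⟩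

lemma equation_of_algHom (g : W.CoordinateRing →ₐ[K] K) :
    W.Equation (g (xFun W)) (g (yFun W)) := by
  have h := congrArg g (equation_xy (W := W))
  simp only [map_add, map_mul, map_pow, AlgHom.commutes] at h
  rw [WeierstrassCurve.Affine.equation_iff]
  exact h

instance : Module.Finite (Polynomial K) W.CoordinateRing :=
  Module.Finite.of_basis (CoordinateRing.basis W)

instance : Algebra.FiniteType K W.CoordinateRing :=
  Algebra.FiniteType.trans (S := Polynomial K) inferInstance inferInstance

instance : IsNoetherianRing W.CoordinateRing := Algebra.FiniteType.isNoetherianRing K _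

/-- The Nullstellensatz: the residue field is finite over the algebraically closed field `K`, hence
equal to `K`, and the quotient map is evaluation at the images of x and y. -/
lemma exists_eq_XYIdeal_of_isMaximal [IsAlgClosed K] (M : Ideal W.CoordinateRing)
    [hM : M.IsMaximal] : ∃ x y, W.Equation x y ∧ M = XYIdeal W x (Polynomial.C y) := by
  let _ : Field (W.CoordinateRing ⧸ M) := Ideal.Quotient.field M
  have h1 : Module.Finite K (W.CoordinateRing ⧸ M) := finite_of_finite_type_of_isJacobsonRing _ _
  have h2 : Function.Bijective (algebraMap K (W.CoordinateRing ⧸ M)) :=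
    IsAlgClosed.algebraMap_bijective_of_isIntegral
  let e : K ≃ₐ[K] (W.CoordinateRing ⧸ M) := AlgEquiv.ofBijective (Algebra.ofId _ _) h2
  let g : W.CoordinateRing →ₐ[K] K := (e.symm : _ →ₐ[K] K).comp (Ideal.Quotient.mkₐ K M)
  have hg : g = evalAt (equation_of_algHom g) := algHom_ext_xy (by simp) (by simp)
  refine ⟨_, _, equation_of_algHom g, ?_⟩
  ext f
  rw [← evalAt_eq_zero_iff (equation_of_algHom g), ← hg]
  simp [g, Ideal.Quotient.eq_zero_iff_mem]

lemma exists_le_XYIdeal [IsAlgClosed K] {J : Ideal W.CoordinateRing} (hJ : J ≠ ⊤) :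
    ∃ x y, W.Equation x y ∧ J ≤ XYIdeal W x (Polynomial.C y) := by
  obtain ⟨M, hM, hJM⟩ := Ideal.exists_le_maximal J hJ
  obtain ⟨x, y, h, rfl⟩ := exists_eq_XYIdeal_of_isMaximal M
  exact ⟨x, y, h, hJM⟩

/-- The coordinate ring is a Jacobson domain, so its maximal ideals, which are the ideals of points,
intersect in zero. Identities between functions can thus be checked at points. -/
lemma eq_zero_of_forall_evalAt [IsAlgClosed K] {f : W.CoordinateRing}
    (hf : ∀ x y (h : W.Equation x y), evalAt h f = 0) : f = 0 := by
  have h1 : IsJacobsonRing W.CoordinateRing := isJacobsonRing_of_finiteType (A := K)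
  have h2 : (⊥ : Ideal W.CoordinateRing).jacobson = ⊥ :=
    h1.out (Ideal.isPrime_bot).isRadical
  rw [← Ideal.mem_bot, ← h2, Ideal.jacobson, Ideal.mem_sInf]
  rintro M ⟨-, hM⟩
  obtain ⟨x, y, h, rfl⟩ := exists_eq_XYIdeal_of_isMaximal M
  exact (evalAt_eq_zero_iff h f).1 (hf x y h)

/-! ### Pole orders at infinity -/

/-- The order of the pole at infinity of a function, as the degree of its norm to `K[x]`. -/
def poleOrder (f : W.CoordinateRing) : ℕ := (Algebra.norm (Polynomial K) f).natDegree

/-- The basis elements xⁱ and xⁱ y have pole orders 2i and 2i + 3. These are pairwise distinct, so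
leading terms cannot cancel. -/
lemma poleOrder_le_iff {p q : Polynomial K} {n : ℕ} :
    poleOrder (Polynomial.aeval (xFun W) p + Polynomial.aeval (xFun W) q * yFun W) ≤ n ↔
      (∀ i, n < 2 * i → p.coeff i = 0) ∧ ∀ i, n < 2 * i + 3 → q.coeff i = 0 := by
  rw [poleOrder, ← smul_basis_eq_aeval, Polynomial.natDegree_le_iff_degree_le,
    CoordinateRing.degree_norm_smul_basis, max_le_iff]
  have hp : ∀ (p : Polynomial K) (d : ℕ), 2 • p.degree + (d : WithBot ℕ) ≤ n ↔
      ∀ i, n < 2 * i + d → p.coeff i = 0 := by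
    intro p d
    by_cases h0 : p = 0
    · simp [h0]
    · rw [Polynomial.degree_eq_natDegree h0, nsmul_eq_mul]
      constructor
      · intro h i hi
        have h' : 2 * p.natDegree + d ≤ n := by exact_mod_cast h
        exact Polynomial.coeff_eq_zero_of_natDegree_lt (by omega)
      · intro h
        have h' : 2 * p.natDegree + d ≤ n := by
          by_contra! hlt
          exact h0 (Polynomial.leadingCoeff_eq_zero.1 (h _ hlt))
        exact_mod_cast h'
  have h0 := hp p 0
  have h3 := hp q 3
  simp only [Nat.cast_zero, add_zero] at h0
  exact and_congr h0 h3

variable (W) in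
/-- The coefficient of a function in pole order `n`, with respect to the basis `xⁱ`, `xⁱ y`. -/
def poleCoeff (n : ℕ) : W.CoordinateRing →ₗ[K] K :=
  if Even n then Polynomial.lcoeff K (n / 2) ∘ₗ
    ((CoordinateRing.basis W).coord 0).restrictScalars K
  -- No basis element has pole order one; without this case the truncated subtraction below would
  -- return the coefficient of y.
  else if n = 1 then 0
  else Polynomial.lcoeff K ((n - 3) / 2) ∘ₗ ((CoordinateRing.basis W).coord 1).restrictScalars K

lemma coord_aeval (p q : Polynomial K) :
    (CoordinateRing.basis W).coord 0
      (Polynomial.aeval (xFun W) p + Polynomial.aeval (xFun W) q * yFun W) = p ∧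
    (CoordinateRing.basis W).coord 1
      (Polynomial.aeval (xFun W) p + Polynomial.aeval (xFun W) q * yFun W) = q := by
  rw [← smul_basis_eq_aeval, ← CoordinateRing.basis_zero, ← CoordinateRing.basis_one]
  simp only [map_add, map_smul, Module.Basis.coord_apply, Module.Basis.repr_self]
  simp

lemma poleOrder_le_iff_poleCoeff {f : W.CoordinateRing} {n : ℕ} :
    poleOrder f ≤ n ↔ ∀ m, n < m → poleCoeff W m f = 0 := by
  obtain ⟨p, q, rfl⟩ := exists_eq_aeval f
  rw [poleOrder_le_iff]
  obtain ⟨h0, h1⟩ := coord_aeval (W := W) p q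
  have key : ∀ m, poleCoeff W m
      (Polynomial.aeval (xFun W) p + Polynomial.aeval (xFun W) q * yFun W) =
      if Even m then p.coeff (m / 2) else if m = 1 then 0 else q.coeff ((m - 3) / 2) := by
    intro m
    unfold poleCoeff
    split_ifs
    · simp only [LinearMap.comp_apply, LinearMap.restrictScalars_apply, h0, Polynomial.lcoeff_apply]
    · rfl
    · simp only [LinearMap.comp_apply, LinearMap.restrictScalars_apply, h1, Polynomial.lcoeff_apply]
  constructor
  · rintro ⟨hp, hq⟩ m hm
    rw [key]
    split_ifs with he h1
    · obtain ⟨i, rfl⟩ := he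
      exact hp _ (by omega)
    · rfl
    · rw [Nat.not_even_iff_odd] at he
      obtain ⟨i, rfl⟩ := he
      exact hq _ (by omega)
  · intro h
    constructor
    · intro i hi
      have := h _ hi
      rwa [key, if_pos (even_two_mul i), Nat.mul_div_cancel_left _ two_pos] at this
    · intro i hi
      have := h _ hi
      rwa [key, if_neg (by rw [Nat.not_even_iff_odd]; exact ⟨i + 1, by ring⟩), if_neg (by omega),
        Nat.add_sub_cancel, Nat.mul_div_cancel_left _ two_pos] at this

/-- The affine zeros of a function, counted with multiplicity, are as many as its poles at infinity:
principal divisors have degree zero. -/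
lemma finrank_quotient_span_singleton {f : W.CoordinateRing} (hf : f ≠ 0) :
    Module.finrank K (W.CoordinateRing ⧸ Ideal.span {f}) = poleOrder f :=
  finrank_quotient_span_eq_natDegree_norm (CoordinateRing.basis W) hf

lemma poleOrder_mul {f g : W.CoordinateRing} (hf : f ≠ 0) (hg : g ≠ 0) :
    poleOrder (f * g) = poleOrder f + poleOrder g := by
  rw [poleOrder, map_mul, Polynomial.natDegree_mul] <;> first
    | rfl | rwa [Ne, Algebra.norm_eq_zero_iff]

lemma exists_eq_algebraMap_of_poleOrder_eq_zero {f : W.CoordinateRing} (h : poleOrder f = 0) :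
    ∃ a, f = algebraMap K _ a := by
  obtain ⟨p, q, rfl⟩ := exists_eq_aeval f
  obtain ⟨hp, hq⟩ := poleOrder_le_iff.1 h.le
  have h1 : p = Polynomial.C (p.coeff 0) := by
    ext i
    rcases i with _ | i
    · simp
    · rw [hp _ (by omega), Polynomial.coeff_C_succ]
  have h2 : q = 0 := by
    ext i
    rw [hq _ (by omega), Polynomial.coeff_zero]
  exact ⟨p.coeff 0, by rw [h2, h1]; simp⟩

/-- A positive `finrank` implies finiteness, but the value zero does not. In pole order zero the
function is a nonzero constant and the quotient is trivial. -/
lemma finite_quotient_span_singleton {f : W.CoordinateRing} (hf : f ≠ 0) :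
    Module.Finite K (W.CoordinateRing ⧸ Ideal.span {f}) := by
  rcases Nat.eq_zero_or_pos (poleOrder f) with h | h
  · obtain ⟨a, rfl⟩ := exists_eq_algebraMap_of_poleOrder_eq_zero h
    have ha : a ≠ 0 := by
      rintro rfl
      exact hf (map_zero _)
    have : Ideal.span {algebraMap K W.CoordinateRing a} = ⊤ :=
      Ideal.span_singleton_eq_top.2 ((isUnit_iff_ne_zero.2 ha).map _)
    rw [this]
    infer_instance
  · exact FiniteDimensional.of_finrank_pos (by rwa [finrank_quotient_span_singleton hf])

lemma finite_quotient {I : Ideal W.CoordinateRing} (hI : I ≠ ⊥) :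
    Module.Finite K (W.CoordinateRing ⧸ I) := by
  obtain ⟨f, hf, h0⟩ := Submodule.exists_mem_ne_zero_of_ne_bot hI
  have := finite_quotient_span_singleton h0
  exact Module.Finite.of_surjective
    (Ideal.Quotient.factorₐ K ((Ideal.span_singleton_le_iff_mem I).2 hf)).toLinearMap
    (Ideal.Quotient.factor_surjective ((Ideal.span_singleton_le_iff_mem I).2 hf))

end CoordinateRing

lemma exists_eq_span_singleton_mul_of_le {R : Type*} [CommRing R] {L : Ideal R} {g : R}
    (h : L ≤ Ideal.span {g}) : ∃ J, L = Ideal.span {g} * J := by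
  refine ⟨Submodule.comap (LinearMap.mulLeft R g) L, le_antisymm (fun z hz => ?_) ?_⟩
  · obtain ⟨t, rfl⟩ := Ideal.mem_span_singleton'.1 (h hz)
    rw [Ideal.mem_span_singleton_mul]
    exact ⟨t, by simpa [mul_comm] using hz, mul_comm _ _⟩
  · rw [Ideal.span_singleton_mul_le_iff]
    exact fun z hz => hz

/-- Nakayama's lemma: some r ≡ 1 modulo m annihilates J, and r is not zero because m is proper. In a
domain this forces J = 0. -/
lemma eq_bot_of_le_mul {R : Type*} [CommRing R] [IsDomain R] [IsNoetherianRing R] {J m : Ideal R}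
    (hm : m ≠ ⊤) (h : J ≤ J * m) : J = ⊥ := by
  obtain ⟨r, hr, h0⟩ := Submodule.exists_sub_one_mem_and_smul_eq_zero_of_fg_of_le_smul m J
    (IsNoetherian.noetherian J) (by rwa [smul_eq_mul, mul_comm])
  rw [eq_bot_iff]
  intro n hn
  rcases mul_eq_zero.1 (h0 n hn) with h1 | h1
  · exact absurd (m.eq_top_iff_one.2 (by simpa [h1] using m.neg_mem hr)) hm
  · exact h1

/-! ### The coordinate ring of an elliptic curve is a Dedekind domain -/

section Dedekind

variable {K : Type*} [Field K] [IsAlgClosed K] {W : WeierstrassCurve.Affine K}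
  [WeierstrassCurve.IsElliptic W]

/-- Noetherian induction, with the step supplied by the group law: if J lies in the ideal m of a
point P, and m' is the ideal of −P, then m m' is generated by g = x − x(P). Hence J m' = g J₁ for an
ideal J₁ that contains J, strictly by Nakayama, and an inverse of J₁ up to principal ideals gives
one of J. -/
lemma exists_mul_eq_span_singleton (J : Ideal W.CoordinateRing) (hJ : J ≠ ⊥) :
    ∃ (J' : Ideal W.CoordinateRing) (g : W.CoordinateRing), g ≠ 0 ∧ J * J' = Ideal.span {g} := by
  induction J using IsNoetherian.induction with
  | hgt J ih =>
  by_cases htop : J = ⊤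
  · exact ⟨⊤, 1, one_ne_zero, by rw [htop, Ideal.span_singleton_one, Ideal.mul_top]⟩
  obtain ⟨x, y, h, hle⟩ := exists_le_XYIdeal htop
  have hns := (WeierstrassCurve.Affine.equation_iff_nonsingular).1 h
  have hmul := CoordinateRing.XYIdeal_neg_mul hns
  have hx0 := CoordinateRing.XClass_ne_zero (W' := W) x
  have hmt := (isMaximal_XYIdeal h).ne_top
  change _ = Ideal.span _ at hmul
  have hgm' : XClass W x ∈ XYIdeal W x (Polynomial.C (W.negY x y)) :=
    Ideal.subset_span (Set.mem_insert _ _)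
  generalize XYIdeal W x (Polynomial.C y) = m at hmul hle hmt
  generalize XYIdeal W x (Polynomial.C (W.negY x y)) = m' at hmul hgm'
  generalize XClass W x = g at hmul hgm' hx0
  obtain ⟨J₁, hJ₁⟩ := exists_eq_span_singleton_mul_of_le (L := J * m') (g := g)
    (by rw [← hmul, mul_comm m']; exact Ideal.mul_mono_left hle)
  have hle1 : J ≤ J₁ := by
    rw [← Ideal.span_singleton_mul_right_mono hx0, ← hJ₁, mul_comm]
    exact Ideal.mul_mono_right ((Ideal.span_singleton_le_iff_mem _).2 hgm')
  have hlt : J < J₁ := by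
    refine lt_of_le_of_ne hle1 fun heq => hJ (eq_bot_of_le_mul hmt ?_)
    rw [← Ideal.span_singleton_mul_right_mono hx0]
    calc Ideal.span {g} * J = J * m' * m := by rw [mul_assoc, hmul, mul_comm]
      _ = Ideal.span {g} * (J * m) := by rw [hJ₁, ← heq, mul_assoc]
      _ ≤ _ := le_rfl
  obtain ⟨J', g', hg', h'⟩ := ih J₁ hlt (ne_bot_of_gt hlt)
  refine ⟨m' * J', g * g', mul_ne_zero hx0 hg', ?_⟩
  rw [← mul_assoc, hJ₁, mul_assoc, h', Ideal.span_singleton_mul_span_singleton]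

instance : IsDedekindDomain W.CoordinateRing := by
  rw [isDedekindDomain_iff_mul_inv_cancel (K := W.FunctionField)]
  intro I hI
  obtain ⟨a, J, ha, rfl⟩ := FractionalIdeal.exists_eq_spanSingleton_mul I
  have hJ : J ≠ ⊥ := by
    rintro rfl
    exact hI (by simp)
  obtain ⟨J', g, hg, h⟩ := exists_mul_eq_span_singleton J hJ
  rw [FractionalIdeal.mul_inv_cancel_iff]
  have ha' : algebraMap W.CoordinateRing W.FunctionField a ≠ 0 :=
    (map_ne_zero_iff _ (FaithfulSMul.algebraMap_injective _ _)).2 ha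
  have hg' : algebraMap W.CoordinateRing W.FunctionField g ≠ 0 :=
    (map_ne_zero_iff _ (FaithfulSMul.algebraMap_injective _ _)).2 hg
  refine ⟨FractionalIdeal.spanSingleton _ (algebraMap _ _ a * (algebraMap _ _ g)⁻¹) *
    (J' : FractionalIdeal _ _), ?_⟩
  rw [mul_mul_mul_comm, ← FractionalIdeal.coeIdeal_mul, h, FractionalIdeal.coeIdeal_span_singleton,
    FractionalIdeal.spanSingleton_mul_spanSingleton,
    FractionalIdeal.spanSingleton_mul_spanSingleton, ← FractionalIdeal.spanSingleton_one]
  congr 1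
  field_simp

/-- No ideal lies strictly between I m and I, so any element a of I outside I m generates I modulo I
m. As s a ≡ s(P) a modulo I m, the quotient I / I m is the line spanned by a. -/
lemma finrank_quotient_mul_XYIdeal {I : Ideal W.CoordinateRing} (hI : I ≠ ⊥) {x y : K}
    (h : W.Equation x y) :
    Module.finrank K (W.CoordinateRing ⧸ I * XYIdeal W x (Polynomial.C y)) =
      Module.finrank K (W.CoordinateRing ⧸ I) + 1 := by
  have hmax := isMaximal_XYIdeal h
  have heval := evalAt_eq_zero_iff h
  generalize XYIdeal W x (Polynomial.C y) = m at hmax heval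
  have hm : m ≠ ⊥ := by
    rintro rfl
    have h1 := (heval _).1 (show evalAt h (xFun W - algebraMap K _ x) = 0 by simp)
    rw [← XClass_eq, Ideal.mem_bot] at h1
    exact CoordinateRing.XClass_ne_zero x h1
  have hlt : I * m < I := lt_of_le_of_ne Ideal.mul_le_left fun h1 =>
    hI (eq_bot_of_le_mul hmax.ne_top h1.ge)
  obtain ⟨a, haI, ha⟩ := Set.exists_of_ssubset hlt
  have hspan : Ideal.span {a} ⊔ I * m = I := by
    obtain ⟨J', hJ'⟩ : I ∣ Ideal.span {a} ⊔ I * m := Ideal.dvd_iff_le.2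
      (sup_le ((Ideal.span_singleton_le_iff_mem _).2 haI) hlt.le)
    have h2 : m ≤ J' := by
      rw [← Ideal.dvd_iff_le, ← mul_dvd_mul_iff_left hI, ← hJ', Ideal.dvd_iff_le]
      exact le_sup_right
    by_cases h3 : J' = ⊤
    · rw [hJ', h3, Ideal.mul_top]
    · rw [← hmax.eq_of_le h3 h2] at hJ'
      exact absurd (hJ' ▸ (le_sup_left : _ ≤ Ideal.span {a} ⊔ I * m)
        (Ideal.mem_span_singleton_self a)) ha
  have hfin := finite_quotient (mul_ne_zero hI hm : I * m ≠ ⊥)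
  have hrn := LinearMap.finrank_range_add_finrank_ker
    (Ideal.Quotient.factorₐ K hlt.le).toLinearMap
  rw [LinearMap.range_eq_top.2 (Ideal.Quotient.factor_surjective hlt.le), finrank_top] at hrn
  rw [← hrn]
  congr 1
  have hker : (Ideal.Quotient.factorₐ K hlt.le).toLinearMap.ker =
      Submodule.span K {Ideal.Quotient.mk (I * m) a} := by
    refine le_antisymm (fun r hr => ?_) ?_
    · obtain ⟨r, rfl⟩ := Ideal.Quotient.mk_surjective r
      have hr' : r ∈ I := by simpa [Ideal.Quotient.eq_zero_iff_mem] using hr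
      rw [← hspan, Submodule.mem_sup] at hr'
      obtain ⟨b, hb, t, ht, rfl⟩ := hr'
      obtain ⟨s, rfl⟩ := Ideal.mem_span_singleton'.1 hb
      rw [Submodule.mem_span_singleton]
      refine ⟨evalAt h s, ?_⟩
      rw [← Ideal.Quotient.mkₐ_eq_mk K, ← map_smul, Ideal.Quotient.mkₐ_eq_mk, Ideal.Quotient.eq]
      have h3 : algebraMap K _ (evalAt h s) - s ∈ m := (heval _).1 (by simp)
      have h4 := (I * m).sub_mem (Ideal.mul_mem_mul haI h3) ht
      convert h4 using 1
      rw [Algebra.smul_def]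
      ring
    · rw [Submodule.span_singleton_le_iff_mem, LinearMap.mem_ker]
      simpa [Ideal.Quotient.eq_zero_iff_mem] using haI
  rw [hker, finrank_span_singleton]
  rwa [Ne, Ideal.Quotient.eq_zero_iff_mem]

lemma exists_eq_prod_XYIdeal {A : Ideal W.CoordinateRing} (hA : A ≠ ⊥) :
    ∃ s : Multiset (K × K), (∀ P ∈ s, W.Equation P.1 P.2) ∧
      A = (s.map fun P => XYIdeal W P.1 (Polynomial.C P.2)).prod := by
  induction A using UniqueFactorizationMonoid.induction_on_prime with
  | h₁ => exact absurd rfl hA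
  | h₂ A hu => exact ⟨0, by simp, by simpa using hu⟩
  | h₃ A p h0 hp ih =>
    obtain ⟨s, hs, rfl⟩ := ih h0
    have hp' := Ideal.isPrime_of_prime hp
    have hmax := hp'.isMaximal hp.ne_zero
    obtain ⟨x, y, h, rfl⟩ := exists_eq_XYIdeal_of_isMaximal p
    refine ⟨(x, y) ::ₘ s, ?_, by simp⟩
    simpa using ⟨h, fun a b => hs (a, b)⟩

lemma finrank_quotient_mul_prod_XYIdeal {I : Ideal W.CoordinateRing} (hI : I ≠ ⊥)
    {s : Multiset (K × K)} (hs : ∀ P ∈ s, W.Equation P.1 P.2)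
    (h0 : (s.map fun P => XYIdeal W P.1 (Polynomial.C P.2)).prod ≠ ⊥) :
    Module.finrank K (W.CoordinateRing ⧸ I * (s.map fun P => XYIdeal W P.1 (Polynomial.C P.2)).prod)
      = Module.finrank K (W.CoordinateRing ⧸ I) + s.card := by
  induction s using Multiset.induction with
  | empty => rw [Multiset.map_zero, Multiset.prod_zero, mul_one, Multiset.card_zero, add_zero]
  | cons P s ih =>
    rw [Multiset.map_cons, Multiset.prod_cons] at h0 ⊢
    have h1 := right_ne_zero_of_mul h0
    rw [mul_comm (XYIdeal W P.1 _), ← mul_assoc, finrank_quotient_mul_XYIdeal (mul_ne_zero hI h1)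
      (hs P (Multiset.mem_cons_self _ _)), ih (fun Q hQ => hs Q (Multiset.mem_cons_of_mem hQ)) h1,
      Multiset.card_cons, add_assoc]

/-- A principal ideal contained in `I` is the product of `I` and the ideals of finitely many
points, whose number is determined by the pole order of the generator. -/
lemma exists_span_singleton_eq_mul_prod {I : Ideal W.CoordinateRing} {w : W.CoordinateRing}
    (hw : w ∈ I) (h0 : w ≠ 0) :
    ∃ s : Multiset (K × K), (∀ P ∈ s, W.Equation P.1 P.2) ∧
      Ideal.span {w} = I * (s.map fun P => XYIdeal W P.1 (Polynomial.C P.2)).prod ∧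
      poleOrder w = Module.finrank K (W.CoordinateRing ⧸ I) + s.card := by
  obtain ⟨A, hA⟩ := Ideal.dvd_iff_le.2 ((Ideal.span_singleton_le_iff_mem I).2 hw)
  have h1 : I * A ≠ 0 := by
    rw [← hA]
    simpa using h0
  have hI := left_ne_zero_of_mul h1
  have hA0 := right_ne_zero_of_mul h1
  obtain ⟨s, hs, rfl⟩ := exists_eq_prod_XYIdeal hA0
  refine ⟨s, hs, hA, ?_⟩
  rw [← finrank_quotient_mul_prod_XYIdeal hI hs hA0, ← hA, finrank_quotient_span_singleton h0]

end Dedekind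

/-! ### A criterion for homogeneity -/

section Homogeneity

variable {k : Type*} [Field k] {σ : Type*}

/-- Substituting T Xᵢ for Xᵢ sorts the monomials by degree. The resulting criterion reduces the
homogeneity of explicit forms to a polynomial identity. -/
lemma coeff_coeff_aeval_scale (p : MvPolynomial σ k) (n : ℕ) (m : σ →₀ ℕ) :
    coeff m ((aeval (fun i => Polynomial.X * Polynomial.C (X i)) p :
      Polynomial (MvPolynomial σ k)).coeff n) = if m.degree = n then coeff m p else 0 := by
  classical
  induction p using MvPolynomial.induction_on' with
  | monomial u a =>
    have : (aeval (fun i => Polynomial.X * Polynomial.C (X i)) (monomial u a) :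
      Polynomial (MvPolynomial σ k)) = Polynomial.C (monomial u a) * Polynomial.X ^ u.degree := by
      rw [aeval_monomial, monomial_eq (s := u), Finsupp.prod]
      simp only [mul_pow, Finset.prod_mul_distrib, Finset.prod_pow_eq_pow_sum, map_mul,
        Finsupp.prod, map_prod, map_pow, Finsupp.degree]
      rw [mul_comm (Polynomial.X ^ _), mul_assoc]
      rfl
    rw [this, Polynomial.coeff_C_mul, Polynomial.coeff_X_pow, mul_ite, mul_one, mul_zero]
    by_cases hm : u = m
    · subst hm
      simp only [eq_comm (a := n)]
      split_ifs <;> simp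
    · split_ifs <;> simp [coeff_monomial, hm]
  | add p q hp hq =>
    rw [map_add, Polynomial.coeff_add, coeff_add, hp, hq, coeff_add]
    split_ifs <;> simp

lemma weight_one_apply (m : σ →₀ ℕ) : Finsupp.weight (1 : σ → ℕ) m = m.degree :=
  (DFunLike.congr_fun (Finsupp.degree_eq_weight_one (R := ℕ)) m).symm

/-- A polynomial that is multiplied by `tᵈ` when its variables are multiplied by `t` is homogeneous
of degree `d`. -/
lemma isHomogeneous_of_aeval_scale {p : MvPolynomial σ k} {d : ℕ}
    (h : (aeval (fun i => Polynomial.X * Polynomial.C (X i)) p :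
      Polynomial (MvPolynomial σ k)) = Polynomial.X ^ d * Polynomial.C p) : p.IsHomogeneous d := by
  intro m hm
  have h1 := coeff_coeff_aeval_scale p m.degree m
  rw [h, Polynomial.coeff_X_pow_mul', if_pos rfl] at h1
  rw [weight_one_apply]
  by_contra hne
  apply hm
  rw [← h1]
  split_ifs with hle
  · rw [Polynomial.coeff_C_of_ne_zero, coeff_zero]
    change m.degree ≠ d at hne
    omega
  · rw [coeff_zero]

lemma aeval_C_scale (a : k) : (aeval (fun i => Polynomial.X * Polynomial.C (X i))
    (C a : MvPolynomial σ k) : Polynomial (MvPolynomial σ k)) = Polynomial.C (C a) := by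
  rw [aeval_C]; rfl

end Homogeneity

/-! ### Points of a plane Weierstrass curve -/

section CurvePoints

variable {k K : Type*} [Field k] [Field K] [Algebra k K] {W : WeierstrassCurve k}

lemma isHomogeneous_polynomial : W.toProjective.polynomial.IsHomogeneous 3 := by
  apply isHomogeneous_of_aeval_scale
  simp only [WeierstrassCurve.Projective.polynomial, map_add, map_sub, map_mul, map_pow, aeval_X,
    aeval_C_scale]
  ring

lemma mk_mem_curve_iff {v : Fin 3 → K} (hv : v ≠ 0) :
    Projectivization.mk K v hv ∈ curve K W ↔ v 1 ^ 2 * v 2 + algebraMap k K W.a₁ * v 0 * v 1 * v 2 +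
      algebraMap k K W.a₃ * v 1 * v 2 ^ 2 = v 0 ^ 3 + algebraMap k K W.a₂ * v 0 ^ 2 * v 2 +
      algebraMap k K W.a₄ * v 0 * v 2 ^ 2 + algebraMap k K W.a₆ * v 2 ^ 3 := by
  rw [curve, mk_mem_zeroLocus (d := fun _ => 3) fun _ => isHomogeneous_polynomial]
  simp [WeierstrassCurve.Projective.polynomial, sub_eq_zero]

lemma affine_ne_zero (x y : K) : (![x, y, 1] : Fin 3 → K) ≠ 0 :=
  fun h => one_ne_zero (congrFun h 2)

lemma infinity_ne_zero : (![0, 1, 0] : Fin 3 → K) ≠ 0 := fun h => one_ne_zero (congrFun h 1)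

lemma affine_mem_curve_iff {x y : K} :
    Projectivization.mk K ![x, y, 1] (affine_ne_zero x y) ∈ curve K W ↔
      (W.baseChange K).toAffine.Equation x y := by
  rw [mk_mem_curve_iff, WeierstrassCurve.Affine.equation_iff]
  simp [WeierstrassCurve.baseChange]

lemma infinity_mem_curve :
    Projectivization.mk K ![0, 1, 0] infinity_ne_zero ∈ curve K W := by
  rw [mk_mem_curve_iff]
  simp

/-- The points of a plane Weierstrass curve: the point at infinity and the affine points. -/
lemma eq_infinity_or_affine {v : Fin 3 → K} (hv : v ≠ 0)
    (h : Projectivization.mk K v hv ∈ curve K W) :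
    (∃ t : K, t ≠ 0 ∧ v = t • ![0, 1, 0]) ∨
      ∃ t : K, t ≠ 0 ∧ ∃ x y, (W.baseChange K).toAffine.Equation x y ∧ v = t • ![x, y, 1] := by
  have h1 := (mk_mem_curve_iff hv).1 h
  by_cases h2 : v 2 = 0
  · left
    have h0 : v 0 = 0 := by
      simpa [h2] using h1.symm
    refine ⟨v 1, fun h3 => hv ?_, ?_⟩
    · ext i
      fin_cases i <;> assumption
    · ext i
      fin_cases i <;> simp [h0, h2]
  · right
    have h3 : v = v 2 • ![v 0 / v 2, v 1 / v 2, 1] := by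
      ext i
      fin_cases i <;> simp <;> field_simp
    refine ⟨v 2, h2, v 0 / v 2, v 1 / v 2, ?_, h3⟩
    rw [← affine_mem_curve_iff]
    convert h using 1
    rw [mk_eq_mk_iff_prop2]
    conv => arg 2; rw [h3]
    intro i j
    simp only [Pi.smul_apply]
    ring

lemma infinity_or_affine (P : curve K W) :
    P = ⟨Projectivization.mk K ![0, 1, 0] infinity_ne_zero, infinity_mem_curve⟩ ∨
      ∃ x y, ∃ h : (W.baseChange K).toAffine.Equation x y,
        P = ⟨Projectivization.mk K ![x, y, 1] (affine_ne_zero x y), affine_mem_curve_iff.2 h⟩ := by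
  obtain ⟨v, hv, hX, rfl⟩ := exists_eq_mk P
  rcases eq_infinity_or_affine hv hX with ⟨t, ht, h⟩ | ⟨t, ht, x, y, hxy, h⟩
  · left
    rw [Subtype.mk.injEq, mk_eq_mk_iff_prop2, h]
    intro i j
    simp only [Pi.smul_apply]
    ring
  · right
    refine ⟨x, y, hxy, ?_⟩
    rw [Subtype.mk.injEq, mk_eq_mk_iff_prop2, h]
    intro i j
    simp only [Pi.smul_apply]
    ring

end CurvePoints

/-! ### Restriction of forms to the affine curve -/

section Dehomogenization

variable {K : Type*} [Field K] {W : WeierstrassCurve.Affine K}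

variable (W) in
/-- The restriction of a form to the affine part of a plane Weierstrass curve. -/
def dehom : MvPolynomial (Fin 3) K →ₐ[K] W.CoordinateRing := aeval ![xFun W, yFun W, 1]

lemma evalAt_dehom {x y : K} (h : W.Equation x y) (F : MvPolynomial (Fin 3) K) :
    evalAt h (dehom W F) = aeval ![x, y, 1] F := by
  have : (evalAt h).comp (dehom W) = aeval ![x, y, 1] := by
    ext i
    fin_cases i <;> simp [dehom]
  rw [← this]
  rfl

lemma poleOrder_xFun : poleOrder (xFun W) = 2 := by
  have h := fun n => poleOrder_le_iff (W := W) (p := Polynomial.X) (q := 0) (n := n)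
  simp only [Polynomial.aeval_X, map_zero, zero_mul, add_zero, Polynomial.coeff_zero,
    implies_true, and_true] at h
  refine le_antisymm ((h 2).2 fun i hi => Polynomial.coeff_X_of_ne_one (by omega)) ?_
  by_contra! hlt
  simpa using (h 1).1 (by omega) 1 (by omega)

lemma poleOrder_yFun : poleOrder (yFun W) = 3 := by
  have h := fun n => poleOrder_le_iff (W := W) (p := 0) (q := 1) (n := n)
  simp only [map_one, map_zero, one_mul, zero_add, Polynomial.coeff_zero,
    implies_true, true_and] at h
  refine le_antisymm ((h 3).2 fun i hi => ?_) ?_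
  · rw [Polynomial.coeff_one, if_neg (by omega)]
  by_contra! hlt
  simpa using (h 2).1 (by omega) 0 (by omega)

lemma xFun_ne_zero : xFun W ≠ 0 := fun h => by
  have := poleOrder_xFun (W := W)
  simp [h, poleOrder] at this

lemma yFun_ne_zero : yFun W ≠ 0 := fun h => by
  have := poleOrder_yFun (W := W)
  simp [h, poleOrder] at this

lemma poleOrder_one : poleOrder (1 : W.CoordinateRing) = 0 := by
  simp [poleOrder]

lemma poleOrder_pow {f : W.CoordinateRing} (hf : f ≠ 0) (n : ℕ) :
    poleOrder (f ^ n) = n * poleOrder f := by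
  induction n with
  | zero => simp [poleOrder_one]
  | succ n ih => rw [pow_succ, poleOrder_mul (pow_ne_zero _ hf) hf, ih]; ring

lemma poleOrder_monomial (i j : ℕ) : poleOrder (xFun W ^ i * yFun W ^ j) = 2 * i + 3 * j := by
  rw [poleOrder_mul (pow_ne_zero _ xFun_ne_zero) (pow_ne_zero _ yFun_ne_zero),
    poleOrder_pow xFun_ne_zero, poleOrder_pow yFun_ne_zero, poleOrder_xFun, poleOrder_yFun]
  ring

lemma poleCoeff_poleOrder_ne_zero {f : W.CoordinateRing} (hf : f ≠ 0) :
    poleCoeff W (poleOrder f) f ≠ 0 := by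
  intro h
  have h1 : ∀ m, poleOrder f ≤ m → poleCoeff W m f = 0 := fun m hm => by
    rcases hm.eq_or_lt with rfl | hm
    · exact h
    · exact poleOrder_le_iff_poleCoeff.1 le_rfl m hm
  rcases Nat.eq_zero_or_pos (poleOrder f) with h0 | h0
  · obtain ⟨a, rfl⟩ := exists_eq_algebraMap_of_poleOrder_eq_zero h0
    rw [h0] at h
    have h2 := (coord_aeval (W := W) (Polynomial.C a) 0).1
    rw [map_zero, zero_mul, add_zero, Polynomial.aeval_C] at h2
    simp only [poleCoeff, Even.zero, if_true, LinearMap.comp_apply,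
      LinearMap.restrictScalars_apply, h2, Polynomial.lcoeff_apply] at h
    simp at h
    exact hf (by rw [h, map_zero])
  · have := poleOrder_le_iff_poleCoeff.2 (fun m (hm : poleOrder f - 1 < m) => h1 m (by omega))
    omega

/-- A form that vanishes on the affine part of a Weierstrass curve vanishes at infinity. -/
lemma aeval_infinity_eq_zero {F : MvPolynomial (Fin 3) K} {d : ℕ} (hF : F.IsHomogeneous d)
    (h : dehom W F = 0) : aeval (![0, 1, 0] : Fin 3 → K) F = 0 := by
  -- Among the monomials of degree d in X, Y, Z, only Yᵈ restricts to a function of pole order 3d,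
  -- and only Yᵈ is nonzero at (0 : 1 : 0). The coefficient in pole order 3d therefore records the
  -- value at infinity.
  have key : poleCoeff W (3 * d) (dehom W F) =
      aeval (![0, 1, 0] : Fin 3 → K) F * poleCoeff W (3 * d) (yFun W ^ d) := by
    conv_lhs => rw [F.as_sum]
    conv_rhs => rw [F.as_sum]
    simp only [map_sum, Finset.sum_mul]
    refine Finset.sum_congr rfl fun m hm => ?_
    have hd : m 0 + m 1 + m 2 = d := by
      have := hF (mem_support_iff.1 hm)
      rw [weight_one_apply] at this
      rw [← this, Finsupp.degree_eq_sum, Fin.sum_univ_three]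
    have h1 : dehom W (monomial m (coeff m F)) = coeff m F • (xFun W ^ m 0 * yFun W ^ m 1) := by
      rw [dehom, aeval_monomial, Algebra.smul_def, Finsupp.prod_fintype _ _ (fun i => pow_zero _)]
      simp [Fin.prod_univ_three]
    have h2 : aeval (![0, 1, 0] : Fin 3 → K) (monomial m (coeff m F)) =
        coeff m F * (0 ^ m 0 * 0 ^ m 2) := by
      rw [aeval_monomial, Finsupp.prod_fintype _ _ (fun i => pow_zero _)]
      simp [Fin.prod_univ_three]
    rw [h1, h2, map_smul, smul_eq_mul, mul_assoc]
    congr 1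
    by_cases h0 : m 0 = 0 ∧ m 2 = 0
    · have : m 1 = d := by omega
      simp [h0.1, h0.2, this]
    · have h3 : (0 : K) ^ m 0 * 0 ^ m 2 = 0 := by
        rw [not_and_or] at h0
        rcases h0 with h0 | h0 <;> simp [zero_pow h0]
      rw [h3, zero_mul]
      refine poleOrder_le_iff_poleCoeff.1 le_rfl _ ?_
      rw [poleOrder_monomial]
      omega
  rw [h, map_zero] at key
  have h1 := poleCoeff_poleOrder_ne_zero (pow_ne_zero d (yFun_ne_zero (W := W)))
  rw [poleOrder_pow yFun_ne_zero, poleOrder_yFun, mul_comm d] at h1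
  exact (mul_eq_zero.1 key.symm).resolve_right h1

lemma aeval_eq_zero_of_dehom_eq_zero {F : MvPolynomial (Fin 3) K} {d : ℕ} (hF : F.IsHomogeneous d)
    (h : dehom W F = 0) {v : Fin 3 → K} (hv : v ≠ 0)
    (hX : Projectivization.mk K v hv ∈ curve K W) : aeval v F = 0 := by
  rcases eq_infinity_or_affine hv hX with ⟨t, ht, rfl⟩ | ⟨t, ht, x, y, hxy, rfl⟩
  · rw [aeval_smul_of_isHomogeneous hF, aeval_infinity_eq_zero hF h, mul_zero]
  · have hxy' : W.Equation x y := by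
      simpa [WeierstrassCurve.baseChange] using hxy
    rw [aeval_smul_of_isHomogeneous hF, ← evalAt_dehom hxy', h, map_zero, mul_zero]

end Dehomogenization

/-! ### Ideals of points and lower bounds for multiplicities -/

section PointIdeal

variable {K : Type*} [Field K] {n : ℕ}

lemma mem_pointIdeal_iff {w : Fin (n + 1) → K} (hw : w ≠ 0) {F : MvPolynomial (Fin (n + 1)) K}
    {d : ℕ} (hF : F.IsHomogeneous d) :
    F ∈ pointIdeal (Projectivization.mk K w hw : PSpace K n) ↔ aeval w F = 0 := by
  obtain ⟨t, ht, h⟩ := exists_rep_eq hw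
  have h1 : (fun i => Polynomial.C ((Projectivization.mk K w hw : PSpace K n).rep i) *
      Polynomial.X) = (Polynomial.C t * Polynomial.X) • fun i => Polynomial.C (w i) := by
    rw [h]
    ext1 i
    simp only [Pi.smul_apply, smul_eq_mul, map_mul]
    ring
  have h2 : aeval (fun i => Polynomial.C (w i)) F = Polynomial.C (aeval w F) := by
    have : (aeval (fun i => Polynomial.C (w i)) : MvPolynomial (Fin (n + 1)) K →ₐ[K] _) =
        Polynomial.CAlgHom.comp (aeval w) := by
      ext i
      simp
    rw [this]
    rfl
  change aeval _ F = 0 ↔ _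
  rw [h1, aeval_smul_of_isHomogeneous hF, h2, mul_eq_zero, Polynomial.C_eq_zero]
  refine or_iff_right (pow_ne_zero _ (mul_ne_zero ?_ Polynomial.X_ne_zero))
  rwa [Ne, Polynomial.C_eq_zero]

instance isPrime_pointIdeal (P : PSpace K n) : (pointIdeal P).IsPrime :=
  RingHom.ker_isPrime _

lemma mem_homogeneousIdeal {Y : Set (PSpace K n)} {F : MvPolynomial (Fin (n + 1)) K} {d : ℕ}
    (hF : F.IsHomogeneous d)
    (h : ∀ (w : Fin (n + 1) → K) (hw : w ≠ 0), Projectivization.mk K w hw ∈ Y → aeval w F = 0) :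
    F ∈ homogeneousIdeal Y := by
  simp only [homogeneousIdeal, Ideal.mem_iInf]
  intro P hP
  obtain ⟨w, hw, hY, hPw⟩ := exists_eq_mk (⟨P, hP⟩ : Y)
  obtain rfl : P = Projectivization.mk K w hw := congrArg Subtype.val hPw
  exact (mem_pointIdeal_iff hw hF).2 (h w hw hY)

lemma isHomogeneous_linearForm (a : Fin (n + 1) → K) : (linearForm a).IsHomogeneous 1 := by
  refine IsHomogeneous.sum _ _ _ fun i _ => ?_
  simpa using (isHomogeneous_C (Fin (n + 1)) (a i)).mul (isHomogeneous_X K i)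

lemma aeval_linearForm {S : Type*} [CommRing S] [Algebra K S] (a : Fin (n + 1) → K)
    (v : Fin (n + 1) → S) : aeval v (linearForm a) = ∑ i, a i • v i := by
  simp [linearForm, Algebra.smul_def]

lemma le_multiplicityAt {Y : Set (PSpace K n)} {P : PSpace K n}
    {F s : MvPolynomial (Fin (n + 1)) K} {r : ℕ} (hs : s ∉ pointIdeal P)
    (h : s * F ∈ homogeneousIdeal Y ⊔ pointIdeal P ^ r) : (r : ℕ∞) ≤ multiplicityAt Y P F :=
  le_iSup₂_of_le r ⟨s, hs, h⟩ le_rfl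

end PointIdeal

/-! ### Orders of vanishing on the Weierstrass curve and multiplicities on its image -/

section Multiplicity

variable {K : Type*} [Field K] {W : WeierstrassCurve K}

lemma exists_algHom {A : Type*} [CommRing A] [Algebra K A] {a b : A}
    (h : b ^ 2 + algebraMap K A W.a₁ * a * b + algebraMap K A W.a₃ * b =
      a ^ 3 + algebraMap K A W.a₂ * a ^ 2 + algebraMap K A W.a₄ * a + algebraMap K A W.a₆) :
    ∃ θ : W.toAffine.CoordinateRing →ₐ[K] A,
      θ (xFun W.toAffine) = a ∧ θ (yFun W.toAffine) = b := by
  have h0 : Polynomial.eval₂ (Polynomial.aeval a : Polynomial K →ₐ[K] A).toRingHom b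
      W.toAffine.polynomial = 0 := by
    simp only [WeierstrassCurve.Affine.polynomial, Polynomial.eval₂_add, Polynomial.eval₂_sub,
      Polynomial.eval₂_mul, Polynomial.eval₂_pow, Polynomial.eval₂_X, Polynomial.eval₂_C, map_add,
      map_mul, map_pow, AlgHom.toRingHom_eq_coe, RingHom.coe_coe, Polynomial.aeval_X,
      Polynomial.aeval_C]
    linear_combination h
  refine ⟨AdjoinRoot.liftAlgHom W.toAffine.polynomial (Polynomial.aeval a) b h0, ?_, ?_⟩
  · exact Eq.trans (AdjoinRoot.liftAlgHom_of _ (Polynomial.aeval a) b h0 _)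
      (Polynomial.aeval_X a)
  · exact AdjoinRoot.liftAlgHom_root _ _ _ _

-- The ring `B` is the localization of `S` at `𝔭` modulo the extension of `I`. Clearing denominators
-- turns membership in a power of its maximal ideal into the condition that defines
-- `multiplicityAt`.
universe u in
lemma exists_local_quotient (k : Type*) [Field k] {S : Type u} [CommRing S] [Algebra k S]
    (I 𝔭 : Ideal S) [𝔭.IsPrime] :
    ∃ (B : Type u) (_ : CommRing B) (_ : Algebra k B) (β : S →ₐ[k] B), (∀ F ∈ I, β F = 0) ∧
      (∀ F, F ∉ 𝔭 → IsUnit (β F)) ∧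
      ∀ F r, β F ∈ (𝔭.map β) ^ r → ∃ s, s ∉ 𝔭 ∧ s * F ∈ I ⊔ 𝔭 ^ r := by
  let A := Localization.AtPrime 𝔭
  refine ⟨A ⧸ I.map (algebraMap S A), inferInstance, inferInstance,
    (Ideal.Quotient.mkₐ k _).comp (IsScalarTower.toAlgHom k S A), fun F hF => ?_, fun F hF => ?_,
    fun F r h => ?_⟩
  · exact Ideal.Quotient.eq_zero_iff_mem.2 (Ideal.mem_map_of_mem _ hF)
  · exact (IsLocalization.map_units A (⟨F, hF⟩ : 𝔭.primeCompl)).map (Ideal.Quotient.mk _)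
  · have h1 : Ideal.Quotient.mk (I.map (algebraMap S A)) (algebraMap S A F) ∈
        ((𝔭 ^ r).map (algebraMap S A)).map (Ideal.Quotient.mk (I.map (algebraMap S A))) := by
      rw [Ideal.map_map, Ideal.map_pow]
      exact h
    rw [Ideal.mem_quotient_iff_mem_sup, sup_comm, ← Ideal.map_sup] at h1
    exact (IsLocalization.algebraMap_mem_map_algebraMap_iff 𝔭.primeCompl A _ _).1 h1

/-- The fractions q₀/q₂ and q₁/q₂ satisfy the Weierstrass equation in B, so they define a
homomorphism θ from the coordinate ring that sends the ideal of (x, y) into the extension of 𝔭.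
Since the Xᵢ are proportional to the pᵢ(q), the linear form is, up to a unit, a multiple of the
image under θ of its pullback, and its order is at least that of the pullback. -/
lemma map_linearForm_mem_pow {n : ℕ} {B : Type*} [CommRing B] [Algebra K B]
    {β : MvPolynomial (Fin (n + 1)) K →ₐ[K] B} {𝔭 : Ideal (MvPolynomial (Fin (n + 1)) K)}
    {q : Fin 3 → MvPolynomial (Fin (n + 1)) K} {p : Fin (n + 1) → MvPolynomial (Fin 3) K}
    {d : ℕ} {x y : K} {j : Fin (n + 1)} {a : Fin (n + 1) → K} {r : ℕ}
    (hp : ∀ i, (p i).IsHomogeneous d) (hW : β (aeval q W.toProjective.polynomial) = 0)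
    (hq2 : IsUnit (β (q 2))) (hx : q 0 - C x * q 2 ∈ 𝔭) (hy : q 1 - C y * q 2 ∈ 𝔭)
    (hcross : ∀ i, β (X j * aeval q (p i)) = β (X i * aeval q (p j)))
    (hpj : IsUnit (β (aeval q (p j))))
    (h : ∑ i, a i • dehom W.toAffine (p i) ∈ XYIdeal W.toAffine x (Polynomial.C y) ^ r) :
    β (linearForm a) ∈ 𝔭.map β ^ r := by
  obtain ⟨u, hu⟩ := hq2
  have hu1 : (u : B) * ↑u⁻¹ = 1 := u.mul_inv
  obtain ⟨θ, hθx, hθy⟩ : ∃ θ : W.toAffine.CoordinateRing →ₐ[K] B,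
      θ (xFun W.toAffine) = β (q 0) * ↑u⁻¹ ∧ θ (yFun W.toAffine) = β (q 1) * ↑u⁻¹ := by
    apply exists_algHom
    simp only [WeierstrassCurve.Projective.polynomial, map_add, map_sub, map_mul, map_pow, aeval_X,
      ← hu, aeval_C, algebraMap_eq] at hW
    have hC : ∀ a, β (C a) = algebraMap K B a := fun a => β.commutes a
    simp only [hC] at hW
    generalize (↑u⁻¹ : B) = v at hu1
    grind
  have hθm : (XYIdeal W.toAffine x (Polynomial.C y)).map θ ≤ 𝔭.map β := by
    rw [XYIdeal, Ideal.map_span, Ideal.span_le]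
    have hC : ∀ a, algebraMap K B a = β (C a) := fun a => (β.commutes a).symm
    rintro _ ⟨f, rfl | rfl, rfl⟩
    · have := Ideal.mul_mem_right (↑u⁻¹ : B) _ (Ideal.mem_map_of_mem β hx)
      rw [map_sub, map_mul, ← hu, sub_mul, mul_assoc, hu1, mul_one] at this
      rwa [XClass_eq, map_sub, hθx, AlgHom.commutes, hC]
    · have := Ideal.mul_mem_right (↑u⁻¹ : B) _ (Ideal.mem_map_of_mem β hy)
      rw [map_sub, map_mul, ← hu, sub_mul, mul_assoc, hu1, mul_one] at this
      rwa [YClass_eq, map_sub, hθy, AlgHom.commutes, hC]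
  have hθp : ∀ i, β (aeval q (p i)) = (u : B) ^ d * θ (dehom W.toAffine (p i)) := by
    intro i
    have h1 : β (aeval q (p i)) = aeval (fun l => β (q l)) (p i) := by
      rw [← AlgHom.comp_apply, comp_aeval]
    have h2 : θ (dehom W.toAffine (p i)) =
        aeval (fun l => θ (![xFun W.toAffine, yFun W.toAffine, 1] l)) (p i) := by
      rw [dehom, ← AlgHom.comp_apply, comp_aeval]
    rw [h1, h2, ← aeval_smul_of_isHomogeneous (hp i)]
    congr 1
    congr 1
    ext l
    fin_cases l
    · simp only [Fin.zero_eta, Matrix.cons_val_zero, Pi.smul_apply, smul_eq_mul, hθx]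
      linear_combination (-β (q 0)) * hu1
    · simp only [Fin.mk_one, Matrix.cons_val_one, Matrix.cons_val_zero, Pi.smul_apply, smul_eq_mul,
        hθy]
      linear_combination (-β (q 1)) * hu1
    · simp [hu]
  have h1 : β (linearForm a) * β (aeval q (p j)) =
      β (X j) * (u : B) ^ d * θ (∑ i, a i • dehom W.toAffine (p i)) := by
    simp only [linearForm, map_sum, map_mul, map_smul, Finset.sum_mul, Finset.mul_sum]
    refine Finset.sum_congr rfl fun i _ => ?_
    have h2 := hcross i
    rw [map_mul, map_mul, hθp i] at h2
    rw [mul_assoc, ← h2, Algebra.smul_def, ← β.commutes]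
    change β (C (a i)) * _ = _ * (β (C (a i)) * _)
    ring
  have h2 : θ (∑ i, a i • dehom W.toAffine (p i)) ∈ 𝔭.map β ^ r := by
    refine Ideal.pow_right_mono hθm r ?_
    rw [← Ideal.map_pow]
    exact Ideal.mem_map_of_mem _ h
  rw [← Ideal.mul_unit_mem_iff_mem _ hpj, h1]
  exact Ideal.mul_mem_left _ _ h2

/-- The order of vanishing of a linear form on a Weierstrass curve `X`, pulled back to `X` along an
isomorphism `ι : X → Y`, is at most the multiplicity of the form on `Y`. -/
lemma le_multiplicityAt_of_dehom_mem_pow {n : ℕ} {Y : Set (PSpace K n)} {ι : curve K W → Y}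
    {κ : Y → curve K W} (hικ : ∀ Q, ι (κ Q) = Q) (hκι : ∀ P, κ (ι P) = P)
    (hκ : IsMorphism K κ) {d : ℕ}
    {p : Fin (n + 1) → MvPolynomial (Fin 3) K} (hp : Represents ι d p) {x y : K}
    (hX : Projectivization.mk K ![x, y, 1] (affine_ne_zero x y) ∈ curve K W)
    (hp0 : evalTuple p ![x, y, 1] ≠ 0) {a : Fin (n + 1) → K} {r : ℕ}
    (h : ∑ i, a i • dehom W.toAffine (p i) ∈ XYIdeal W.toAffine x (Polynomial.C y) ^ r) :
    (r : ℕ∞) ≤ multiplicityAt Y (ι ⟨_, hX⟩) (linearForm a) := by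
  have hιP := hp.eq_mk _ (affine_ne_zero x y) hX hp0
  set w := evalTuple p ![x, y, 1] with hw
  have hwY : Projectivization.mk K w hp0 ∈ Y := hιP ▸ (ι ⟨_, hX⟩).2
  obtain ⟨d', q, hq, hq0⟩ := isMorphism_iff.1 hκ w hp0 hwY
  have hκQ : Prop2 (evalTuple q w) ![x, y, 1] := by
    have h1 := hq.eq_mk w hp0 hwY hq0
    have h2 : (⟨_, hwY⟩ : Y) = ι ⟨_, hX⟩ := Subtype.ext hιP.symm
    rw [h2, hκι] at h1
    exact (mk_eq_mk_iff_prop2 _ _).1 h1.symm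
  obtain ⟨t, ht⟩ := hκQ.exists_smul (affine_ne_zero x y)
  have ht0 : t ≠ 0 := by
    rintro rfl
    exact hq0 (by rw [← ht, zero_smul])
  have hpq : evalTuple p (evalTuple q w) ≠ 0 := by
    rw [← ht, evalTuple_smul hp.isHomogeneous]
    exact smul_ne_zero (pow_ne_zero _ ht0) hp0
  obtain ⟨j, hj⟩ := exists_apply_ne_zero hpq
  have hq2 : q 2 ∉ pointIdeal (ι ⟨_, hX⟩ : PSpace K n) := by
    rw [hιP, mem_pointIdeal_iff _ (hq.isHomogeneous 2)]
    have : evalTuple q w 2 = t := by rw [← ht]; simp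
    change evalTuple q w 2 ≠ 0
    rwa [this]
  have hpj : compTuple p q j ∉ pointIdeal (ι ⟨_, hX⟩ : PSpace K n) := by
    rw [hιP]
    refine fun h1 => absurd ((mem_pointIdeal_iff hp0
      ((hp.isHomogeneous j).aeval _ hq.isHomogeneous)).1 h1) ?_
    change evalTuple (compTuple p q) w j ≠ 0
    rwa [evalTuple_compTuple]
  have hq0x : q 0 - C x * q 2 ∈ pointIdeal (ι ⟨_, hX⟩ : PSpace K n) := by
    rw [hιP, mem_pointIdeal_iff _ ((hq.isHomogeneous 0).sub
      (by simpa using (isHomogeneous_C _ x).mul (hq.isHomogeneous 2)))]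
    have h0 : evalTuple q w 0 = t * x := by rw [← ht]; simp
    have h2 : evalTuple q w 2 = t := by rw [← ht]; simp
    change aeval w (q 0) = _ at h0
    change aeval w (q 2) = _ at h2
    rw [map_sub, map_mul, h0, h2, aeval_C, Algebra.algebraMap_self_apply]
    ring
  have hq1y : q 1 - C y * q 2 ∈ pointIdeal (ι ⟨_, hX⟩ : PSpace K n) := by
    rw [hιP, mem_pointIdeal_iff _ ((hq.isHomogeneous 1).sub
      (by simpa using (isHomogeneous_C _ y).mul (hq.isHomogeneous 2)))]
    have h0 : evalTuple q w 1 = t * y := by rw [← ht]; simp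
    have h2 : evalTuple q w 2 = t := by rw [← ht]; simp
    change aeval w (q 1) = _ at h0
    change aeval w (q 2) = _ at h2
    rw [map_sub, map_mul, h0, h2, aeval_C, Algebra.algebraMap_self_apply]
    ring
  have hWq : aeval q W.toProjective.polynomial ∈ homogeneousIdeal Y := by
    refine mem_homogeneousIdeal (isHomogeneous_polynomial.aeval _ hq.isHomogeneous)
      fun v hv hvY => ?_
    rw [← aeval_evalTuple]
    by_cases h0 : evalTuple q v = 0
    · simp [h0, WeierstrassCurve.Projective.polynomial]
    · have h1 : Projectivization.mk K _ h0 ∈ curve K W := hq.eq_mk v hv hvY h0 ▸ (κ ⟨_, hvY⟩).2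
      exact (mk_mem_zeroLocus (d := fun _ => 3) (fun _ => isHomogeneous_polynomial) h0).1 h1 0
  -- The factor `q 2` takes care of the points of `Y` where `q` vanishes and does not describe `κ`.
  -- It becomes a unit in the local ring at the given point.
  have hcross : ∀ i, (X j * compTuple p q i - X i * compTuple p q j) * q 2 ∈
      homogeneousIdeal Y := by
    intro i
    have hhom : ∀ i j, (X j * compTuple p q i : MvPolynomial _ K).IsHomogeneous (1 + d' * d) :=
      fun i j => (isHomogeneous_X K j).mul ((hp.isHomogeneous i).aeval _ hq.isHomogeneous)
    refine mem_homogeneousIdeal (((hhom i j).sub (hhom j i)).mul (hq.isHomogeneous 2))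
      fun v hv hvY => ?_
    simp only [map_mul, map_sub, aeval_X]
    change (v j * evalTuple (compTuple p q) v i - v i * evalTuple (compTuple p q) v j) *
      evalTuple q v 2 = 0
    by_cases h0 : evalTuple q v = 0
    · simp [h0]
    by_cases h1 : evalTuple (compTuple p q) v = 0
    · simp [h1]
    have h2 := hp.comp hq hv hvY h0 h1
    rw [hικ] at h2
    have h3 := (mk_eq_mk_iff_prop2 _ _).1 h2 j i
    rw [h3, mul_comm (v i), sub_self, zero_mul]
  generalize (ι ⟨_, hX⟩ : PSpace K n) = Q at *
  obtain ⟨B, _, _, β, hβI, hβu, hβ⟩ := exists_local_quotient K (homogeneousIdeal Y) (pointIdeal Q)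
  have hq2u := hβu _ hq2
  obtain ⟨s, hs, hsF⟩ := hβ _ r (map_linearForm_mem_pow hp.isHomogeneous (hβI _ hWq) hq2u hq0x hq1y
    (fun i => by
      have h1 := hβI _ (hcross i)
      rw [map_mul, hq2u.mul_left_eq_zero, map_sub, sub_eq_zero] at h1
      exact h1) (hβu _ hpj) h)
  exact le_multiplicityAt hs hsF

end Multiplicity

/-! ### Comparison of charts of one morphism -/

section Chart

variable {K : Type*} [Field K] {W : WeierstrassCurve K} {n : ℕ}
  {Y : Set (PSpace K n)}

lemma affine_mem_curve {x y : K} (h : W.toAffine.Equation x y) :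
    Projectivization.mk K ![x, y, 1] (affine_ne_zero x y) ∈ curve K W := by
  rw [affine_mem_curve_iff]
  simpa [WeierstrassCurve.baseChange] using h

lemma evalTuple_affine {x y : K} (h : W.toAffine.Equation x y)
    (p : Fin (n + 1) → MvPolynomial (Fin 3) K) :
    evalTuple p ![x, y, 1] = fun i => evalAt h (dehom W.toAffine (p i)) :=
  funext fun i => (evalAt_dehom h (p i)).symm

lemma eq_of_forall_evalAt [IsAlgClosed K] {f g : W.toAffine.CoordinateRing}
    (h : ∀ x y (h : W.toAffine.Equation x y), evalAt h f = evalAt h g) : f = g :=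
  sub_eq_zero.1 (eq_zero_of_forall_evalAt fun x y hxy => by rw [map_sub, h x y hxy, sub_self])

/-- Two charts of the same map are proportional at every affine point where neither vanishes, and
the identity is trivial elsewhere; pointwise equality suffices. -/
lemma Represents.dehom_mul_dehom [IsAlgClosed K] {ι : curve K W → Y} {d d' : ℕ}
    {p p' : Fin (n + 1) → MvPolynomial (Fin 3) K} (hp : Represents ι d p)
    (hp' : Represents ι d' p') (i j : Fin (n + 1)) :
    dehom W.toAffine (p i) * dehom W.toAffine (p' j) =
      dehom W.toAffine (p j) * dehom W.toAffine (p' i) := by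
  refine eq_of_forall_evalAt fun x y h => ?_
  simp only [map_mul]
  have h1 := congrFun (evalTuple_affine h p)
  have h2 := congrFun (evalTuple_affine h p')
  simp only [← h1, ← h2]
  by_cases h3 : evalTuple p ![x, y, 1] = 0
  · simp [h3]
  by_cases h4 : evalTuple p' ![x, y, 1] = 0
  · simp [h4]
  have h5 := hp.eq_mk _ (affine_ne_zero x y) (affine_mem_curve h) h3
  rw [hp'.eq_mk _ (affine_ne_zero x y) (affine_mem_curve h) h4] at h5
  exact ((mk_eq_mk_iff_prop2 _ _).1 h5).symm i j

lemma Represents.exists_dehom_ne_zero {ι : curve K W → Y} {d : ℕ}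
    {p : Fin (n + 1) → MvPolynomial (Fin 3) K} (hp : Represents ι d p) {v : Fin 3 → K} (hv : v ≠ 0)
    (hX : Projectivization.mk K v hv ∈ curve K W) {i : Fin (n + 1)} (h0 : evalTuple p v i ≠ 0) :
    dehom W.toAffine (p i) ≠ 0 :=
  fun h => h0 (aeval_eq_zero_of_dehom_eq_zero (hp.isHomogeneous i) h hv hX)

/-- The coordinates of an embedding into no hyperplane are linearly independent functions. -/
lemma Represents.linearIndependent [IsAlgClosed K] {ι : curve K W → Y} (hι : IsMorphism K ι)
    (hsurj : Function.Surjective ι)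
    (hY : ∀ a : Fin (n + 1) → K, a ≠ 0 → ∃ P ∈ Y, linearForm a ∉ pointIdeal P) {d : ℕ}
    {p : Fin (n + 1) → MvPolynomial (Fin 3) K} (hp : Represents ι d p)
    (h0 : ∃ i, dehom W.toAffine (p i) ≠ 0) :
    LinearIndependent K fun i => dehom W.toAffine (p i) := by
  rw [Fintype.linearIndependent_iff]
  intro a ha
  by_contra! hne
  obtain ⟨i₀, hi₀⟩ := hne
  obtain ⟨P, hP, haP⟩ := hY a fun h => hi₀ (congrFun h i₀)
  obtain ⟨Q, hQ⟩ := hsurj ⟨P, hP⟩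
  obtain ⟨v, hv, hX, rfl⟩ := exists_eq_mk Q
  obtain ⟨d', p', hp', hp0⟩ := isMorphism_iff.1 hι v hv hX
  obtain rfl : P = Projectivization.mk K _ hp0 := by
    rw [← hp'.eq_mk v hv hX hp0, hQ]
  rw [mem_pointIdeal_iff _ (isHomogeneous_linearForm a), aeval_linearForm] at haP
  apply haP
  have h1 : dehom W.toAffine (∑ i, a i • p' i) = 0 := by
    obtain ⟨j, hj⟩ := h0
    have h2 : dehom W.toAffine (∑ i, a i • p' i) * dehom W.toAffine (p j) = 0 := by
      simp only [map_sum, map_smul, Finset.sum_mul, smul_mul_assoc]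
      calc ∑ i, a i • (dehom W.toAffine (p' i) * dehom W.toAffine (p j))
          = (∑ i, a i • dehom W.toAffine (p i)) * dehom W.toAffine (p' j) := by
            rw [Finset.sum_mul]
            refine Finset.sum_congr rfl fun i _ => ?_
            rw [smul_mul_assoc, hp.dehom_mul_dehom hp' i j, mul_comm]
        _ = 0 := by rw [ha, zero_mul]
    exact (mul_eq_zero.1 h2).resolve_right hj
  have h3 : (∑ i, a i • p' i).IsHomogeneous d' := by
    refine IsHomogeneous.sum _ _ _ fun i _ => ?_
    rw [smul_eq_C_mul]
    simpa using (isHomogeneous_C (Fin 3) (a i)).mul (hp'.isHomogeneous i)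
  have h4 := aeval_eq_zero_of_dehom_eq_zero h3 h1 hv hX
  simpa [evalTuple] using h4

end Chart

/-! ### The linear system of a quartic model -/

section Quartic

variable {K : Type*} [Field K] {W : WeierstrassCurve K}
  {Y : Set (PSpace K 3)} {ι : curve K W → Y} {κ : Y → curve K W} {d : ℕ}
  {p : Fin 4 → MvPolynomial (Fin 3) K}

lemma mem_pow_count_of_mem_mul_prod {w : W.toAffine.CoordinateRing}
    {s : Multiset (K × K)} (P : K × K) {I : Ideal W.toAffine.CoordinateRing} [DecidableEq (K × K)]
    (hw : w ∈ I * (s.map fun P => XYIdeal W.toAffine P.1 (Polynomial.C P.2)).prod) :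
    w ∈ I * XYIdeal W.toAffine P.1 (Polynomial.C P.2) ^ s.count P := by
  refine Ideal.mul_mono_right ?_ hw
  refine Ideal.le_of_dvd ?_
  rw [← Multiset.prod_replicate, ← Multiset.map_replicate
    (fun P : K × K => XYIdeal W.toAffine P.1 (Polynomial.C P.2))]
  exact Multiset.prod_dvd_prod_of_le (Multiset.map_le_map
    (Multiset.le_count_iff_replicate_le.1 le_rfl))

/-- The multiplicity in which a point divides the quotient of `w` and the base ideal of a chart is
at most the multiplicity of the corresponding plane section. -/
lemma count_le_multiplicityAt [IsAlgClosed K] (hικ : ∀ Q, ι (κ Q) = Q) (hκι : ∀ P, κ (ι P) = P)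
    (hι : IsMorphism K ι) (hκ : IsMorphism K κ) (hp : Represents ι d p)
    (h0 : ∃ i, dehom W.toAffine (p i) ≠ 0) {a : Fin 4 → K} {x y : K}
    (hxy : W.toAffine.Equation x y) {r : ℕ}
    (h : ∑ i, a i • dehom W.toAffine (p i) ∈
      Ideal.span (Set.range fun i => dehom W.toAffine (p i)) *
        XYIdeal W.toAffine x (Polynomial.C y) ^ r) :
    (r : ℕ∞) ≤ multiplicityAt Y (ι ⟨_, affine_mem_curve hxy⟩) (linearForm a) := by
  obtain ⟨d', q, hq, hq0⟩ := isMorphism_iff.1 hι _ (affine_ne_zero x y) (affine_mem_curve hxy)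
  refine le_multiplicityAt_of_dehom_mem_pow hικ hκι hκ hq (affine_mem_curve hxy) hq0 ?_
  obtain ⟨j, hj⟩ := exists_apply_ne_zero hq0
  have hj0 := hq.exists_dehom_ne_zero (affine_ne_zero x y) (affine_mem_curve hxy) hj
  have hpj : dehom W.toAffine (p j) ≠ 0 := by
    obtain ⟨l, hl⟩ := h0
    intro h1
    have h2 := hp.dehom_mul_dehom hq l j
    rw [h1, zero_mul] at h2
    exact mul_ne_zero hl hj0 h2
  have h1 : dehom W.toAffine (q j) * ∑ i, a i • dehom W.toAffine (p i) =
      dehom W.toAffine (p j) * ∑ i, a i • dehom W.toAffine (q i) := by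
    simp only [Finset.mul_sum, mul_smul_comm]
    refine Finset.sum_congr rfl fun i _ => ?_
    rw [mul_comm, hp.dehom_mul_dehom hq i j]
  -- The chart `q` has no base point at (x, y), since `q j` does not vanish there. The
  -- proportionality q_j p_i = p_j q_i puts q_j times the base ideal of `p` inside (p_j), so that
  -- cancelling p_j removes the base ideal from the hypothesis.
  have h2 : Ideal.span {dehom W.toAffine (q j)} *
      Ideal.span (Set.range fun i => dehom W.toAffine (p i)) ≤
        Ideal.span {dehom W.toAffine (p j)} := by
    rw [Ideal.span_singleton_mul_le_iff]
    intro z hz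
    induction hz using Submodule.span_induction with
    | mem z hz =>
      obtain ⟨i, rfl⟩ := hz
      rw [mul_comm, hp.dehom_mul_dehom hq i j]
      exact Ideal.mul_mem_right _ _ (Ideal.mem_span_singleton_self _)
    | zero => simp
    | add z w _ _ hz hw => rw [mul_add]; exact add_mem hz hw
    | smul b z _ hz => rw [smul_eq_mul, mul_left_comm]; exact Ideal.mul_mem_left _ _ hz
  have h3 := Ideal.mul_mem_mul (Ideal.mem_span_singleton_self (dehom W.toAffine (q j))) h
  rw [← mul_assoc, h1] at h3
  obtain ⟨z, hz, hz'⟩ := Ideal.mem_span_singleton_mul.1 (Ideal.mul_mono_left h2 h3)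
  rwa [← mul_left_cancel₀ hpj hz']

/-- Distinct affine points have distinct images in Y, and each occurs in s at most as often as the
multiplicity of the plane section at its image. Intersections at the image of infinity only add to
the total, so an inequality results. -/
lemma sum_count_le_four [IsAlgClosed K] (hικ : ∀ Q, ι (κ Q) = Q) (hκι : ∀ P, κ (ι P) = P)
    (hι : IsMorphism K ι) (hκ : IsMorphism K κ) (hp : Represents ι d p)
    (h0 : ∃ i, dehom W.toAffine (p i) ≠ 0) {a : Fin 4 → K}
    (hdeg : ∑ᶠ P : Y, multiplicityAt Y P (linearForm a) = 4) {s : Multiset (K × K)}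
    (hs : ∀ P ∈ s, W.toAffine.Equation P.1 P.2)
    (h : Ideal.span {∑ i, a i • dehom W.toAffine (p i)} =
      Ideal.span (Set.range fun i => dehom W.toAffine (p i)) *
        (s.map fun P => XYIdeal W.toAffine P.1 (Polynomial.C P.2)).prod) : s.card ≤ 4 := by
  classical
  -- A `finsum` with infinite support has the value 0, which is not 4.
  have hfin : (Function.support fun P : Y => multiplicityAt Y P (linearForm a)).Finite := by
    by_contra hinf
    rw [finsum_of_infinite_support hinf] at hdeg
    exact absurd hdeg (by norm_num)
  rw [finsum_eq_sum_of_support_subset _ hfin.coe_toFinset.ge] at hdeg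
  let g : {P // P ∈ s.toFinset} → Y := fun P =>
    ι ⟨_, affine_mem_curve (hs P.1 (Multiset.mem_toFinset.1 P.2))⟩
  have hg : Function.Injective g := by
    intro P Q hPQ
    have h1 := congrArg κ hPQ
    simp only [g, hκι, Subtype.mk.injEq] at h1
    have h2 := (mk_eq_mk_iff_prop2 _ _).1 h1
    have h3 := h2 0 2
    have h4 := h2 1 2
    simp only [Matrix.cons_val_zero, Matrix.cons_val, Matrix.cons_val_one, mul_one, one_mul]
      at h3 h4
    exact Subtype.ext (Prod.ext h3 h4)
  have key : (s.card : ℕ∞) ≤ 4 := by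
    rw [← Multiset.toFinset_sum_count_eq, ← Finset.sum_attach, Nat.cast_sum, ← hdeg]
    calc ∑ P ∈ s.toFinset.attach, (s.count P.1 : ℕ∞)
        ≤ ∑ P ∈ s.toFinset.attach, multiplicityAt Y (g P) (linearForm a) :=
          Finset.sum_le_sum fun P _ => count_le_multiplicityAt hικ hκι hι hκ hp h0
            (hs P.1 (Multiset.mem_toFinset.1 P.2))
            (mem_pow_count_of_mem_mul_prod P.1 (h ▸ Ideal.mem_span_singleton_self _))
      _ = ∑ Q ∈ s.toFinset.attach.map ⟨g, hg⟩, multiplicityAt Y Q (linearForm a) := by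
          rw [Finset.sum_map]; rfl
      _ ≤ _ := Finset.sum_le_sum_of_ne_zero fun Q _ hQ => by simpa using hQ
  exact_mod_cast key

/-- The coordinate functions of a quartic model: up to a common factor, they have poles bounded by
`4 O`, or by `3 O + S` for an affine point `S`. -/
lemma exists_generator_of_isQuarticModel [IsAlgClosed K] [W.IsElliptic]
    (hικ : ∀ Q, ι (κ Q) = Q) (hκι : ∀ P, κ (ι P) = P) (hι : IsMorphism K ι)
    (hκ : IsMorphism K κ) (hY : IsQuarticModel Y) (hp : Represents ι d p)
    (h0 : ∃ i, dehom W.toAffine (p i) ≠ 0) :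
    ∃ v : W.toAffine.CoordinateRing, v ≠ 0 ∧
      ((Ideal.span {v} = Ideal.span (Set.range fun i => dehom W.toAffine (p i)) ∧
        ∀ i, poleOrder (dehom W.toAffine (p i)) ≤ poleOrder v + 4) ∨
      ∃ x y, W.toAffine.Equation x y ∧
        Ideal.span {v} = Ideal.span (Set.range fun i => dehom W.toAffine (p i)) *
          XYIdeal W.toAffine x (Polynomial.C y) ∧
        ∀ i, poleOrder (dehom W.toAffine (p i)) ≤ poleOrder v + 3) := by
  have hli := hp.linearIndependent hι (fun Q => ⟨κ Q, hικ Q⟩) hY.nondegenerate h0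
  set f := fun i => dehom W.toAffine (p i) with hf
  set I := Ideal.span (Set.range f) with hI
  set N := Module.finrank K (W.toAffine.CoordinateRing ⧸ I) with hN
  have hmem : ∀ a : Fin 4 → K, ∑ i, a i • f i ∈ I := fun a => by
    refine sum_mem fun i _ => ?_
    rw [Algebra.smul_def]
    exact Ideal.mul_mem_left _ _ (Ideal.subset_span ⟨i, rfl⟩)
  have hne : ∀ a : Fin 4 → K, a ≠ 0 → ∑ i, a i • f i ≠ 0 := fun a ha h =>
    ha (funext (Fintype.linearIndependent_iff.1 hli a h))
  have hle : ∀ a : Fin 4 → K, a ≠ 0 → poleOrder (∑ i, a i • f i) ≤ N + 4 := fun a ha => by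
    obtain ⟨s, hs, hs', hs''⟩ := exists_span_singleton_eq_mul_prod (hmem a) (hne a ha)
    rw [hs'', add_le_add_iff_left]
    exact sum_count_le_four hικ hκι hι hκ hp h0 (hY.degree_eq a ha) hs hs'
  have hle' : ∀ i, poleOrder (f i) ≤ N + 4 := fun i => by
    have := hle (Pi.single i 1) (by simp)
    simpa [Pi.single_apply] using this
  -- a combination of small pole order
  let L : (Fin 4 → K) →ₗ[K] (Fin 3 → K) := LinearMap.pi (fun j : Fin 3 =>
    poleCoeff W.toAffine (N + 2 + j) ∘ₗ Fintype.linearCombination K f)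
  obtain ⟨a, haker, ha⟩ := Submodule.exists_mem_ne_zero_of_ne_bot
    (LinearMap.ker_ne_bot_of_finrank_lt (f := L) (by simp))
  have hav : poleOrder (∑ i, a i • f i) ≤ N + 1 := by
    rw [poleOrder_le_iff_poleCoeff]
    intro m hm
    by_cases hm' : N + 4 < m
    · exact poleOrder_le_iff_poleCoeff.1 (hle a ha) m hm'
    · have h1 := congrFun (LinearMap.mem_ker.1 haker) ⟨m - (N + 2), by omega⟩
      have h2 : N + 2 + (m - (N + 2)) = m := by omega
      simpa [L, Fintype.linearCombination_apply, h2] using h1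
  obtain ⟨s, hs, hs', hs''⟩ := exists_span_singleton_eq_mul_prod (hmem a) (hne a ha)
  refine ⟨∑ i, a i • f i, hne a ha, ?_⟩
  -- The pole order is `N` plus the number of zeros outside the base ideal, and it is at most `N +
  -- 1`. A remaining zero is the affine point in the class of 3 O plus a point.
  have hcard : s.card ≤ 1 := by
    change _ = N + _ at hs''
    omega
  rcases Nat.le_one_iff_eq_zero_or_eq_one.1 hcard with h1 | h1
  · left
    rw [Multiset.card_eq_zero] at h1
    subst h1
    rw [Multiset.map_zero, Multiset.prod_zero, mul_one] at hs'
    refine ⟨hs', fun i => ?_⟩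
    rw [hs'', Multiset.card_zero, add_zero]
    exact hle' i
  · right
    obtain ⟨P, rfl⟩ := Multiset.card_eq_one.1 h1
    rw [Multiset.map_singleton, Multiset.prod_singleton] at hs'
    refine ⟨P.1, P.2, hs P (Multiset.mem_singleton_self P), hs', fun i => ?_⟩
    rw [hs'', Multiset.card_singleton]
    exact hle' i

end Quartic

/-! ### Negation and the class of the plane sections -/

section Symmetric

variable {K : Type*} [Field K] {W : WeierstrassCurve K}

lemma mulVec_ne_zero {n : ℕ} (B : Matrix.GeneralLinearGroup (Fin (n + 1)) K)
    {v : Fin (n + 1) → K} (hv : v ≠ 0) :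
    (B : Matrix (Fin (n + 1)) (Fin (n + 1)) K).mulVec v ≠ 0 := fun h =>
  hv (Matrix.eq_zero_of_mulVec_eq_zero (Matrix.GeneralLinearGroup.det_ne_zero B) h)

lemma linAut_mk {n : ℕ} (B : Matrix.GeneralLinearGroup (Fin (n + 1)) K) {v : Fin (n + 1) → K}
    (hv : v ≠ 0) : linAut B (Projectivization.mk K v hv) =
      Projectivization.mk K ((B : Matrix (Fin (n + 1)) (Fin (n + 1)) K).mulVec v)
        (mulVec_ne_zero B hv) := by
  rw [linAut, Projectivization.smul_mk]
  rfl

variable (W) in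
lemma exists_negHom : ∃ σ : W.toAffine.CoordinateRing →ₐ[K] W.toAffine.CoordinateRing,
    σ (xFun W.toAffine) = xFun W.toAffine ∧ σ (yFun W.toAffine) =
      -yFun W.toAffine - algebraMap K _ W.a₁ * xFun W.toAffine - algebraMap K _ W.a₃ := by
  apply exists_algHom
  linear_combination equation_xy (W := W.toAffine)

variable (W) in
/-- The automorphism of the coordinate ring induced by negation. -/
def negHom : W.toAffine.CoordinateRing →ₐ[K] W.toAffine.CoordinateRing := (exists_negHom W).choose

lemma negHom_xFun : negHom W (xFun W.toAffine) = xFun W.toAffine := (exists_negHom W).choose_spec.1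

lemma negHom_yFun : negHom W (yFun W.toAffine) =
    -yFun W.toAffine - algebraMap K _ W.a₁ * xFun W.toAffine - algebraMap K _ W.a₃ :=
  (exists_negHom W).choose_spec.2

lemma negHom_negHom (f : W.toAffine.CoordinateRing) : negHom W (negHom W f) = f := by
  have : (negHom W).comp (negHom W) = AlgHom.id K _ := by
    apply algHom_ext_xy
    · simp only [AlgHom.comp_apply, negHom_xFun, AlgHom.id_apply]
    · simp only [AlgHom.comp_apply, negHom_yFun, negHom_xFun, map_sub, map_neg, map_mul,
        AlgHom.commutes, AlgHom.id_apply]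
      ring
  exact DFunLike.congr_fun this f

lemma evalAt_negHom {x y : K} (h : W.toAffine.Equation x y)
    (h' : W.toAffine.Equation x (W.toAffine.negY x y)) (f : W.toAffine.CoordinateRing) :
    evalAt h (negHom W f) = evalAt h' f := by
  have : (evalAt h).comp (negHom W) = evalAt h' := by
    apply algHom_ext_xy
    · simp only [AlgHom.comp_apply, negHom_xFun, evalAt_xFun]
    · simp only [AlgHom.comp_apply, negHom_yFun, map_sub, map_neg, map_mul, AlgHom.commutes,
        evalAt_xFun, evalAt_yFun, WeierstrassCurve.Affine.negY]
      rfl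
  exact DFunLike.congr_fun this f

lemma map_negHom_XYIdeal {x y : K} (h : W.toAffine.Equation x y) :
    (XYIdeal W.toAffine x (Polynomial.C y)).map (negHom W) =
      XYIdeal W.toAffine x (Polynomial.C (W.toAffine.negY x y)) := by
  have key : ∀ y, W.toAffine.Equation x y → (XYIdeal W.toAffine x (Polynomial.C y)).map (negHom W) ≤
      XYIdeal W.toAffine x (Polynomial.C (W.toAffine.negY x y)) := by
    intro y h
    have h' := (WeierstrassCurve.Affine.equation_neg x y).2 h
    rw [Ideal.map_le_iff_le_comap]
    intro f hf
    rw [Ideal.mem_comap, ← evalAt_eq_zero_iff h']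
    have h'' : W.toAffine.Equation x (W.toAffine.negY x (W.toAffine.negY x y)) := by
      rwa [WeierstrassCurve.Affine.negY_negY]
    rw [evalAt_negHom h' h'', evalAt_eq_zero_iff h'', WeierstrassCurve.Affine.negY_negY]
    exact hf
  refine le_antisymm (key y h) ?_
  intro f hf
  have h1 := key _ ((WeierstrassCurve.Affine.equation_neg x y).2 h) (Ideal.mem_map_of_mem _ hf)
  rw [WeierstrassCurve.Affine.negY_negY] at h1
  rw [← negHom_negHom f]
  exact Ideal.mem_map_of_mem _ h1

lemma span_range_sum_le {R : Type*} [CommRing R] [Algebra K R] {n : ℕ}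
    (M : Matrix (Fin n) (Fin n) K) (f : Fin n → R) :
    Ideal.span (Set.range fun i => ∑ j, algebraMap K R (M i j) * f j) ≤
      Ideal.span (Set.range f) := by
  rw [Ideal.span_le]
  rintro _ ⟨i, rfl⟩
  exact sum_mem fun j _ => Ideal.mul_mem_left _ _ (Ideal.subset_span ⟨j, rfl⟩)

lemma span_range_sum_eq {R : Type*} [CommRing R] [Algebra K R] {n : ℕ}
    (B : Matrix.GeneralLinearGroup (Fin n) K) (f : Fin n → R) :
    Ideal.span (Set.range fun i => ∑ j, algebraMap K R (B i j) * f j) =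
      Ideal.span (Set.range f) := by
  refine le_antisymm (span_range_sum_le _ f) ?_
  have h := span_range_sum_le (B⁻¹ : Matrix.GeneralLinearGroup (Fin n) K).1
    fun i => ∑ j, algebraMap K R (B i j) * f j
  convert h using 3
  ext1 i
  have h1 : (B⁻¹).1 * B.1 = 1 := B.inv_mul
  simp only [Finset.mul_sum]
  rw [Finset.sum_comm]
  simp only [← mul_assoc, ← Finset.sum_mul, ← map_mul, ← map_sum]
  have h2 : ∀ j, ∑ l, (B⁻¹).1 i l * B l j = (1 : Matrix (Fin n) (Fin n) K) i j := fun j => by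
    rw [← h1, Matrix.mul_apply]
  simp only [h2]
  simp [Matrix.one_apply]

/-- The hypothesis says that P and −P have the same ideal class, and the map from points to the
class group is injective. -/
lemma eq_negY_of_mul_XYIdeal [IsAlgClosed K] [W.IsElliptic] {x y : K}
    (h : W.toAffine.Equation x y)
    {g g' : W.toAffine.CoordinateRing} (hg : g ≠ 0) (hg' : g' ≠ 0)
    (hmul : Ideal.span {g} * XYIdeal W.toAffine x (Polynomial.C y) =
      Ideal.span {g'} * XYIdeal W.toAffine x (Polynomial.C (W.toAffine.negY x y))) :
    y = W.toAffine.negY x y := by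
  classical
  have hns := (WeierstrassCurve.Affine.equation_iff_nonsingular).1 h
  have hns' := (WeierstrassCurve.Affine.nonsingular_neg x y).2 hns
  have h1 : WeierstrassCurve.Affine.Point.toClass (WeierstrassCurve.Affine.Point.some _ _ hns) =
      WeierstrassCurve.Affine.Point.toClass (WeierstrassCurve.Affine.Point.some _ _ hns') := by
    rw [WeierstrassCurve.Affine.Point.toClass_some, WeierstrassCurve.Affine.Point.toClass_some]
    exact (ClassGroup.mk_eq_mk_of_coe_ideal (CoordinateRing.XYIdeal'_eq hns)
      (CoordinateRing.XYIdeal'_eq hns')).2 ⟨_, _, hg, hg', hmul⟩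
  have h2 := WeierstrassCurve.Affine.Point.toClass_injective h1
  simp only [WeierstrassCurve.Affine.Point.some.injEq] at h2
  exact h2.2

/-- If negation is induced by a projective linear transformation, then the point `S` such that the
hyperplane sections are equivalent to `3 O + S` satisfies `S = -S`. -/
lemma eq_negY_of_symmetric [IsAlgClosed K] [W.IsElliptic] {n : ℕ} {Y : Set (PSpace K n)}
    {ι : curve K W → Y}
    {B : Matrix.GeneralLinearGroup (Fin (n + 1)) K}
    (hB : ∀ x y (h : W.toAffine.Equation x y) (h' : W.toAffine.Equation x (W.toAffine.negY x y)),
      (ι ⟨_, affine_mem_curve h'⟩ : PSpace K n) = linAut B (ι ⟨_, affine_mem_curve h⟩))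
    {d : ℕ} {p : Fin (n + 1) → MvPolynomial (Fin 3) K} (hp : Represents ι d p)
    {v : W.toAffine.CoordinateRing} (hv : v ≠ 0) {x y : K} (h : W.toAffine.Equation x y)
    (hvI : Ideal.span {v} = Ideal.span (Set.range fun i => dehom W.toAffine (p i)) *
      XYIdeal W.toAffine x (Polynomial.C y)) : y = W.toAffine.negY x y := by
  set f := fun i => dehom W.toAffine (p i) with hf
  set b : Fin (n + 1) → W.toAffine.CoordinateRing :=
    fun i => ∑ j, algebraMap K _ (B i j) * f j with hb
  have hbf : ∀ x y (h : W.toAffine.Equation x y) i, evalAt h (b i) =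
      (B : Matrix (Fin (n + 1)) (Fin (n + 1)) K).mulVec (evalTuple p ![x, y, 1]) i := by
    intro x y h i
    simp only [hb, map_sum, map_mul, AlgHom.commutes, evalTuple_affine h]
    rfl
  -- Both tuples describe the map P ↦ ι(−P): one by composing the chart with negation, the other by
  -- applying `B` to the chart.
  have key : ∀ i j, negHom W (f i) * b j = negHom W (f j) * b i := by
    intro i j
    refine eq_of_forall_evalAt fun x y h => ?_
    have h' := (WeierstrassCurve.Affine.equation_neg x y).2 h
    simp only [map_mul, evalAt_negHom h h', hbf]
    have h1 := fun i => (congrFun (evalTuple_affine h' p) i).symm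
    simp only [hf, h1]
    by_cases h2 : evalTuple p ![x, y, 1] = 0
    · simp [h2]
    by_cases h3 : evalTuple p ![x, W.toAffine.negY x y, 1] = 0
    · simp only [h3, Pi.zero_apply, zero_mul]
    have h4 := hB x y h h'
    rw [hp.eq_mk _ (affine_ne_zero _ _) (affine_mem_curve h) h2,
      hp.eq_mk _ (affine_ne_zero _ _) (affine_mem_curve h') h3, linAut_mk,
      mk_eq_mk_iff_prop2] at h4
    exact h4 i j
  have hIb : Ideal.span (Set.range f) = Ideal.span (Set.range b) :=
    (span_range_sum_eq B f).symm
  have hI : Ideal.span (Set.range f) ≠ ⊥ := by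
    intro h0
    rw [h0, Ideal.bot_mul] at hvI
    exact hv (Ideal.span_singleton_eq_bot.1 hvI)
  obtain ⟨j, hj⟩ : ∃ j, b j ≠ 0 := by
    by_contra! h0
    rw [hIb] at hI
    exact hI (Ideal.span_eq_bot.2 (by rintro _ ⟨i, rfl⟩; exact h0 i))
  have hinj : Function.Injective (negHom W) :=
    Function.LeftInverse.injective negHom_negHom
  have hj' : negHom W (f j) ≠ 0 := by
    intro h0
    have h1 : ∀ i, f i = 0 := fun i => by
      have := key i j
      rw [h0, zero_mul] at this
      exact (map_eq_zero_iff _ hinj).1 ((mul_eq_zero.1 this).resolve_right hj)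
    exact hI (Ideal.span_eq_bot.2 (by rintro _ ⟨i, rfl⟩; exact h1 i))
  -- By proportionality, the base ideal and its image under negation differ by principal factors;
  -- the invertibility of `B` makes the tuples `f` and `b` generate the same ideal.
  have h1 : Ideal.span {b j} * (Ideal.span (Set.range f)).map (negHom W) =
      Ideal.span {negHom W (f j)} * Ideal.span (Set.range f) := by
    conv_rhs => rw [hIb]
    rw [Ideal.map_span, Ideal.span_mul_span', Ideal.span_mul_span', Set.singleton_mul,
      Set.singleton_mul, ← Set.range_comp, ← Set.range_comp, ← Set.range_comp]
    congr 2
    ext1 i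
    simp only [Function.comp_apply]
    rw [mul_comm, key i j]
  have h2 := congrArg (Ideal.map (negHom W)) hvI
  rw [Ideal.map_mul, Ideal.map_span, Set.image_singleton, map_negHom_XYIdeal h] at h2
  refine eq_negY_of_mul_XYIdeal h (g := b j * negHom W v) (g' := negHom W (f j) * v)
    (mul_ne_zero hj ((map_ne_zero_iff _ hinj).2 hv)) (mul_ne_zero hj' hv) ?_
  rw [← Ideal.span_singleton_mul_span_singleton, ← Ideal.span_singleton_mul_span_singleton, h2,
    hvI, ← mul_assoc, h1]
  ring

end Symmetric

lemma prop2_fin_three {K : Type*} [Field K] {v w : Fin 3 → K} (h₀₁ : v 0 * w 1 = v 1 * w 0)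
    (h₀₂ : v 0 * w 2 = v 2 * w 0) (h₁₂ : v 1 * w 2 = v 2 * w 1) : Prop2 v w := by
  intro i j
  fin_cases i <;> fin_cases j <;> first | rfl | assumption | (symm; assumption)

lemma prop2_fin_four {K : Type*} [Field K] {v w : Fin 4 → K} (h₀₁ : v 0 * w 1 = v 1 * w 0)
    (h₀₂ : v 0 * w 2 = v 2 * w 0) (h₀₃ : v 0 * w 3 = v 3 * w 0) (h₁₂ : v 1 * w 2 = v 2 * w 1)
    (h₁₃ : v 1 * w 3 = v 3 * w 1) (h₂₃ : v 2 * w 3 = v 3 * w 2) : Prop2 v w := by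
  intro i j
  fin_cases i <;> fin_cases j <;> first | rfl | assumption | (symm; assumption)

/-- The model `y² + e x y = x³ + e²` of an ordinary elliptic curve in characteristic two with a
rational point `(e, e)` of order four. -/
def modelCurve {F : Type*} [Field F] (e : F) : WeierstrassCurve F := ⟨e, 0, 0, 0, e ^ 2⟩

/-! ### The model curve y² + e x y = x³ + e² -/

section Model

variable {k K : Type*} [Field k] [Field K] [Algebra k K]

lemma mk_mem_modelCurve_iff {e : k} {v : Fin 3 → K} (hv : v ≠ 0) :
    Projectivization.mk K v hv ∈ curve K (modelCurve e) ↔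
      v 1 ^ 2 * v 2 + algebraMap k K e * v 0 * v 1 * v 2 =
        v 0 ^ 3 + algebraMap k K e ^ 2 * v 2 ^ 3 := by
  rw [mk_mem_curve_iff]
  simp [modelCurve]

lemma isElliptic_modelCurve [CharP k 2] {e : k} (he : e ≠ 0) : (modelCurve e).IsElliptic := by
  constructor
  have h : (modelCurve e).Δ = e ^ 8 := by
    simp only [modelCurve, WeierstrassCurve.Δ, WeierstrassCurve.b₂, WeierstrassCurve.b₄,
      WeierstrassCurve.b₆, WeierstrassCurve.b₈]
    grind
  rw [h]
  exact (isUnit_iff_ne_zero.2 he).pow 8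

lemma baseChange_modelCurve (e : k) :
    (modelCurve e).baseChange K = modelCurve (algebraMap k K e) := by
  simp [modelCurve, WeierstrassCurve.baseChange, WeierstrassCurve.map]

/-- The points of the model curve, up to scaling. -/
lemma modelCurve_cases {e : k} {v : Fin 3 → K} (hv : v ≠ 0)
    (h : Projectivization.mk K v hv ∈ curve K (modelCurve e)) :
    (∃ t : K, t ≠ 0 ∧ v = t • ![0, 1, 0]) ∨ ∃ t : K, t ≠ 0 ∧ ∃ x y, v = t • ![x, y, 1] ∧
      y ^ 2 + algebraMap k K e * x * y = x ^ 3 + algebraMap k K e ^ 2 := by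
  rcases eq_infinity_or_affine hv h with h | ⟨t, ht, x, y, hxy, rfl⟩
  · exact Or.inl h
  · refine Or.inr ⟨t, ht, x, y, rfl, ?_⟩
    rw [← affine_mem_curve_iff, mk_mem_modelCurve_iff] at hxy
    simpa using hxy

end Model

/-! ### The isomorphism with the split μ₄-normal form -/

section Mu4

variable {k : Type*} [Field k]

/-- The charts of the isomorphism from the model curve to the curve in split `μ₄`-normal form. -/
def mu4Chart (c : k) : Fin 2 → Fin 4 → MvPolynomial (Fin 3) k
  | 0 => ![C c * X 0 ^ 2, X 0 ^ 2 + C (c ^ 4) * X 0 * X 2 + C (c ^ 2) * X 1 * X 2,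
      C (c ^ 5) * X 2 ^ 2, X 0 ^ 2 + C (c ^ 2) * X 1 * X 2]
  -- On the affine curve this is x times the first chart, rewritten by y² + c² x y + c⁴ = x³. It is
  -- nonzero at infinity, where the first chart vanishes.
  | 1 => ![C c * (X 1 ^ 2 + C (c ^ 2) * X 0 * X 1 + C (c ^ 4) * X 2 ^ 2),
      X 1 ^ 2 + C (c ^ 4) * X 2 ^ 2 + C (c ^ 4) * X 0 ^ 2, C (c ^ 5) * X 0 * X 2,
      X 1 ^ 2 + C (c ^ 4) * X 2 ^ 2]

/-- The charts of the inverse isomorphism. -/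
def mu4InvChart (c : k) : Fin 2 → Fin 3 → MvPolynomial (Fin 4) k
  | 0 => ![C c * (X 1 + X 3), C (c ^ 3) * X 3 + C (c ^ 2) * X 0, X 2]
  | 1 => ![C (c ^ 3) * X 0 * (C c * X 3 + X 0),
      C (c ^ 6) * X 0 * X 3 + C (c ^ 2) * X 2 * (X 1 + X 3), (C c * X 3 + X 0) * (X 1 + X 3)]

variable {K : Type*} [Field K] [Algebra k K]

lemma evalTuple_mu4Chart_zero (c : k) (v : Fin 3 → K) : evalTuple (mu4Chart c 0) v =
    ![algebraMap k K c * v 0 ^ 2,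
      v 0 ^ 2 + algebraMap k K c ^ 4 * v 0 * v 2 + algebraMap k K c ^ 2 * v 1 * v 2,
      algebraMap k K c ^ 5 * v 2 ^ 2, v 0 ^ 2 + algebraMap k K c ^ 2 * v 1 * v 2] := by
  ext i
  fin_cases i <;> simp [evalTuple, mu4Chart]

lemma evalTuple_mu4Chart_one (c : k) (v : Fin 3 → K) : evalTuple (mu4Chart c 1) v =
    ![algebraMap k K c * (v 1 ^ 2 + algebraMap k K c ^ 2 * v 0 * v 1 +
        algebraMap k K c ^ 4 * v 2 ^ 2),
      v 1 ^ 2 + algebraMap k K c ^ 4 * v 2 ^ 2 + algebraMap k K c ^ 4 * v 0 ^ 2,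
      algebraMap k K c ^ 5 * v 0 * v 2, v 1 ^ 2 + algebraMap k K c ^ 4 * v 2 ^ 2] := by
  ext i
  fin_cases i <;> simp [evalTuple, mu4Chart]

lemma evalTuple_mu4InvChart_zero (c : k) (v : Fin 4 → K) : evalTuple (mu4InvChart c 0) v =
    ![algebraMap k K c * (v 1 + v 3), algebraMap k K c ^ 3 * v 3 + algebraMap k K c ^ 2 * v 0,
      v 2] := by
  ext i
  fin_cases i <;> simp [evalTuple, mu4InvChart]

lemma evalTuple_mu4InvChart_one (c : k) (v : Fin 4 → K) : evalTuple (mu4InvChart c 1) v =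
    ![algebraMap k K c ^ 3 * v 0 * (algebraMap k K c * v 3 + v 0),
      algebraMap k K c ^ 6 * v 0 * v 3 + algebraMap k K c ^ 2 * v 2 * (v 1 + v 3),
      (algebraMap k K c * v 3 + v 0) * (v 1 + v 3)] := by
  ext i
  fin_cases i <;> simp [evalTuple, mu4InvChart]

lemma isHomogeneous_mu4Chart (c : k) (j : Fin 2) (i : Fin 4) :
    (mu4Chart c j i).IsHomogeneous 2 := by
  apply isHomogeneous_of_aeval_scale
  fin_cases j <;> fin_cases i <;>
    simp [mu4Chart, algebraMap_eq] <;> ring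

lemma isHomogeneous_mu4InvChart (c : k) (j : Fin 2) (i : Fin 3) :
    (mu4InvChart c j i).IsHomogeneous (![1, 2] j) := by
  apply isHomogeneous_of_aeval_scale
  fin_cases j <;> fin_cases i <;>
    simp [mu4InvChart, algebraMap_eq] <;> ring

lemma isHomogeneous_mu4Forms (c : k) (j : Fin 2) : (mu4Forms c j).IsHomogeneous 2 := by
  apply isHomogeneous_of_aeval_scale
  fin_cases j <;> simp [mu4Forms, algebraMap_eq] <;> ring

lemma isHomogeneous_z4Forms (e : k) (j : Fin 2) : (z4Forms e j).IsHomogeneous 2 := by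
  apply isHomogeneous_of_aeval_scale
  fin_cases j <;> simp [z4Forms, algebraMap_eq] <;> ring

lemma mk_mem_mu4Curve_iff {c : k} {v : Fin 4 → K} (hv : v ≠ 0) :
    Projectivization.mk K v hv ∈ mu4Curve K c ↔
      v 0 ^ 2 - v 2 ^ 2 = algebraMap k K c ^ 2 * v 1 * v 3 ∧
      v 1 ^ 2 - v 3 ^ 2 = algebraMap k K c ^ 2 * v 0 * v 2 := by
  rw [mu4Curve, mk_mem_zeroLocus (isHomogeneous_mu4Forms c), Fin.forall_fin_two]
  simp [mu4Forms, sub_eq_zero]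

lemma mk_mem_z4Curve_iff {e : k} {v : Fin 4 → K} (hv : v ≠ 0) :
    Projectivization.mk K v hv ∈ z4Curve K e ↔
      v 0 ^ 2 - v 1 ^ 2 + v 2 ^ 2 - v 3 ^ 2 = algebraMap k K e * v 0 * v 2 ∧
      v 0 ^ 2 - v 1 ^ 2 + v 2 ^ 2 - v 3 ^ 2 = algebraMap k K e * v 1 * v 3 := by
  rw [z4Curve, mk_mem_zeroLocus (isHomogeneous_z4Forms e), Fin.forall_fin_two]
  simp [z4Forms, sub_eq_zero]

lemma isAtlas_mu4Chart [CharP K 2] {c : k} (hc : c ≠ 0) :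
    IsAtlas (curve K (modelCurve (c ^ 2))) (mu4Curve K c) (fun _ => 2) (mu4Chart c) where
  isHomogeneous := isHomogeneous_mu4Chart c
  covers v hv hX := by
    have hc' : algebraMap k K c ≠ 0 := (map_ne_zero _).2 hc
    rcases modelCurve_cases hv hX with ⟨t, ht, rfl⟩ | ⟨t, ht, x, y, rfl, -⟩
    · refine ⟨1, fun h => ?_⟩
      have := congrFun h 3
      simp [evalTuple_mu4Chart_one, ht] at this
    · refine ⟨0, fun h => ?_⟩
      have := congrFun h 2
      simp [evalTuple_mu4Chart_zero, ht, hc'] at this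
  compatible v hv hX := by
    rw [mk_mem_modelCurve_iff, map_pow] at hX
    have h01 : Prop2 (evalTuple (mu4Chart c 0) v) (evalTuple (mu4Chart c 1) v) := by
      rw [evalTuple_mu4Chart_zero, evalTuple_mu4Chart_one]
      generalize algebraMap k K c = c at *
      apply prop2_fin_four <;> simp <;> grind
    intro j j'
    fin_cases j <;> fin_cases j'
    exacts [prop2_self _, h01, h01.symm, prop2_self _]
  mapsTo v hv hX j h := by
    rw [mk_mem_modelCurve_iff, map_pow] at hX
    rw [mk_mem_mu4Curve_iff]
    clear h
    fin_cases j
    · simp only [Fin.zero_eta, evalTuple_mu4Chart_zero]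
      generalize algebraMap k K c = c at *
      constructor <;> simp <;> grind
    · simp only [Fin.mk_one, evalTuple_mu4Chart_one]
      generalize algebraMap k K c = c at *
      constructor <;> simp <;> grind

/-- On the plane X₂ = 0 both equations become equalities of squares in characteristic 2: X₁ = X₃,
and then X₀ = c X₃. The plane meets the curve only at the identity. -/
lemma mu4Curve_cases [CharP K 2] {c : k} {v : Fin 4 → K} (hv : v ≠ 0)
    (h : Projectivization.mk K v hv ∈ mu4Curve K c) :
    v 2 ≠ 0 ∨ ∃ t : K, t ≠ 0 ∧ v = t • ![algebraMap k K c, 1, 0, 1] := by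
  rw [mk_mem_mu4Curve_iff] at h
  obtain ⟨h1, h2⟩ := h
  by_cases h0 : v 2 = 0
  · right
    have h3 : v 1 = v 3 := by
      have : (v 1 - v 3) ^ 2 = 0 := by grind
      exact sub_eq_zero.1 (pow_eq_zero_iff two_ne_zero |>.1 this)
    have h4 : v 0 = algebraMap k K c * v 3 := by
      have : (v 0 - algebraMap k K c * v 3) ^ 2 = 0 := by grind
      exact sub_eq_zero.1 (pow_eq_zero_iff two_ne_zero |>.1 this)
    refine ⟨v 3, fun h5 => hv ?_, ?_⟩
    · ext i
      fin_cases i <;> simp [h0, h3, h4, h5]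
    · ext i
      fin_cases i <;> simp [h0, h3, h4, mul_comm]
  · exact Or.inl h0

lemma isAtlas_mu4InvChart [CharP K 2] {c : k} (hc : c ≠ 0) :
    IsAtlas (mu4Curve K c) (curve K (modelCurve (c ^ 2))) ![1, 2] (mu4InvChart c) where
  isHomogeneous := isHomogeneous_mu4InvChart c
  covers v hv hX := by
    have hc' : algebraMap k K c ≠ 0 := (map_ne_zero _).2 hc
    rcases mu4Curve_cases hv hX with h2 | ⟨t, ht, rfl⟩
    · refine ⟨0, fun h => h2 ?_⟩
      have := congrFun h 2
      simpa [evalTuple_mu4InvChart_zero] using this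
    · refine ⟨1, fun h => ?_⟩
      have := congrFun h 1
      simp [evalTuple_mu4InvChart_one, ht, hc'] at this
  compatible v hv hX := by
    rw [mk_mem_mu4Curve_iff] at hX
    have h01 : Prop2 (evalTuple (mu4InvChart c 0) v) (evalTuple (mu4InvChart c 1) v) := by
      rw [evalTuple_mu4InvChart_zero, evalTuple_mu4InvChart_one]
      generalize algebraMap k K c = c at *
      apply prop2_fin_three <;> simp <;> grind
    intro j j'
    fin_cases j <;> fin_cases j'
    exacts [prop2_self _, h01, h01.symm, prop2_self _]
  mapsTo v hv hX j h := by
    rw [mk_mem_mu4Curve_iff] at hX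
    rw [mk_mem_modelCurve_iff, map_pow]
    clear h
    fin_cases j
    · simp only [Fin.zero_eta, evalTuple_mu4InvChart_zero]
      generalize algebraMap k K c = c at *
      simp
      grind
    · simp only [Fin.mk_one, evalTuple_mu4InvChart_one]
      generalize algebraMap k K c = c at *
      simp
      grind

lemma exists_iso_mu4Curve [CharP K 2] {c : k} (hc : c ≠ 0) :
    ∃ φ : Iso k (curve K (modelCurve (c ^ 2))) (mu4Curve K c),
      ∀ j, Represents φ.toEquiv 2 (mu4Chart c j) := by
  have hc' : algebraMap k K c ≠ 0 := (map_ne_zero _).2 hc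
  have h1 := isAtlas_mu4Chart (K := K) hc
  have h2 := isAtlas_mu4InvChart (K := K) hc
  refine h1.exists_iso h2 (fun v hv hX => ?_) (fun v hv hX => ?_)
  · rcases modelCurve_cases hv hX with ⟨t, ht, rfl⟩ | ⟨t, ht, x, y, rfl, h⟩
    · refine ⟨1, 1, fun h => ?_, fun h => ?_, ?_⟩
      · have := congrFun h 3
        simp [evalTuple_mu4Chart_one, ht] at this
      · have := congrFun h 1
        simp [evalTuple_mu4Chart_one, evalTuple_mu4InvChart_one, ht, hc'] at this
      · rw [evalTuple_mu4Chart_one, evalTuple_mu4InvChart_one]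
        apply prop2_fin_three <;> simp <;> grind
    · refine ⟨0, 0, fun h => ?_, fun h => ?_, ?_⟩
      · have := congrFun h 2
        simp [evalTuple_mu4Chart_zero, ht, hc'] at this
      · have := congrFun h 2
        simp [evalTuple_mu4Chart_zero, evalTuple_mu4InvChart_zero, ht, hc'] at this
      · rw [evalTuple_mu4Chart_zero, evalTuple_mu4InvChart_zero]
        generalize algebraMap k K c = c at *
        apply prop2_fin_three <;> simp <;> grind
  · rcases mu4Curve_cases hv hX with h0 | ⟨t, ht, rfl⟩
    · rw [mk_mem_mu4Curve_iff] at hX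
      refine ⟨0, 0, fun h => h0 ?_, fun h => ?_, ?_⟩
      · have := congrFun h 2
        simpa [evalTuple_mu4InvChart_zero] using this
      · have := congrFun h 2
        simp [evalTuple_mu4Chart_zero, evalTuple_mu4InvChart_zero, h0, hc'] at this
      · rw [evalTuple_mu4Chart_zero, evalTuple_mu4InvChart_zero]
        generalize algebraMap k K c = c at *
        apply prop2_fin_four <;> simp <;> grind
    · refine ⟨1, 1, fun h => ?_, fun h => ?_, ?_⟩
      · have := congrFun h 1
        simp [evalTuple_mu4InvChart_one, ht, hc'] at this
      · have := congrFun h 3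
        simp [evalTuple_mu4Chart_one, evalTuple_mu4InvChart_one, ht, hc',
          CharTwo.add_self_eq_zero] at this
      · rw [evalTuple_mu4Chart_one, evalTuple_mu4InvChart_one]
        generalize algebraMap k K c = c at *
        apply prop2_fin_four <;> simp <;> grind

end Mu4

/-! ### Smoothness of the two normal forms -/

section Smooth

variable {k K : Type*} [Field k] [Field K] [Algebra k K] [CharP K 2]

/-- Squares have zero derivative in characteristic 2, so up to the factor e the Jacobian rows are
(X₂, 0, X₀, 0) and (0, X₃, 0, X₁). They have disjoint supports, and neither vanishes on the curve:
X₀ = X₂ = 0 would give X₁² = X₃² and X₁ X₃ = 0, and likewise with the pairs exchanged. -/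
lemma isSmooth_z4Forms {e : k} (he : e ≠ 0) : IsSmoothCompleteIntersection K (z4Forms e) := by
  intro P hP
  have h0 := Projectivization.rep_nonzero P
  have hmk : Projectivization.mk K P.rep h0 ∈ z4Curve K e := by rwa [Projectivization.mk_rep]
  rw [mk_mem_z4Curve_iff] at hmk
  obtain ⟨h1, h2⟩ := hmk
  have he' : algebraMap k K e ≠ 0 := (map_ne_zero _).2 he
  have htwo : (2 : K) = 0 := CharTwo.two_eq_zero
  rw [Fintype.linearIndependent_iff]
  intro g hg
  generalize P.rep = w at *
  have c0 := congrFun hg 0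
  have c1 := congrFun hg 1
  have c2 := congrFun hg 2
  have c3 := congrFun hg 3
  simp [z4Forms, pderiv_X, htwo, he'] at c0 c1 c2 c3
  have key : ¬(w 0 = 0 ∧ w 2 = 0) ∧ ¬(w 1 = 0 ∧ w 3 = 0) := by
    have hw : ¬(w 0 = 0 ∧ w 1 = 0 ∧ w 2 = 0 ∧ w 3 = 0) := fun h => h0 (by
      ext i
      fin_cases i <;> simp [h])
    constructor
    · rintro ⟨ha, hb⟩
      simp [ha, hb] at h1 h2 hw
      have h3 : w 1 ^ 3 = 0 := by clear hw c0 c1 c2 c3; grind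
      have h4 : w 3 ^ 3 = 0 := by clear hw c0 c1 c2 c3; grind
      exact hw (pow_eq_zero_iff three_ne_zero |>.1 h3) (pow_eq_zero_iff three_ne_zero |>.1 h4)
    · rintro ⟨ha, hb⟩
      simp [ha, hb] at h1 h2 hw
      have h3 : w 0 ^ 3 = 0 := by clear hw c0 c1 c2 c3; grind
      have h4 : w 2 ^ 3 = 0 := by clear hw c0 c1 c2 c3; grind
      exact hw (pow_eq_zero_iff three_ne_zero |>.1 h3) (pow_eq_zero_iff three_ne_zero |>.1 h4)
  rw [Fin.forall_fin_two]
  constructor <;> grind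

lemma isSmooth_mu4Forms {c : k} (hc : c ≠ 0) : IsSmoothCompleteIntersection K (mu4Forms c) := by
  intro P hP
  have h0 := Projectivization.rep_nonzero P
  have hmk : Projectivization.mk K P.rep h0 ∈ mu4Curve K c := by rwa [Projectivization.mk_rep]
  rw [mk_mem_mu4Curve_iff] at hmk
  obtain ⟨h1, h2⟩ := hmk
  have hc' : algebraMap k K c ≠ 0 := (map_ne_zero _).2 hc
  have htwo : (2 : K) = 0 := CharTwo.two_eq_zero
  rw [Fintype.linearIndependent_iff]
  intro g hg
  generalize P.rep = w at *
  have c0 := congrFun hg 0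
  have c1 := congrFun hg 1
  have c2 := congrFun hg 2
  have c3 := congrFun hg 3
  simp [mu4Forms, pderiv_X, htwo, hc', Derivation.leibniz_pow] at c0 c1 c2 c3
  have key : ¬(w 0 = 0 ∧ w 2 = 0) ∧ ¬(w 1 = 0 ∧ w 3 = 0) := by
    have hw : ¬(w 0 = 0 ∧ w 1 = 0 ∧ w 2 = 0 ∧ w 3 = 0) := fun h => h0 (by
      ext i
      fin_cases i <;> simp [h])
    constructor
    · rintro ⟨ha, hb⟩
      simp [ha, hb, hc'] at h1 h2 hw
      have h3 : w 1 ^ 3 = 0 := by clear hw c0 c1 c2 c3; grind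
      have h4 : w 3 ^ 3 = 0 := by clear hw c0 c1 c2 c3; grind
      exact hw (pow_eq_zero_iff three_ne_zero |>.1 h3) (pow_eq_zero_iff three_ne_zero |>.1 h4)
    · rintro ⟨ha, hb⟩
      simp [ha, hb, hc'] at h1 h2 hw
      have h3 : w 0 ^ 3 = 0 := by clear hw c0 c1 c2 c3; grind
      have h4 : w 2 ^ 3 = 0 := by clear hw c0 c1 c2 c3; grind
      exact hw (pow_eq_zero_iff three_ne_zero |>.1 h3) (pow_eq_zero_iff three_ne_zero |>.1 h4)
  rw [Fin.forall_fin_two]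
  constructor <;> grind

end Smooth

/-! ### The map from the model curve to the ℤ/4ℤ-normal form -/

section Z4

variable {k : Type*} [Field k]

/-- The charts of the isomorphism from the model curve to the curve in `ℤ/4ℤ`-normal form. -/
def z4Chart (e : k) : Fin 3 → Fin 4 → MvPolynomial (Fin 3) k
  | 0 => ![X 0 * (X 1 + C e * X 0 + C e * X 2), C e * X 2 * (X 1 + C e * X 0 + C e * X 2),
      C e * X 2 * (X 1 + C e * X 2), X 0 * (X 1 + C e * X 2)]
  -- On the affine curve this is x² times the first chart, with x³ written as y² + e x y + e²; it is
  -- nonzero at infinity.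
  | 1 => ![(X 1 ^ 2 + C e * X 0 * X 1 + C e ^ 2 * X 2 ^ 2) * (X 1 + C e * X 0 + C e * X 2),
      C e * X 0 ^ 2 * (X 1 + C e * X 0 + C e * X 2), C e * X 0 ^ 2 * (X 1 + C e * X 2),
      (X 1 ^ 2 + C e * X 0 * X 1 + C e ^ 2 * X 2 ^ 2) * (X 1 + C e * X 2)]
  -- This is the first chart multiplied by (x² + e²)/(y + e), which removes its affine base point
  -- (0, e).
  | 2 => ![X 0 * (X 0 ^ 2 + C e ^ 2 * X 0 * X 2 + C e * X 1 * X 2),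
      C e * X 2 * (X 0 ^ 2 + C e ^ 2 * X 0 * X 2 + C e * X 1 * X 2),
      C e * X 2 * (X 0 ^ 2 + C e ^ 2 * X 2 ^ 2), X 0 * (X 0 ^ 2 + C e ^ 2 * X 2 ^ 2)]

/-- The charts of the inverse isomorphism. -/
def z4InvChart (e : k) : Fin 3 → Fin 3 → MvPolynomial (Fin 4) k
  -- The first chart gives x = e X₀/X₁ = e X₃/X₂, while X₂ : X₁ = (y + e) : (y + e x + e). Together
  -- with (y + e)(y + e x + e) = x (x + e)² on the curve, these determine y; the three tuples
  -- express the result with different denominators.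
  | 0 => ![C e * X 0 * X 1 ^ 2, C e * (X 1 + X 2) * (X 0 + X 1) ^ 2 + C e * X 1 ^ 3, X 1 ^ 3]
  | 1 => ![C e * X 3 * (X 0 + X 3), C e ^ 2 * X 3 ^ 2 + C e * X 2 * (X 0 + X 3), X 2 * (X 0 + X 3)]
  | 2 => ![C e * X 3 * (X 1 + X 2), C e ^ 2 * X 2 * X 3 + C e * X 2 * (X 1 + X 2), X 2 * (X 1 + X 2)]

variable {K : Type*} [Field K] [Algebra k K]

lemma evalTuple_z4Chart_zero (e : k) (v : Fin 3 → K) : evalTuple (z4Chart e 0) v =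
    ![v 0 * (v 1 + algebraMap k K e * v 0 + algebraMap k K e * v 2),
      algebraMap k K e * v 2 * (v 1 + algebraMap k K e * v 0 + algebraMap k K e * v 2),
      algebraMap k K e * v 2 * (v 1 + algebraMap k K e * v 2),
      v 0 * (v 1 + algebraMap k K e * v 2)] := by
  ext i
  fin_cases i <;> simp [evalTuple, z4Chart]

lemma evalTuple_z4Chart_one (e : k) (v : Fin 3 → K) : evalTuple (z4Chart e 1) v =
    ![(v 1 ^ 2 + algebraMap k K e * v 0 * v 1 + algebraMap k K e ^ 2 * v 2 ^ 2) *
        (v 1 + algebraMap k K e * v 0 + algebraMap k K e * v 2),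
      algebraMap k K e * v 0 ^ 2 * (v 1 + algebraMap k K e * v 0 + algebraMap k K e * v 2),
      algebraMap k K e * v 0 ^ 2 * (v 1 + algebraMap k K e * v 2),
      (v 1 ^ 2 + algebraMap k K e * v 0 * v 1 + algebraMap k K e ^ 2 * v 2 ^ 2) *
        (v 1 + algebraMap k K e * v 2)] := by
  ext i
  fin_cases i <;> simp [evalTuple, z4Chart]

lemma evalTuple_z4Chart_two (e : k) (v : Fin 3 → K) : evalTuple (z4Chart e 2) v =
    ![v 0 * (v 0 ^ 2 + algebraMap k K e ^ 2 * v 0 * v 2 + algebraMap k K e * v 1 * v 2),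
      algebraMap k K e * v 2 *
        (v 0 ^ 2 + algebraMap k K e ^ 2 * v 0 * v 2 + algebraMap k K e * v 1 * v 2),
      algebraMap k K e * v 2 * (v 0 ^ 2 + algebraMap k K e ^ 2 * v 2 ^ 2),
      v 0 * (v 0 ^ 2 + algebraMap k K e ^ 2 * v 2 ^ 2)] := by
  ext i
  fin_cases i <;> simp [evalTuple, z4Chart]

lemma evalTuple_z4InvChart_zero (e : k) (v : Fin 4 → K) : evalTuple (z4InvChart e 0) v =
    ![algebraMap k K e * v 0 * v 1 ^ 2,
      algebraMap k K e * (v 1 + v 2) * (v 0 + v 1) ^ 2 + algebraMap k K e * v 1 ^ 3,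
      v 1 ^ 3] := by
  ext i
  fin_cases i <;> simp [evalTuple, z4InvChart]

lemma evalTuple_z4InvChart_one (e : k) (v : Fin 4 → K) : evalTuple (z4InvChart e 1) v =
    ![algebraMap k K e * v 3 * (v 0 + v 3),
      algebraMap k K e ^ 2 * v 3 ^ 2 + algebraMap k K e * v 2 * (v 0 + v 3),
      v 2 * (v 0 + v 3)] := by
  ext i
  fin_cases i <;> simp [evalTuple, z4InvChart]

lemma evalTuple_z4InvChart_two (e : k) (v : Fin 4 → K) : evalTuple (z4InvChart e 2) v =
    ![algebraMap k K e * v 3 * (v 1 + v 2),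
      algebraMap k K e ^ 2 * v 2 * v 3 + algebraMap k K e * v 2 * (v 1 + v 2),
      v 2 * (v 1 + v 2)] := by
  ext i
  fin_cases i <;> simp [evalTuple, z4InvChart]

lemma isHomogeneous_z4Chart (e : k) (j : Fin 3) (i : Fin 4) :
    (z4Chart e j i).IsHomogeneous (![2, 3, 3] j) := by
  apply isHomogeneous_of_aeval_scale
  fin_cases j <;> fin_cases i <;> simp [z4Chart, algebraMap_eq] <;> ring

lemma isHomogeneous_z4InvChart (e : k) (j : Fin 3) (i : Fin 3) :
    (z4InvChart e j i).IsHomogeneous (![3, 2, 2] j) := by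
  apply isHomogeneous_of_aeval_scale
  fin_cases j <;> fin_cases i <;> simp [z4InvChart, algebraMap_eq] <;> ring

variable [CharP K 2]

lemma isAtlas_z4Chart {e : k} (he : e ≠ 0) :
    IsAtlas (curve K (modelCurve e)) (z4Curve K e) ![2, 3, 3] (z4Chart e) where
  isHomogeneous := isHomogeneous_z4Chart e
  covers v hv hX := by
    have he' : algebraMap k K e ≠ 0 := (map_ne_zero _).2 he
    rcases modelCurve_cases hv hX with ⟨t, ht, rfl⟩ | ⟨t, ht, x, y, rfl, hxy⟩
    · refine ⟨1, fun h => ?_⟩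
      have := congrFun h 3
      simp [evalTuple_z4Chart_one, ht] at this
    · by_cases hy : y + algebraMap k K e = 0
      · refine ⟨2, fun h => ?_⟩
        have h1 := congrFun h 1
        have h2 := congrFun h 2
        simp [evalTuple_z4Chart_two, ht, he'] at h1 h2
        generalize algebraMap k K e = e at *
        grind
      · refine ⟨0, fun h => ?_⟩
        have h2 := congrFun h 2
        simp [evalTuple_z4Chart_zero, ht, he'] at h2
        generalize algebraMap k K e = e at *
        grind
  compatible v hv hX := by
    rw [mk_mem_modelCurve_iff] at hX
    have h01 : Prop2 (evalTuple (z4Chart e 0) v) (evalTuple (z4Chart e 1) v) := by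
      rw [evalTuple_z4Chart_zero, evalTuple_z4Chart_one]
      generalize algebraMap k K e = e at *
      apply prop2_fin_four <;> simp <;> grind
    have h02 : Prop2 (evalTuple (z4Chart e 0) v) (evalTuple (z4Chart e 2) v) := by
      rw [evalTuple_z4Chart_zero, evalTuple_z4Chart_two]
      generalize algebraMap k K e = e at *
      apply prop2_fin_four <;> simp <;> grind
    have h12 : Prop2 (evalTuple (z4Chart e 1) v) (evalTuple (z4Chart e 2) v) := by
      rw [evalTuple_z4Chart_one, evalTuple_z4Chart_two]
      generalize algebraMap k K e = e at *
      apply prop2_fin_four <;> simp <;> grind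
    intro j j'
    fin_cases j <;> fin_cases j'
    exacts [prop2_self _, h01, h02, h01.symm, prop2_self _, h12, h02.symm, h12.symm, prop2_self _]
  mapsTo v hv hX j h := by
    rw [mk_mem_modelCurve_iff] at hX
    rw [mk_mem_z4Curve_iff]
    clear h
    fin_cases j
    · simp only [Fin.zero_eta, evalTuple_z4Chart_zero]
      generalize algebraMap k K e = e at *
      constructor <;> simp <;> grind
    · simp only [Fin.mk_one, evalTuple_z4Chart_one]
      generalize algebraMap k K e = e at *
      constructor <;> simp <;> grind
    · simp only [Fin.reduceFinMk, evalTuple_z4Chart_two]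
      generalize algebraMap k K e = e at *
      constructor <;> simp <;> grind

end Z4

/-! ### The inverse map from the ℤ/4ℤ-normal form -/

section Z4Inv

variable {k K : Type*} [Field k] [Field K] [Algebra k K] [CharP K 2]

lemma z4Curve_cases {e : k} (he : e ≠ 0) {v : Fin 4 → K} (hv : v ≠ 0)
    (h : Projectivization.mk K v hv ∈ z4Curve K e) :
    v 1 ≠ 0 ∨ (∃ t : K, t ≠ 0 ∧ v = t • ![1, 0, 0, 1]) ∨ ∃ t : K, t ≠ 0 ∧ v = t • ![0, 0, 1, 1] := by
  have he' : algebraMap k K e ≠ 0 := (map_ne_zero _).2 he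
  rw [mk_mem_z4Curve_iff] at h
  obtain ⟨h1, h2⟩ := h
  by_cases h0 : v 1 = 0
  · right
    simp [h0] at h1 h2
    rw [h2] at h1
    have h3 : v 0 = 0 ∨ v 2 = 0 := by simpa [he'] using h1.symm
    rcases h3 with h3 | h3
    · have h4 : v 2 = v 3 := by
        have : (v 2 - v 3) ^ 2 = 0 := by grind
        exact sub_eq_zero.1 (pow_eq_zero_iff two_ne_zero |>.1 this)
      refine Or.inr ⟨v 3, fun h5 => hv ?_, ?_⟩ <;> ext i <;> fin_cases i <;> simp [h0, h3, h4]
      · exact h5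
      · exact h5
    · have h4 : v 0 = v 3 := by
        have : (v 0 - v 3) ^ 2 = 0 := by grind
        exact sub_eq_zero.1 (pow_eq_zero_iff two_ne_zero |>.1 this)
      refine Or.inl ⟨v 3, fun h5 => hv ?_, ?_⟩ <;> ext i <;> fin_cases i <;> simp [h0, h3, h4]
      · exact h5
      · exact h5
  · exact Or.inl h0

lemma isAtlas_z4InvChart {e : k} (he : e ≠ 0) :
    IsAtlas (z4Curve K e) (curve K (modelCurve e)) ![3, 2, 2] (z4InvChart e) where
  isHomogeneous := isHomogeneous_z4InvChart e
  covers v hv hX := by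
    have he' : algebraMap k K e ≠ 0 := (map_ne_zero _).2 he
    rcases z4Curve_cases he hv hX with h1 | ⟨t, ht, rfl⟩ | ⟨t, ht, rfl⟩
    · refine ⟨0, fun h => h1 ?_⟩
      have := congrFun h 2
      simpa [evalTuple_z4InvChart_zero] using this
    · refine ⟨1, fun h => ?_⟩
      have := congrFun h 1
      simp [evalTuple_z4InvChart_one, ht, he', CharTwo.add_self_eq_zero] at this
    · refine ⟨2, fun h => ?_⟩
      have := congrFun h 2
      simp [evalTuple_z4InvChart_two, ht] at this
  compatible v hv hX := by
    have he' : algebraMap k K e ≠ 0 := (map_ne_zero _).2 he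
    rw [mk_mem_z4Curve_iff] at hX
    have h01 : Prop2 (evalTuple (z4InvChart e 0) v) (evalTuple (z4InvChart e 1) v) := by
      rw [evalTuple_z4InvChart_zero, evalTuple_z4InvChart_one]
      generalize algebraMap k K e = e at *
      apply prop2_fin_three <;> simp <;> grind
    have h02 : Prop2 (evalTuple (z4InvChart e 0) v) (evalTuple (z4InvChart e 2) v) := by
      rw [evalTuple_z4InvChart_zero, evalTuple_z4InvChart_two]
      generalize algebraMap k K e = e at *
      apply prop2_fin_three <;> simp <;> grind
    have h12 : Prop2 (evalTuple (z4InvChart e 1) v) (evalTuple (z4InvChart e 2) v) := by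
      rw [evalTuple_z4InvChart_one, evalTuple_z4InvChart_two]
      generalize algebraMap k K e = e at *
      apply prop2_fin_three <;> simp <;> grind
    intro j j'
    fin_cases j <;> fin_cases j'
    exacts [prop2_self _, h01, h02, h01.symm, prop2_self _, h12, h02.symm, h12.symm, prop2_self _]
  mapsTo v hv hX j h := by
    rw [mk_mem_z4Curve_iff] at hX
    rw [mk_mem_modelCurve_iff]
    have he' : algebraMap k K e ≠ 0 := (map_ne_zero _).2 he
    clear h
    fin_cases j
    · simp only [Fin.zero_eta, evalTuple_z4InvChart_zero]
      generalize algebraMap k K e = e at *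
      simp
      grind
    · simp only [Fin.mk_one, evalTuple_z4InvChart_one]
      generalize algebraMap k K e = e at *
      simp
      grind
    · simp only [Fin.reduceFinMk, evalTuple_z4InvChart_two]
      generalize algebraMap k K e = e at *
      simp
      grind

lemma prop2_evalTuple_z4Chart_zero {e : k} {v : Fin 4 → K} (hv : v ≠ 0)
    (hX : Projectivization.mk K v hv ∈ z4Curve K e) :
    Prop2 (evalTuple (z4Chart e 0) (evalTuple (z4InvChart e 0) v)) v := by
  rw [mk_mem_z4Curve_iff] at hX
  rw [evalTuple_z4Chart_zero, evalTuple_z4InvChart_zero]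
  generalize algebraMap k K e = e at *
  simp only [Matrix.cons_val]
  -- Here `W` and `U` stand for y + e and y + e x + e at the image point, up to the factor X₁³. Only
  -- the proportions X₂ : X₁ = X₃ : X₀ = W : U are needed afterwards.
  generalize hW : e * (v 1 + v 2) * (v 0 + v 1) ^ 2 + e * v 1 ^ 3 + e * v 1 ^ 3 = W
  generalize hU : e * (v 1 + v 2) * (v 0 + v 1) ^ 2 + e * v 1 ^ 3 + e * (e * v 0 * v 1 ^ 2) +
    e * v 1 ^ 3 = U
  have h12 : v 2 * U = v 1 * W := by grind
  have h03 : v 3 * U = v 0 * W ∨ v 1 = 0 := by grind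
  rcases h03 with h03 | h03
  · clear hW hU
    apply prop2_fin_four <;> simp <;> grind
  · apply prop2_fin_four <;> simp [h03]

set_option maxHeartbeats 1000000 in
lemma exists_iso_z4Curve {e : k} (he : e ≠ 0) :
    ∃ φ : Iso k (curve K (modelCurve e)) (z4Curve K e),
      ∀ j, Represents φ.toEquiv (![2, 3, 3] j) (z4Chart e j) := by
  have he' : algebraMap k K e ≠ 0 := (map_ne_zero _).2 he
  have h1 := isAtlas_z4Chart (K := K) he
  have h2 := isAtlas_z4InvChart (K := K) he
  refine h1.exists_iso h2 (fun v hv hX => ?_) (fun v hv hX => ?_)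
  · rcases modelCurve_cases hv hX with ⟨t, ht, rfl⟩ | ⟨t, ht, x, y, rfl, h⟩
    · refine ⟨1, 1, fun h => ?_, fun h => ?_, ?_⟩
      · have := congrFun h 3
        simp [evalTuple_z4Chart_one, ht] at this
      · have := congrFun h 1
        simp [evalTuple_z4Chart_one, evalTuple_z4InvChart_one, ht, he',
          CharTwo.add_self_eq_zero] at this
      · rw [evalTuple_z4Chart_one, evalTuple_z4InvChart_one]
        apply prop2_fin_three <;> simp <;> grind
    -- The factors y + e and y + e x + e govern where the first chart, or the inverse tuple applied
    -- to it, degenerates; each case picks a pair of tuples that survives.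
    · by_cases hw : y + algebraMap k K e = 0
      · by_cases hx : x = 0
        · subst hx
          refine ⟨2, 0, fun h => ?_, fun h => ?_, ?_⟩
          · have := congrFun h 1
            simp [evalTuple_z4Chart_two, ht, he'] at this
            grind
          · have := congrFun h 2
            simp [evalTuple_z4Chart_two, evalTuple_z4InvChart_zero, ht, he'] at this
            grind
          · rw [evalTuple_z4Chart_two, evalTuple_z4InvChart_zero]
            generalize algebraMap k K e = e at *
            apply prop2_fin_three <;> simp <;> grind
        · have hu : y + algebraMap k K e * x + algebraMap k K e ≠ 0 := by
            generalize algebraMap k K e = e at *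
            grind
          refine ⟨0, 0, fun h => ?_, fun h => ?_, ?_⟩
          · have := congrFun h 1
            simp [evalTuple_z4Chart_zero, ht, he'] at this
            grind
          · have := congrFun h 2
            simp [evalTuple_z4Chart_zero, evalTuple_z4InvChart_zero, ht, he', ← mul_add] at this
            grind
          · rw [evalTuple_z4Chart_zero, evalTuple_z4InvChart_zero]
            generalize algebraMap k K e = e at *
            apply prop2_fin_three <;> simp <;> grind
      · by_cases hu : y + algebraMap k K e * x + algebraMap k K e = 0
        · have hx : x ≠ 0 := by
            rintro rfl
            grind
          refine ⟨0, 2, fun h => ?_, fun h => ?_, ?_⟩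
          · have := congrFun h 2
            simp [evalTuple_z4Chart_zero, ht, he'] at this
            grind
          · have := congrFun h 2
            simp [evalTuple_z4Chart_zero, evalTuple_z4InvChart_two, ht, he', ← mul_add] at this
            generalize algebraMap k K e = e at *
            grind
          · rw [evalTuple_z4Chart_zero, evalTuple_z4InvChart_two]
            generalize algebraMap k K e = e at *
            apply prop2_fin_three <;> simp <;> grind
        · refine ⟨0, 0, fun h => ?_, fun h => ?_, ?_⟩
          · have := congrFun h 1
            simp [evalTuple_z4Chart_zero, ht, he'] at this
            grind
          · have := congrFun h 2
            simp [evalTuple_z4Chart_zero, evalTuple_z4InvChart_zero, ht, he', ← mul_add] at this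
            grind
          · rw [evalTuple_z4Chart_zero, evalTuple_z4InvChart_zero]
            generalize algebraMap k K e = e at *
            apply prop2_fin_three <;> simp <;> grind
  · rcases z4Curve_cases he hv hX with h0 | ⟨t, ht, rfl⟩ | ⟨t, ht, rfl⟩
    · rw [mk_mem_z4Curve_iff] at hX
      -- The exceptional point is (0 : 1 : 1 : 0), the image of (0, e), where the first chart
      -- vanishes and the third is needed.
      by_cases h00 : v 0 = 0 ∧ v 1 = v 2
      · have h3 : v 3 = 0 := by grind
        obtain ⟨h00, h12⟩ := h00
        have hv1 : v 2 ≠ 0 := h12 ▸ h0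
        refine ⟨0, 2, fun h => h0 ?_, fun h => ?_, ?_⟩
        · have := congrFun h 2
          simpa [evalTuple_z4InvChart_zero] using this
        · have := congrFun h 1
          simp [evalTuple_z4Chart_two, evalTuple_z4InvChart_zero, h00, h12, hv1, he',
            CharTwo.add_self_eq_zero] at this
        · rw [evalTuple_z4Chart_two, evalTuple_z4InvChart_zero]
          generalize algebraMap k K e = e at *
          apply prop2_fin_four <;> simp [h00, h12, h3, CharTwo.add_self_eq_zero]
          exact Or.inl (Or.inl (by ring))
      · refine ⟨0, 0, fun h => h0 ?_, fun h => ?_, ?_⟩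
        · have := congrFun h 2
          simpa [evalTuple_z4InvChart_zero] using this
        · have h1 := congrFun h 1
          have h2 := congrFun h 2
          simp [evalTuple_z4Chart_zero, evalTuple_z4InvChart_zero, h0, he'] at h1 h2
          generalize algebraMap k K e = e at *
          have h3 : v 0 = 0 := by grind
          grind
        · exact prop2_evalTuple_z4Chart_zero hv (mk_mem_z4Curve_iff hv |>.2 hX)
    · refine ⟨1, 1, fun h => ?_, fun h => ?_, ?_⟩
      · have := congrFun h 1
        simp [evalTuple_z4InvChart_one, ht, he', CharTwo.add_self_eq_zero] at this
      · have := congrFun h 3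
        simp [evalTuple_z4Chart_one, evalTuple_z4InvChart_one, ht, he',
          CharTwo.add_self_eq_zero] at this
      · rw [evalTuple_z4Chart_one, evalTuple_z4InvChart_one]
        generalize algebraMap k K e = e at *
        apply prop2_fin_four <;> simp <;> grind
    · refine ⟨2, 0, fun h => ?_, fun h => ?_, ?_⟩
      · have := congrFun h 2
        simp [evalTuple_z4InvChart_two, ht] at this
      · have := congrFun h 2
        simp [evalTuple_z4Chart_zero, evalTuple_z4InvChart_two, ht, he'] at this
        grind
      · rw [evalTuple_z4Chart_zero, evalTuple_z4InvChart_two]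
        generalize algebraMap k K e = e at *
        apply prop2_fin_four <;> simp <;> grind

end Z4Inv

/-! ### Extension of scalars from k to K -/

section BaseChange

variable {k K : Type*} [Field k] [Field K] [Algebra k K]

lemma evalTuple_map {m n : ℕ} (p : Fin n → MvPolynomial (Fin m) k) (v : Fin m → K) :
    evalTuple (fun i => map (algebraMap k K) (p i)) v = evalTuple p v :=
  funext fun i => by simp [evalTuple, aeval_map_algebraMap]

lemma Represents.map {m n : ℕ} {X : Set (PSpace K m)} {Y : Set (PSpace K n)} {φ : X → Y} {d : ℕ}
    {p : Fin (n + 1) → MvPolynomial (Fin (m + 1)) k} (h : Represents φ d p) :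
    Represents φ d (fun i => MvPolynomial.map (algebraMap k K) (p i)) where
  isHomogeneous i := (h.isHomogeneous i).map _
  eq_mk v hv hX h0 := by
    have h1 : evalTuple p v ≠ 0 := by rwa [evalTuple_map] at h0
    rw [h.eq_mk v hv hX h1]
    simp only [evalTuple_map]

lemma IsMorphism.map {m n : ℕ} {X : Set (PSpace K m)} {Y : Set (PSpace K n)} {φ : X → Y}
    (h : IsMorphism k φ) : IsMorphism K φ := by
  rw [isMorphism_iff] at *
  intro v hv hX
  obtain ⟨d, p, hp, h0⟩ := h v hv hX
  exact ⟨d, _, hp.map, by rwa [evalTuple_map]⟩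

lemma curve_baseChange (W : WeierstrassCurve k) : curve K W = curve K (W.baseChange K) := by
  ext P
  rw [← Projectivization.mk_rep P, mk_mem_curve_iff, mk_mem_curve_iff]
  simp [WeierstrassCurve.baseChange]

end BaseChange

/-! ### Automorphisms fixing infinity and their action on functions -/

section Endomorphism

variable {K : Type*} [Field K] {W : WeierstrassCurve K}

/-- The pole order of f is the dimension of the quotient by (f), which an algebra automorphism
preserves. -/
lemma poleOrder_algEquiv (θ : W.toAffine.CoordinateRing ≃ₐ[K] W.toAffine.CoordinateRing)
    (f : W.toAffine.CoordinateRing) : poleOrder (θ f) = poleOrder f := by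
  by_cases hf : f = 0
  · rw [hf, map_zero]
  rw [← finrank_quotient_span_singleton hf,
    ← finrank_quotient_span_singleton ((map_ne_zero_iff _ θ.injective).2 hf)]
  refine (Ideal.quotientEquivAlg _ _ θ ?_).toLinearEquiv.finrank_eq.symm
  rw [Ideal.map_span, Set.image_singleton]
  rfl

lemma exists_eq_of_poleOrder_le_three {f : W.toAffine.CoordinateRing} (h : poleOrder f ≤ 3) :
    ∃ a b c : K, f = algebraMap K _ a * yFun _ + algebraMap K _ b * xFun _ + algebraMap K _ c ∧
      (poleOrder f ≤ 2 → a = 0) := by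
  obtain ⟨p, q, rfl⟩ := exists_eq_aeval f
  have h1 := poleOrder_le_iff.1 h
  have hp : p = Polynomial.C (p.coeff 1) * Polynomial.X + Polynomial.C (p.coeff 0) := by
    ext i
    rcases i with _ | _ | i
    · simp
    · simp
    · rw [h1.1 _ (by omega)]
      simp
  have hq : q = Polynomial.C (q.coeff 0) := by
    ext i
    rcases i with _ | i
    · simp
    · rw [h1.2 _ (by omega), Polynomial.coeff_C_succ]
  refine ⟨q.coeff 0, p.coeff 1, p.coeff 0, ?_, fun h2 => (poleOrder_le_iff.1 h2).2 0 (by omega)⟩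
  conv_lhs => rw [hp, hq]
  simp
  ring

variable [IsAlgClosed K]

/-- The pullback of functions under an endomorphism that preserves the affine part. -/
lemma exists_pullback {τ : curve K W → curve K W} (hτ : IsMorphism K τ)
    (haff : ∀ x y (h : W.toAffine.Equation x y), (τ ⟨_, affine_mem_curve h⟩ : PSpace K 2) ≠
      Projectivization.mk K ![0, 1, 0] infinity_ne_zero) :
    ∃ θ : W.toAffine.CoordinateRing →ₐ[K] W.toAffine.CoordinateRing,
      ∀ x y (h : W.toAffine.Equation x y), ∃ h', τ ⟨_, affine_mem_curve h⟩ =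
        ⟨Projectivization.mk K ![evalAt h (θ (xFun _)), evalAt h (θ (yFun _)), 1]
          (affine_ne_zero _ _), h'⟩ := by
  have hloc : ∀ x y (h : W.toAffine.Equation x y), ∃ (d : ℕ) (q : Fin 3 → MvPolynomial (Fin 3) K),
      Represents τ d q ∧ evalAt h (dehom W.toAffine (q 2)) ≠ 0 := by
    intro x y h
    obtain ⟨d, q, hq, hq0⟩ := isMorphism_iff.1 hτ _ (affine_ne_zero x y) (affine_mem_curve h)
    refine ⟨d, q, hq, fun h2 => haff x y h ?_⟩
    have h1 := hq.eq_mk _ (affine_ne_zero x y) (affine_mem_curve h) hq0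
    have h3 : evalTuple q ![x, y, 1] 2 = 0 := (congrFun (evalTuple_affine h q) 2).trans h2
    rcases eq_infinity_or_affine hq0 (h1 ▸ (τ ⟨_, affine_mem_curve h⟩).2) with
      ⟨t, ht, h4⟩ | ⟨t, ht, a, b, -, h4⟩
    · rw [h1, mk_eq_mk_iff_prop2, h4]
      intro i j
      simp only [Pi.smul_apply]
      ring
    · rw [h4] at h3
      simp [ht] at h3
  obtain ⟨x₀, y₀, h₀⟩ : ∃ x y, W.toAffine.Equation x y := by
    obtain ⟨x, y, h, -⟩ := exists_le_XYIdeal (W := W.toAffine)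
      (bot_ne_top : (⊥ : Ideal W.toAffine.CoordinateRing) ≠ ⊤)
    exact ⟨x, y, h⟩
  obtain ⟨d, p, hp, hp2⟩ := hloc x₀ y₀ h₀
  have hp2' : dehom W.toAffine (p 2) ≠ 0 := fun h => hp2 (by rw [h, map_zero])
  have hdvd : ∀ i, ∃ a, dehom W.toAffine (p i) = dehom W.toAffine (p 2) * a := by
    intro i
    -- The ideal of denominators of pᵢ/p₂. It contains the last entry of a chart around each affine
    -- point, and that entry is nonzero there, so `J` lies in no maximal ideal and the quotient is a
    -- regular function.
    let J : Ideal W.toAffine.CoordinateRing :=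
      Submodule.comap (LinearMap.mulRight W.toAffine.CoordinateRing (dehom W.toAffine (p i)))
        (Ideal.span {dehom W.toAffine (p 2)})
    have hJ : J = ⊤ := by
      by_contra hne
      obtain ⟨x, y, h, hle⟩ := exists_le_XYIdeal hne
      obtain ⟨d', q, hq, hq2⟩ := hloc x y h
      refine hq2 ((evalAt_eq_zero_iff h _).2 (hle ?_))
      change dehom W.toAffine (q 2) * dehom W.toAffine (p i) ∈ Ideal.span _
      rw [mul_comm, hp.dehom_mul_dehom hq i 2]
      exact Ideal.mul_mem_right _ _ (Ideal.mem_span_singleton_self _)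
    have h1 : (1 : W.toAffine.CoordinateRing) ∈ J := hJ ▸ Submodule.mem_top
    change 1 * dehom W.toAffine (p i) ∈ Ideal.span _ at h1
    rw [one_mul, Ideal.mem_span_singleton] at h1
    exact h1
  choose a ha using hdvd
  have hval : ∀ x y (h : W.toAffine.Equation x y), (τ ⟨_, affine_mem_curve h⟩ : PSpace K 2) =
      Projectivization.mk K ![evalAt h (a 0), evalAt h (a 1), 1] (affine_ne_zero _ _) := by
    intro x y h
    obtain ⟨d', q, hq, hq2⟩ := hloc x y h
    have h1 : ∀ i, dehom W.toAffine (q i) = dehom W.toAffine (q 2) * a i := fun i => by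
      have := hp.dehom_mul_dehom hq i 2
      rw [ha i, mul_assoc] at this
      rw [← mul_left_cancel₀ hp2' this, mul_comm]
    have h2 : evalTuple q ![x, y, 1] ≠ 0 := fun h3 => hq2 (by
      rw [← congrFun (evalTuple_affine h q) 2, h3, Pi.zero_apply])
    rw [hq.eq_mk _ (affine_ne_zero x y) (affine_mem_curve h) h2, mk_eq_mk_iff_prop2]
    have h3 : evalTuple q ![x, y, 1] = fun i => evalAt h (dehom W.toAffine (q 2)) * evalAt h (a i) := by
      rw [evalTuple_affine h]
      funext i
      rw [h1 i, map_mul]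
    have h4 : evalAt h (a 2) = 1 := by
      have := h1 2
      rw [eq_comm, mul_eq_left₀ (fun h0 => hq2 (by rw [h0, map_zero]))] at this
      rw [this, map_one]
    rw [h3]
    apply prop2_fin_three <;> simp [h4] <;> ring
  have heq : ∀ x y (h : W.toAffine.Equation x y),
      W.toAffine.Equation (evalAt h (a 0)) (evalAt h (a 1)) := by
    intro x y h
    have h1 := hval x y h ▸ (τ ⟨_, affine_mem_curve h⟩).2
    rw [affine_mem_curve_iff] at h1
    simpa [WeierstrassCurve.baseChange] using h1
  obtain ⟨θ, hx, hy⟩ := exists_algHom (W := W.toAffine) (a := a 0) (b := a 1) (by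
    refine eq_of_forall_evalAt fun x y h => ?_
    have := (WeierstrassCurve.Affine.equation_iff _ _).1 (heq x y h)
    simp only [map_add, map_mul, map_pow, AlgHom.commutes]
    exact this)
  refine ⟨θ, fun x y h => ⟨?_, Subtype.ext ?_⟩⟩
  · rw [hx, hy]
    exact affine_mem_curve (heq x y h)
  · simp only [hx, hy]
    exact hval x y h

/-- An automorphism of a Weierstrass curve that fixes the point at infinity induces an automorphism
of the affine coordinate ring. -/
lemma exists_algEquiv {τ : curve K W ≃ curve K W} (hτ : IsMorphism K τ)
    (hτ' : IsMorphism K τ.symm)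
    (h0 : τ ⟨_, infinity_mem_curve⟩ = ⟨_, infinity_mem_curve⟩) :
    ∃ θ : W.toAffine.CoordinateRing ≃ₐ[K] W.toAffine.CoordinateRing,
      ∀ x y (h : W.toAffine.Equation x y), ∃ h', τ ⟨_, affine_mem_curve h⟩ =
        ⟨Projectivization.mk K ![evalAt h (θ (xFun _)), evalAt h (θ (yFun _)), 1]
          (affine_ne_zero _ _), h'⟩ := by
  have hne : ∀ x y : K, (Projectivization.mk K ![x, y, 1] (affine_ne_zero x y) : PSpace K 2) ≠
      Projectivization.mk K ![0, 1, 0] infinity_ne_zero := by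
    intro x y h
    have := (mk_eq_mk_iff_prop2 _ _).1 h 1 2
    simp at this
  have h0' : τ.symm ⟨_, infinity_mem_curve⟩ = ⟨_, infinity_mem_curve⟩ := by
    rw [Equiv.symm_apply_eq, h0]
  have haux : ∀ σ : curve K W ≃ curve K W, IsMorphism K σ →
      σ ⟨_, infinity_mem_curve⟩ = ⟨_, infinity_mem_curve⟩ →
      ∃ θ : W.toAffine.CoordinateRing →ₐ[K] W.toAffine.CoordinateRing,
      ∀ x y (h : W.toAffine.Equation x y), ∃ h', σ ⟨_, affine_mem_curve h⟩ =
        ⟨Projectivization.mk K ![evalAt h (θ (xFun _)), evalAt h (θ (yFun _)), 1]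
          (affine_ne_zero _ _), h'⟩ := fun σ hσ hσ0 =>
    exists_pullback hσ fun x y h h1 => hne x y (congrArg Subtype.val
      (σ.injective ((Subtype.ext h1).trans hσ0.symm)))
  have hcomp : ∀ (σ : curve K W ≃ curve K W)
      (θ θ' : W.toAffine.CoordinateRing →ₐ[K] W.toAffine.CoordinateRing),
      (∀ x y (h : W.toAffine.Equation x y), ∃ h', σ ⟨_, affine_mem_curve h⟩ =
        ⟨Projectivization.mk K ![evalAt h (θ (xFun _)), evalAt h (θ (yFun _)), 1]
          (affine_ne_zero _ _), h'⟩) →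
      (∀ x y (h : W.toAffine.Equation x y), ∃ h', σ.symm ⟨_, affine_mem_curve h⟩ =
        ⟨Projectivization.mk K ![evalAt h (θ' (xFun _)), evalAt h (θ' (yFun _)), 1]
          (affine_ne_zero _ _), h'⟩) → θ.comp θ' = AlgHom.id K _ := by
    intro σ θ θ' hθ hθ'
    have key : ∀ x y (h : W.toAffine.Equation x y), evalAt h (θ (θ' (xFun _))) = x ∧
        evalAt h (θ (θ' (yFun _))) = y := by
      intro x y h
      obtain ⟨h1, h2⟩ := hθ x y h
      have h3 : W.toAffine.Equation (evalAt h (θ (xFun _))) (evalAt h (θ (yFun _))) :=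
        equation_of_algHom ((evalAt h).comp θ)
      have h4 : (evalAt h).comp θ = evalAt h3 := algHom_ext_xy (by simp) (by simp)
      obtain ⟨h5, h6⟩ := hθ' _ _ h3
      rw [← h2, Equiv.symm_apply_apply, Subtype.mk.injEq, mk_eq_mk_iff_prop2] at h6
      have h7 := h6 0 2
      have h8 := h6 1 2
      simp only [Matrix.cons_val_zero, Matrix.cons_val_one, Matrix.cons_val, mul_one, one_mul,
        ← h4, AlgHom.comp_apply] at h7 h8
      exact ⟨h7.symm, h8.symm⟩
    apply algHom_ext_xy <;> refine eq_of_forall_evalAt fun x y h => ?_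
    · simpa using (key x y h).1
    · simpa using (key x y h).2
  obtain ⟨θ, hθ⟩ := haux τ hτ h0
  obtain ⟨θ', hθ'⟩ := haux τ.symm hτ' h0'
  exact ⟨AlgEquiv.ofAlgHom θ θ' (hcomp τ θ θ' hθ hθ') (hcomp τ.symm θ' θ hθ' hθ), hθ⟩

end Endomorphism

/-! ### Rigidity of the model curve with its point of order four -/

section ModelAutomorphism

variable {K : Type*} [Field K]

lemma equation_modelCurve_iff {e x y : K} : (modelCurve e).toAffine.Equation x y ↔
    y ^ 2 + e * x * y = x ^ 3 + e ^ 2 := by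
  rw [WeierstrassCurve.Affine.equation_iff]
  simp [modelCurve]

lemma equation_modelCurve_self (e : K) : (modelCurve e).toAffine.Equation e e := by
  rw [equation_modelCurve_iff]
  ring

lemma modelCurve_equation_xy (e : K) :
    yFun (modelCurve e).toAffine ^ 2 + algebraMap K _ e * xFun _ * yFun _ =
      xFun (modelCurve e).toAffine ^ 3 + algebraMap K _ e ^ 2 := by
  have h := equation_xy (W := (modelCurve e).toAffine)
  have h₁ : (modelCurve e).toAffine.a₁ = e := rfl
  have h₂ : (modelCurve e).toAffine.a₂ = 0 := rfl
  have h₃ : (modelCurve e).toAffine.a₃ = 0 := rfl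
  have h₄ : (modelCurve e).toAffine.a₄ = 0 := rfl
  have h₆ : (modelCurve e).toAffine.a₆ = e ^ 2 := rfl
  rw [h₁, h₂, h₃, h₄, h₆, map_zero, map_pow] at h
  linear_combination h

lemma poleOrder_algebraMap {W : WeierstrassCurve.Affine K} (a : K) :
    poleOrder (algebraMap K W.CoordinateRing a) = 0 := by
  have h := poleOrder_le_iff (W := W) (p := Polynomial.C a) (q := 0) (n := 0)
  rw [map_zero, zero_mul, add_zero, Polynomial.aeval_C] at h
  refine Nat.le_zero.1 (h.2 ⟨fun i hi => ?_, fun _ _ => rfl⟩)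
  rw [Polynomial.coeff_C, if_neg (by omega)]

lemma coeff_eq_zero_of_xFun_yFun {W : WeierstrassCurve.Affine K} {a₀ a₁ a₂ a₃ b₀ b₁ : K}
    (h : algebraMap K _ a₃ * xFun W ^ 3 + algebraMap K _ a₂ * xFun W ^ 2 +
      algebraMap K _ a₁ * xFun W + algebraMap K _ a₀ +
      (algebraMap K _ b₁ * xFun W + algebraMap K _ b₀) * yFun W = 0) :
    a₃ = 0 ∧ a₂ = 0 ∧ a₁ = 0 ∧ a₀ = 0 ∧ b₁ = 0 ∧ b₀ = 0 := by
  have h1 := coord_aeval (W := W) (Polynomial.C a₃ * Polynomial.X ^ 3 +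
    Polynomial.C a₂ * Polynomial.X ^ 2 + Polynomial.C a₁ * Polynomial.X + Polynomial.C a₀)
    (Polynomial.C b₁ * Polynomial.X + Polynomial.C b₀)
  simp only [map_add, map_mul, map_pow, Polynomial.aeval_X, Polynomial.aeval_C] at h1
  simp only [← map_add, h] at h1
  rw [map_zero, map_zero] at h1
  obtain ⟨h2, h3⟩ := h1
  have c : ∀ i, _ := fun i => congrArg (Polynomial.coeff · i) h2
  have d : ∀ i, _ := fun i => congrArg (Polynomial.coeff · i) h3
  have c0 := c 0
  have c1 := c 1
  have c2 := c 2
  have c3 := c 3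
  have d0 := d 0
  have d1 := d 1
  simp [Polynomial.coeff_X, Polynomial.coeff_C, Polynomial.coeff_X_pow] at c0 c1 c2 c3 d0 d1
  exact ⟨c3.symm, c2.symm, c1.symm, c0.symm, d1.symm, d0.symm⟩

/-- Preservation of pole orders makes θ affine: x ↦ a x + b, y ↦ α y + β x + γ with a ≠ 0. Comparing
coefficients in the curve equation gives α² = a³, e a α = e α² and e b α = 0, so a = α = 1 and b =
0; the coefficient of x then gives γ = 0. The condition on β is left aside, as the marked point
determines β. -/
lemma algEquiv_modelCurve [CharP K 2] {e : K} (he : e ≠ 0)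
    (θ : (modelCurve e).toAffine.CoordinateRing ≃ₐ[K] (modelCurve e).toAffine.CoordinateRing) :
    ∃ b, θ (xFun _) = xFun _ ∧ θ (yFun _) = yFun _ + algebraMap K _ b * xFun _ := by
  obtain ⟨a', a, b, hx, ha'⟩ := exists_eq_of_poleOrder_le_three (f := θ (xFun _))
    (by rw [poleOrder_algEquiv, poleOrder_xFun]; norm_num)
  obtain ⟨α, β, γ, hy, -⟩ := exists_eq_of_poleOrder_le_three (f := θ (yFun _))
    (by rw [poleOrder_algEquiv, poleOrder_yFun])
  rw [ha' (by rw [poleOrder_algEquiv, poleOrder_xFun]), map_zero, zero_mul, zero_add] at hx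
  have ha : a ≠ 0 := by
    rintro rfl
    rw [map_zero, zero_mul, zero_add, ← AlgEquiv.commutes θ, θ.injective.eq_iff] at hx
    have := poleOrder_xFun (W := (modelCurve e).toAffine)
    rw [hx, poleOrder_algebraMap] at this
    exact absurd this (by norm_num)
  have h := congrArg θ (modelCurve_equation_xy e)
  simp only [map_add, map_mul, map_pow, AlgEquiv.commutes, hx, hy] at h
  have h1 := modelCurve_equation_xy e
  have htwo : (2 : (modelCurve e).toAffine.CoordinateRing) = 0 := by
    rw [← map_ofNat (algebraMap K (modelCurve e).toAffine.CoordinateRing), CharTwo.two_eq_zero,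
      map_zero]
  obtain ⟨c3, -, c1, -, d1, d0⟩ := coeff_eq_zero_of_xFun_yFun (W := (modelCurve e).toAffine)
    (a₃ := α ^ 2 - a ^ 3) (a₂ := β ^ 2 + e * a * β - a ^ 2 * b)
    (a₁ := e * a * γ + e * b * β - a * b ^ 2)
    (a₀ := α ^ 2 * e ^ 2 + γ ^ 2 + e * b * γ - b ^ 3 - e ^ 2)
    (b₁ := e * a * α - α ^ 2 * e) (b₀ := e * b * α) (by
      simp only [map_add, map_sub, map_mul, map_pow]
      generalize xFun (modelCurve e).toAffine = x at *
      generalize yFun (modelCurve e).toAffine = y at *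
      generalize algebraMap K (modelCurve e).toAffine.CoordinateRing = f at *
      -- Subtracting α² times the curve equation eliminates y²; the terms multiplied by `htwo` are
      -- even discrepancies, such as the cross terms of a square.
      linear_combination h - f α ^ 2 * h1 - (f α * f β * x * y + f β * f γ * x + f α * f γ * y -
        f a ^ 2 * f b * x ^ 2 - f a * f b ^ 2 * x) * htwo)
  have h6 : α = a ∧ a = 1 ∧ b = 0 ∧ γ = 0 := by
    clear h hx hy ha' h1 htwo
    have hα : α ≠ 0 := by grind
    have h6 : α = a := by
      have h : e * α * (a - α) = 0 := by linear_combination d1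
      simpa [he, hα, sub_eq_zero, eq_comm] using h
    have h7 : b = 0 := by simpa [he, hα] using d0
    subst h6 h7
    refine ⟨rfl, ?_, rfl, ?_⟩
    · have h : α ^ 2 * (1 - α) = 0 := by linear_combination c3
      simpa [hα, sub_eq_zero, eq_comm (a := α)] using h
    · simpa [he, hα] using c1
  obtain ⟨h6, h7, h8, h9⟩ := h6
  refine ⟨β, ?_, ?_⟩
  · rw [hx, h7, h8, map_one, map_zero, one_mul, add_zero]
  · rw [hy, h6, h7, h9, map_one, map_zero, one_mul, add_zero]

lemma eq_refl_of_modelCurve [IsAlgClosed K] [CharP K 2] {e : K} (he : e ≠ 0)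
    {τ : curve K (modelCurve e) ≃ curve K (modelCurve e)} (hτ : IsMorphism K τ)
    (hτ' : IsMorphism K τ.symm)
    (h0 : τ ⟨_, infinity_mem_curve⟩ = ⟨_, infinity_mem_curve⟩)
    (hT : τ ⟨_, affine_mem_curve (equation_modelCurve_self e)⟩ =
      ⟨_, affine_mem_curve (equation_modelCurve_self e)⟩) : τ = Equiv.refl _ := by
  obtain ⟨θ, hθ⟩ := exists_algEquiv hτ hτ' h0
  obtain ⟨b, hx, hy⟩ := algEquiv_modelCurve he θ
  have hb : b = 0 := by
    obtain ⟨h1, h2⟩ := hθ e e (equation_modelCurve_self e)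
    rw [hT, Subtype.mk.injEq, mk_eq_mk_iff_prop2, hx, hy] at h2
    have h3 := h2 1 2
    simp [he] at h3
    exact h3
  ext1 P
  rcases infinity_or_affine P with rfl | ⟨x, y, h, rfl⟩
  · exact h0
  · have h' : (modelCurve e).toAffine.Equation x y := by
      simpa [WeierstrassCurve.baseChange] using h
    obtain ⟨h1, h2⟩ := hθ x y h'
    refine h2.trans (Subtype.ext ?_)
    simp [hx, hy, hb]

end ModelAutomorphism

/-! ### Isomorphisms are determined by their markings -/

section Uniqueness

variable {k K : Type*} [Field k] [Field K] [Algebra k K] [IsAlgClosed K] [CharP K 2]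

/-- Isomorphisms from the model curve are determined by the images of the point at infinity and of
the point `(e, e)` of order four. -/
lemma Iso.eq_of_modelCurve {e : k} (he : e ≠ 0) {n : ℕ} {Z : Set (PSpace K n)}
    (φ ψ : Iso k (curve K (modelCurve e)) Z) {P Q : curve K (modelCurve e)}
    (hP : (P : PSpace K 2) = Projectivization.mk K ![0, 1, 0] infinity_ne_zero)
    (hQ : (Q : PSpace K 2) =
      Projectivization.mk K ![algebraMap k K e, algebraMap k K e, 1] (affine_ne_zero _ _))
    (h0 : φ.toEquiv P = ψ.toEquiv P) (hT : φ.toEquiv Q = ψ.toEquiv Q) : φ = ψ := by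
  obtain ⟨P, hPX⟩ := P
  obtain ⟨Q, hQX⟩ := Q
  subst hP hQ
  have hτ := ((φ.trans ψ.symm).isMorphism_toFun).map
  have hτ' := ((φ.trans ψ.symm).isMorphism_invFun).map
  have h0' : (φ.trans ψ.symm).toEquiv ⟨_, hPX⟩ = ⟨_, hPX⟩ :=
    (Equiv.symm_apply_eq ψ.toEquiv).2 h0
  have hT' : (φ.trans ψ.symm).toEquiv ⟨_, hQX⟩ = ⟨_, hQX⟩ :=
    (Equiv.symm_apply_eq ψ.toEquiv).2 hT
  have key : (φ.trans ψ.symm).toEquiv = Equiv.refl _ := by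
    generalize (φ.trans ψ.symm).toEquiv = τ at hτ hτ' h0' hT' ⊢
    have hX : curve K (modelCurve e) = curve K (modelCurve (algebraMap k K e)) := by
      rw [curve_baseChange, baseChange_modelCurve]
    clear h0 hT
    clear φ ψ
    generalize curve K (modelCurve e) = X at *
    subst hX
    exact eq_refl_of_modelCurve ((map_ne_zero _).2 he) hτ hτ' h0' hT'
  refine Iso.ext (Equiv.ext fun R => ?_)
  have h1 := DFunLike.congr_fun key R
  exact (Equiv.symm_apply_eq ψ.toEquiv).1 h1

end Uniqueness

/-! ### Images of the marked points under the explicit maps -/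

section Markings

variable {k K : Type*} [Field k] [Field K] [Algebra k K]

lemma Represents.z4Chart_infinity {e : k} {φ : curve K (modelCurve e) → z4Curve K e}
    (h : Represents φ 3 (z4Chart e 1)) {P : curve K (modelCurve e)}
    (hP : (P : PSpace K 2) = Projectivization.mk K ![0, 1, 0] infinity_ne_zero) :
    (φ P : PSpace K 3) =
      Projectivization.mk K ![1, 0, 0, 1] (fun h => one_ne_zero (congrFun h 0)) := by
  obtain ⟨P, hPX⟩ := P
  subst hP
  rw [h.eq_mk _ infinity_ne_zero hPX, mk_eq_mk_iff_prop2]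
  · rw [evalTuple_z4Chart_one]
    apply prop2_fin_four <;> simp
  · intro h1
    have := congrFun h1 0
    simp [evalTuple_z4Chart_one] at this

lemma Represents.z4Chart_self [CharP K 2] {e : k} (he : e ≠ 0) {φ : curve K (modelCurve e) → z4Curve K e}
    (h : Represents φ 2 (z4Chart e 0)) {P : curve K (modelCurve e)}
    (hP : (P : PSpace K 2) =
      Projectivization.mk K ![algebraMap k K e, algebraMap k K e, 1] (affine_ne_zero _ _)) :
    (φ P : PSpace K 3) =
      Projectivization.mk K ![1, 1, 0, 0] (fun h => one_ne_zero (congrFun h 0)) := by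
  obtain ⟨P, hPX⟩ := P
  subst hP
  rw [h.eq_mk _ (affine_ne_zero _ _) hPX, mk_eq_mk_iff_prop2]
  · rw [evalTuple_z4Chart_zero]
    apply prop2_fin_four <;> simp [CharTwo.add_self_eq_zero]
  · intro h1
    have h2 := congrFun h1 0
    have he' : algebraMap k K e ≠ 0 := (map_ne_zero _).2 he
    simp [evalTuple_z4Chart_zero, he'] at h2
    generalize algebraMap k K e = e at *
    grind

lemma Represents.mu4Chart_infinity {c : k} {φ : curve K (modelCurve (c ^ 2)) → mu4Curve K c}
    (h : Represents φ 2 (mu4Chart c 1)) {P : curve K (modelCurve (c ^ 2))}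
    (hP : (P : PSpace K 2) = Projectivization.mk K ![0, 1, 0] infinity_ne_zero) :
    (φ P : PSpace K 3) =
      Projectivization.mk K ![algebraMap k K c, 1, 0, 1] (fun h => one_ne_zero (congrFun h 1)) := by
  obtain ⟨P, hPX⟩ := P
  subst hP
  rw [h.eq_mk _ infinity_ne_zero hPX, mk_eq_mk_iff_prop2]
  · rw [evalTuple_mu4Chart_one]
    apply prop2_fin_four <;> simp
  · intro h1
    have := congrFun h1 1
    simp [evalTuple_mu4Chart_one] at this

lemma Represents.mu4Chart_self [CharP K 2] {c : k} (hc : c ≠ 0)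
    {φ : curve K (modelCurve (c ^ 2)) → mu4Curve K c}
    (h : Represents φ 2 (mu4Chart c 0)) {P : curve K (modelCurve (c ^ 2))}
    (hP : (P : PSpace K 2) = Projectivization.mk K
      ![algebraMap k K (c ^ 2), algebraMap k K (c ^ 2), 1] (affine_ne_zero _ _)) :
    (φ P : PSpace K 3) =
      Projectivization.mk K ![1, algebraMap k K c, 1, 0] (fun h => one_ne_zero (congrFun h 0)) := by
  have hc' : algebraMap k K c ≠ 0 := (map_ne_zero _).2 hc
  obtain ⟨P, hPX⟩ := P
  subst hP
  rw [h.eq_mk _ (affine_ne_zero _ _) hPX, mk_eq_mk_iff_prop2]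
  · rw [evalTuple_mu4Chart_zero]
    simp only [map_pow]
    generalize algebraMap k K c = c at *
    apply prop2_fin_four <;> simp <;> grind
  · intro h1
    have h2 := congrFun h1 0
    simp [evalTuple_mu4Chart_zero, hc'] at h2

end Markings

/-! ### The spaces L(4O) and L(5O − S) and the normal form coordinates -/

section Combinations

variable {K : Type*} [Field K]

lemma exists_eq_of_poleOrder_le_five {W : WeierstrassCurve.Affine K} {f : W.CoordinateRing}
    (h : poleOrder f ≤ 5) : ∃ a b b' c d : K,
      f = algebraMap K _ a + algebraMap K _ b * xFun _ + algebraMap K _ b' * yFun _ +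
        algebraMap K _ c * xFun _ ^ 2 + algebraMap K _ d * xFun _ * yFun _ ∧
      (poleOrder f ≤ 4 → d = 0) := by
  obtain ⟨p, q, rfl⟩ := exists_eq_aeval f
  have h1 := poleOrder_le_iff.1 h
  have hp : p = Polynomial.C (p.coeff 2) * Polynomial.X ^ 2 +
      Polynomial.C (p.coeff 1) * Polynomial.X + Polynomial.C (p.coeff 0) := by
    ext i
    rcases i with _ | _ | _ | i
    · simp
    · simp
    · simp
    · rw [h1.1 _ (by omega)]
      simp
  have hq : q = Polynomial.C (q.coeff 1) * Polynomial.X + Polynomial.C (q.coeff 0) := by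
    ext i
    rcases i with _ | _ | i
    · simp
    · simp
    · rw [h1.2 _ (by omega)]
      simp
  refine ⟨p.coeff 0, p.coeff 1, q.coeff 0, p.coeff 2, q.coeff 1, ?_,
    fun h2 => (poleOrder_le_iff.1 h2).2 1 (by omega)⟩
  conv_lhs => rw [hp, hq]
  simp
  ring

/-- Functions of pole order at most 4 are combinations of 1, x, y, x². The coefficients come from
solving the chart for these four functions. -/
lemma exists_eq_sum_mu4Chart {c : K} (hc : c ≠ 0) {u : (modelCurve (c ^ 2)).toAffine.CoordinateRing}
    (hu : poleOrder u ≤ 4) : ∃ m : Fin 4 → K, u = ∑ j, m j • dehom _ (mu4Chart c 0 j) := by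
  obtain ⟨a, b, b', d, f, hu', hf⟩ := exists_eq_of_poleOrder_le_five (hu.trans (Nat.le_succ 4))
  refine ⟨![c⁻¹ * d - c⁻¹ ^ 3 * b', c⁻¹ ^ 4 * b, c⁻¹ ^ 5 * a, c⁻¹ ^ 2 * b' - c⁻¹ ^ 4 * b], ?_⟩
  have h1 : algebraMap K (modelCurve (c ^ 2)).toAffine.CoordinateRing c * algebraMap K _ c⁻¹ = 1 := by
    rw [← map_mul, mul_inv_cancel₀ hc, map_one]
  rw [hu', hf hu, Fin.sum_univ_four]
  simp only [Algebra.smul_def, mu4Chart, dehom, Matrix.cons_val, map_add, map_mul, map_sub, map_pow,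
    aeval_X, algHom_C, map_zero]
  generalize xFun (modelCurve (c ^ 2)).toAffine = x at *
  generalize yFun (modelCurve (c ^ 2)).toAffine = y at *
  generalize algebraMap K (modelCurve (c ^ 2)).toAffine.CoordinateRing = g at *
  clear hu' hu hf
  generalize g c⁻¹ = C' at *
  grind

/-- Functions of pole order at most 5 are combinations of 1, x, y, x², xy, and vanishing at S = (0,
−e) ties the constant term to the coefficient of y. This leaves a four-dimensional space, which the
chart spans; in characteristic 2 it is x times L(3O + S). -/
lemma exists_eq_sum_z4Chart {e : K} (he : e ≠ 0) {u : (modelCurve e).toAffine.CoordinateRing}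
    (hu : poleOrder u ≤ 5) {x y : K} (h : (modelCurve e).toAffine.Equation x y) (hx : x = 0)
    (hy : y = -e) (hxy : evalAt h u = 0) : ∃ m : Fin 4 → K, u = ∑ j, m j • dehom _ (z4Chart e 0 j) := by
  obtain ⟨a, b, b', d, f, hu', -⟩ := exists_eq_of_poleOrder_le_five hu
  refine ⟨![e⁻¹ * d, e⁻¹ ^ 2 * (b - f * e), e⁻¹ * b' - e⁻¹ ^ 2 * (b - f * e), f - e⁻¹ * d], ?_⟩
  have h1 : algebraMap K (modelCurve e).toAffine.CoordinateRing e * algebraMap K _ e⁻¹ = 1 := by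
    rw [← map_mul, mul_inv_cancel₀ he, map_one]
  have h2 : a = b' * e := by
    rw [hu'] at hxy
    simp [hx, hy] at hxy
    linear_combination hxy
  rw [hu', Fin.sum_univ_four]
  simp only [Algebra.smul_def, z4Chart, dehom, Matrix.cons_val, map_add, map_mul, map_sub, map_pow,
    aeval_X, algHom_C, h2]
  generalize xFun (modelCurve e).toAffine = x at *
  generalize yFun (modelCurve e).toAffine = y at *
  generalize algebraMap K (modelCurve e).toAffine.CoordinateRing = g at *
  clear hu' hu hxy h2
  generalize g e⁻¹ = C' at *
  grind

end Combinations

/-! ### From relations between functions to relations between points -/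

section Proportional

variable {K : Type*} [Field K] [IsAlgClosed K] {W : WeierstrassCurve K} {n : ℕ}

/-- A linear relation between coordinate functions of two morphisms holds at all points. -/
lemma eq_linAut_of_dehom {X : Set (PSpace K 2)} (hW : X = curve K W) {Y Z : Set (PSpace K n)}
    {ι : X → Y} {φ : X → Z}
    (hι : IsMorphism K ι) (hφ : IsMorphism K φ) {d d' : ℕ}
    {p q : Fin (n + 1) → MvPolynomial (Fin 3) K} (hp : Represents ι d p) (hq : Represents φ d' q)
    (hp0 : ∃ i, dehom W.toAffine (p i) ≠ 0) (hq0 : ∃ i, dehom W.toAffine (q i) ≠ 0)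
    (N : Matrix.GeneralLinearGroup (Fin (n + 1)) K)
    (h : ∀ i j, dehom W.toAffine (p i) * ∑ l, N j l • dehom W.toAffine (q l) =
      dehom W.toAffine (p j) * ∑ l, N i l • dehom W.toAffine (q l)) (P : X) :
    (ι P : PSpace K n) = linAut N (φ P) := by
  subst hW
  obtain ⟨v, hv, hX, rfl⟩ := exists_eq_mk P
  obtain ⟨d₁, p', hp', hp1⟩ := isMorphism_iff.1 hι v hv hX
  obtain ⟨d₂, q', hq', hq1⟩ := isMorphism_iff.1 hφ v hv hX
  rw [hp'.eq_mk v hv hX hp1, hq'.eq_mk v hv hX hq1, linAut_mk, mk_eq_mk_iff_prop2]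
  intro i j
  obtain ⟨a, ha⟩ := hp0
  obtain ⟨b, hb⟩ := hq0
  have hF : ∀ i j, (p' i * ∑ l, N j l • q' l).IsHomogeneous (d₁ + d₂) := fun i j => by
    refine (hp'.isHomogeneous i).mul (IsHomogeneous.sum _ _ _ fun l _ => ?_)
    rw [smul_eq_C_mul]
    simpa using (isHomogeneous_C (Fin 3) (N j l)).mul (hq'.isHomogeneous l)
  have hN : ∀ j, dehom W.toAffine (q b) * ∑ l, N j l • dehom W.toAffine (q' l) =
      dehom W.toAffine (q' b) * ∑ l, N j l • dehom W.toAffine (q l) := fun j => by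
    simp only [Finset.mul_sum, mul_smul_comm]
    refine Finset.sum_congr rfl fun l _ => ?_
    rw [hq.dehom_mul_dehom hq' b l, mul_comm]
  have h0 : dehom W.toAffine (p' i * ∑ l, N j l • q' l - p' j * ∑ l, N i l • q' l) = 0 := by
    simp only [map_sub, map_mul, map_sum, map_smul]
    refine (mul_eq_zero.1 ?_).resolve_left (mul_ne_zero ha hb)
    linear_combination dehom W.toAffine (p a) * dehom W.toAffine (p' i) * hN j -
      dehom W.toAffine (p a) * dehom W.toAffine (p' j) * hN i +
      dehom W.toAffine (q' b) * (∑ l, N j l • dehom W.toAffine (q l)) *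
        hp.dehom_mul_dehom hp' a i -
      dehom W.toAffine (q' b) * (∑ l, N i l • dehom W.toAffine (q l)) *
        hp.dehom_mul_dehom hp' a j + dehom W.toAffine (p' a) * dehom W.toAffine (q' b) * h i j
  have h1 := aeval_eq_zero_of_dehom_eq_zero ((hF i j).sub (hF j i)) h0 hv hX
  simp only [map_sub, map_mul, map_sum, map_smul, smul_eq_mul] at h1
  exact sub_eq_zero.1 h1

end Proportional

/-! ### Descent of the linear transformation from K to k -/

section Descent

open scoped Matrix

variable {k K : Type*} [Field k] [Field K] [Algebra k K]

/-- A form over k has coordinates over k in the basis xⁱ, xⁱ y; this is what lets a k-linear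
functional act on the coefficients of a relation. -/
lemma exists_dehom_map_eq {e : k} (F : MvPolynomial (Fin 3) k) : ∃ p q : Polynomial k,
    dehom (modelCurve (algebraMap k K e)).toAffine (map (algebraMap k K) F) =
      Polynomial.aeval (xFun _) (p.map (algebraMap k K)) +
        Polynomial.aeval (xFun _) (q.map (algebraMap k K)) * yFun _ := by
  induction F using MvPolynomial.induction_on with
  | C a => exact ⟨Polynomial.C a, 0, by simp [dehom]⟩
  | add F G hF hG =>
    obtain ⟨p, q, hF⟩ := hF
    obtain ⟨p', q', hG⟩ := hG
    refine ⟨p + p', q + q', ?_⟩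
    rw [map_add, map_add, hF, hG]
    simp only [Polynomial.map_add, map_add]
    ring
  | mul_X F i hF =>
    obtain ⟨p, q, hF⟩ := hF
    rw [map_mul, map_mul, hF, map_X]
    have h := modelCurve_equation_xy (algebraMap k K e)
    fin_cases i
    · refine ⟨Polynomial.X * p, Polynomial.X * q, ?_⟩
      simp [dehom]
      ring
    · refine ⟨q * (Polynomial.X ^ 3 + Polynomial.C e ^ 2), p - Polynomial.C e * Polynomial.X * q, ?_⟩
      simp [dehom, -Polynomial.aeval_map_algebraMap]
      linear_combination Polynomial.aeval (xFun _) (q.map (algebraMap k K)) * h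
    · exact ⟨p, q, by simp [dehom]⟩

/-- A linear relation with coefficients in `K` between functions defined over `k` gives relations
with coefficients in `k`. -/
lemma sum_smul_dehom_map_eq_zero {e : k} {J : Type*} {s : Finset J}
    {F : J → MvPolynomial (Fin 3) k} {m : J → K}
    (h : ∑ a ∈ s, m a • dehom (modelCurve (algebraMap k K e)).toAffine (map (algebraMap k K) (F a)) = 0)
    (l : K →ₗ[k] k) :
    ∑ a ∈ s, algebraMap k K (l (m a)) •
      dehom (modelCurve (algebraMap k K e)).toAffine (map (algebraMap k K) (F a)) = 0 := by
  choose p q hpq using fun a => exists_dehom_map_eq (K := K) (e := e) (F a)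
  simp only [hpq] at h ⊢
  have hsum : ∀ m : J → K, ∑ a ∈ s, m a • (
      Polynomial.aeval (xFun (modelCurve (algebraMap k K e)).toAffine) ((p a).map (algebraMap k K)) +
        Polynomial.aeval (xFun _) ((q a).map (algebraMap k K)) * yFun _) =
      Polynomial.aeval (xFun _) (∑ a ∈ s, m a • (p a).map (algebraMap k K)) +
      Polynomial.aeval (xFun _) (∑ a ∈ s, m a • (q a).map (algebraMap k K)) * yFun _ := by
    intro m
    simp only [map_sum, map_smul, Finset.sum_mul, ← Finset.sum_add_distrib, smul_add, smul_mul_assoc]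
  rw [hsum] at h ⊢
  have hc := coord_aeval (W := (modelCurve (algebraMap k K e)).toAffine)
    (∑ a ∈ s, m a • (p a).map (algebraMap k K)) (∑ a ∈ s, m a • (q a).map (algebraMap k K))
  rw [h, map_zero, map_zero] at hc
  have key : ∀ r : J → Polynomial k, 0 = ∑ a ∈ s, m a • (r a).map (algebraMap k K) →
      ∑ a ∈ s, algebraMap k K (l (m a)) • (r a).map (algebraMap k K) = 0 := by
    intro r hr
    ext n
    have h1 := congrArg (fun z => l (Polynomial.coeff z n)) hr
    simp only [Polynomial.finsetSum_coeff, Polynomial.coeff_smul, Polynomial.coeff_map, smul_eq_mul,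
      Polynomial.coeff_zero, map_zero, map_sum, mul_comm (m _), ← Algebra.smul_def, map_smul] at h1
    simp only [Polynomial.finsetSum_coeff, Polynomial.coeff_smul, Polynomial.coeff_map, smul_eq_mul,
      Polynomial.coeff_zero, ← map_mul, ← map_sum]
    rw [← map_zero (algebraMap k K), h1]
    simp only [mul_comm]
  rw [key p hc.1, key q hc.2, map_zero, zero_mul, add_zero]

/-- The entries of M need not lie in k, since the common factor is arbitrary. The relations f_i (M
g)_j = f_j (M g)_i, however, are linear in M and involve functions over k, so they persist when a
k-linear functional l : K → k is applied to all entries. If l is nonzero at some entry of M, the new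
matrix is again invertible. -/
lemma isInducedByLinear_of_relation [IsAlgClosed K] {e : k} {Y Z : Set (PSpace K 3)}
    {ι : Iso k (curve K (modelCurve e)) Y} {φ : Iso k (curve K (modelCurve e)) Z} {d d' : ℕ}
    {p q : Fin 4 → MvPolynomial (Fin 3) k} (hp : Represents ι.toEquiv d p)
    (hq : Represents φ.toEquiv d' q)
    (hli : LinearIndependent K fun i =>
      dehom (modelCurve (algebraMap k K e)).toAffine (map (algebraMap k K) (p i)))
    {s v : (modelCurve (algebraMap k K e)).toAffine.CoordinateRing} (hs : s ≠ 0) (hv : v ≠ 0)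
    {M : Matrix (Fin 4) (Fin 4) K} (h : ∀ i, s * dehom _ (map (algebraMap k K) (p i)) =
      v * ∑ j, M i j • dehom _ (map (algebraMap k K) (q j))) : IsInducedByLinear ι φ := by
  set f := fun i => dehom (modelCurve (algebraMap k K e)).toAffine (map (algebraMap k K) (p i))
    with hf
  set g := fun i => dehom (modelCurve (algebraMap k K e)).toAffine (map (algebraMap k K) (q i))
    with hg
  rw [Fintype.linearIndependent_iff] at hli
  have hsum : ∀ a : Fin 4 → K, s * ∑ i, a i • f i = v * ∑ j, (a ᵥ* M) j • g j := by
    intro a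
    simp only [Matrix.vecMul, dotProduct, Finset.sum_smul, Finset.mul_sum, mul_smul_comm]
    rw [Finset.sum_comm]
    refine Finset.sum_congr rfl fun i _ => ?_
    simp only [hf, hg, h i, Finset.mul_sum, Finset.smul_sum, mul_smul_comm, smul_smul]
  have hdet : M.det ≠ 0 := fun h0 => by
    obtain ⟨a, ha, haM⟩ := Matrix.exists_vecMul_eq_zero_iff.2 h0
    have h1 := hsum a
    simp only [haM, Pi.zero_apply, zero_smul, Finset.sum_const_zero, mul_zero] at h1
    exact ha (funext (hli a ((mul_eq_zero.1 h1).resolve_left hs)))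
  have hgli : ∀ b : Fin 4 → K, ∑ j, b j • g j = 0 → b = 0 := by
    intro b hb
    have h1 : (b ᵥ* M⁻¹) ᵥ* M = b := by
      rw [Matrix.vecMul_vecMul, Matrix.nonsing_inv_mul _ (isUnit_iff_ne_zero.2 hdet),
        Matrix.vecMul_one]
    have h2 := hsum (b ᵥ* M⁻¹)
    rw [h1, hb, mul_zero] at h2
    rw [← h1, funext (hli _ ((mul_eq_zero.1 h2).resolve_left hs))]
    exact Matrix.zero_vecMul M
  have hrel : ∀ i j, f i * ∑ l, M j l • g l = f j * ∑ l, M i l • g l := by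
    intro i j
    refine mul_left_cancel₀ hv ?_
    linear_combination f j * h i - f i * h j
  obtain ⟨i₀, j₀, h₀⟩ : ∃ i j, M i j ≠ 0 := by
    by_contra! h0
    exact hdet (by rw [show M = 0 from Matrix.ext h0, Matrix.det_zero])
  obtain ⟨l, hl⟩ : ∃ l : Module.Dual k K, l (M i₀ j₀) ≠ 0 := by
    by_contra! h0
    exact h₀ ((Module.forall_dual_apply_eq_zero_iff k _).1 h0)
  have hrel' : ∀ i j, f i * ∑ a, algebraMap k K (l (M j a)) • g a =
      f j * ∑ a, algebraMap k K (l (M i a)) • g a := by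
    intro i j
    have h1 := sum_smul_dehom_map_eq_zero (e := e) (s := Finset.univ)
      (F := Sum.elim (fun a => p i * q a) (fun a => p j * q a)) (m := Sum.elim (M j) (-M i)) (by
        have := hrel i j
        simp only [Finset.mul_sum, mul_smul_comm] at this
        simp only [Fintype.sum_sum_type, Sum.elim_inl, Sum.elim_inr, Pi.neg_apply, neg_smul,
          Finset.sum_neg_distrib, map_mul]
        rw [← sub_eq_add_neg, sub_eq_zero]
        exact this) l
    simp only [Fintype.sum_sum_type, Sum.elim_inl, Sum.elim_inr, Pi.neg_apply, neg_smul, map_neg,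
      Finset.sum_neg_distrib, map_mul] at h1
    rw [← sub_eq_add_neg, sub_eq_zero] at h1
    simpa only [Finset.mul_sum, mul_smul_comm] using h1
  let M' : Matrix (Fin 4) (Fin 4) k := Matrix.of fun i j => l (M i j)
  -- A vector a with a M' = 0 would give (∑ aⱼ fⱼ) (M' g)_{i₀} = 0. The second factor is nonzero,
  -- since the g's are independent and the entry at (i₀, j₀) is not zero; independence of the f's
  -- then gives a = 0.
  have hdet' : M'.det ≠ 0 := fun h0 => by
    obtain ⟨a, ha, haM⟩ := Matrix.exists_vecMul_eq_zero_iff.2 h0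
    have h1 : ∑ a, algebraMap k K (l (M i₀ a)) • g a ≠ 0 := fun h1 => by
      have := congrFun (hgli _ h1) j₀
      exact hl ((map_eq_zero _).1 this)
    have h2 : (∑ j, algebraMap k K (a j) • f j) * ∑ a, algebraMap k K (l (M i₀ a)) • g a = 0 := by
      have h3 : ∀ b, ∑ j, algebraMap k K (a j) * algebraMap k K (l (M j b)) = 0 := fun b => by
        have := congrArg (algebraMap k K) (congrFun haM b)
        simpa [Matrix.vecMul, dotProduct, M'] using this
      calc _ = ∑ j, algebraMap k K (a j) • (f j * ∑ a, algebraMap k K (l (M i₀ a)) • g a) := by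
            rw [Finset.sum_mul]
            simp only [smul_mul_assoc]
        _ = ∑ j, algebraMap k K (a j) • (f i₀ * ∑ a, algebraMap k K (l (M j a)) • g a) := by
            simp only [hrel' i₀]
        _ = f i₀ * ∑ b, (∑ j, algebraMap k K (a j) * algebraMap k K (l (M j b))) • g b := by
            simp only [Finset.mul_sum, Finset.smul_sum, Finset.sum_smul, mul_smul_comm, smul_smul]
            rw [Finset.sum_comm]
        _ = 0 := by simp only [h3, zero_smul, Finset.sum_const_zero, mul_zero]
    have h4 := hli _ ((mul_eq_zero.1 h2).resolve_right h1)
    exact ha (funext fun i => (map_eq_zero _).1 (h4 i))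
  have hfg : (∃ i, f i ≠ 0) ∧ ∃ i, g i ≠ 0 := by
    constructor <;> by_contra! h0
    · exact one_ne_zero (hli (fun _ => 1) (by simp [h0]) 0)
    · exact one_ne_zero (congrFun (hgli (fun _ => 1) (by simp [h0])) 0)
  -- The relations express `ι` as `N` applied to `φ`, so the transformation sought is the inverse.
  let N : Matrix.GeneralLinearGroup (Fin 4) k := Matrix.GeneralLinearGroup.mkOfDetNeZero M' hdet'
  refine ⟨N⁻¹, fun P => ?_⟩
  have hX : curve K (modelCurve e) = curve K (modelCurve (algebraMap k K e)) := by
    rw [curve_baseChange, baseChange_modelCurve]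
  have key := eq_linAut_of_dehom hX ι.isMorphism_toFun.map φ.isMorphism_toFun.map hp.map hq.map
    hfg.1 hfg.2 (Matrix.GeneralLinearGroup.map (algebraMap k K) N) hrel' P
  rw [key, linAut, linAut, map_inv, map_inv, inv_smul_smul]

end Descent

/-! ### Symmetric quartic models of the model curve -/

section QuarticModel

/-- The coordinate functions of a symmetric quartic model of the model curve are, up to a common
factor, linear combinations of those of one of the two normal forms. -/
lemma exists_relation {K : Type*} [Field K] [IsAlgClosed K] [CharP K 2] {c : K} (hc : c ≠ 0)
    {X : Set (PSpace K 2)} (hX : X = curve K (modelCurve (c ^ 2))) {Y : Set (PSpace K 3)}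
    {ι : X ≃ Y} (hι : IsMorphism K ι) (hι' : IsMorphism K ι.symm) (hY : IsQuarticModel Y)
    {B : Matrix.GeneralLinearGroup (Fin 4) K}
    (hB : ∀ x y (h : Projectivization.mk K ![x, y, 1] (affine_ne_zero x y) ∈ X)
      (h' : Projectivization.mk K ![x, y + c ^ 2 * x, 1] (affine_ne_zero _ _) ∈ X),
      (ι ⟨_, h'⟩ : PSpace K 3) = linAut B (ι ⟨_, h⟩))
    {d : ℕ} {p : Fin 4 → MvPolynomial (Fin 3) K} (hp : Represents ι d p)
    {w : Fin 3 → K} (hw : w ≠ 0) (hwX : Projectivization.mk K w hw ∈ X)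
    (hp0 : evalTuple p w ≠ 0) :
    LinearIndependent K (fun i => dehom (modelCurve (c ^ 2)).toAffine (p i)) ∧
    ∃ s v : (modelCurve (c ^ 2)).toAffine.CoordinateRing, s ≠ 0 ∧ v ≠ 0 ∧
      ∃ M : Matrix (Fin 4) (Fin 4) K,
        (∀ i, s * dehom _ (p i) = v * ∑ j, M i j • dehom _ (mu4Chart c 0 j)) ∨
        (∀ i, s * dehom _ (p i) = v * ∑ j, M i j • dehom _ (z4Chart (c ^ 2) 0 j)) := by
  subst hX
  have he : c ^ 2 ≠ 0 := pow_ne_zero 2 hc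
  have : (modelCurve (c ^ 2)).IsElliptic := isElliptic_modelCurve he
  obtain ⟨i₀, hi₀⟩ := exists_apply_ne_zero hp0
  have h0 : ∃ i, dehom (modelCurve (c ^ 2)).toAffine (p i) ≠ 0 :=
    ⟨i₀, hp.exists_dehom_ne_zero hw hwX hi₀⟩
  refine ⟨hp.linearIndependent hι ι.surjective hY.nondegenerate h0, ?_⟩
  obtain ⟨v, hv, ⟨hI, hdeg⟩ | ⟨x, y, h, hI, hdeg⟩⟩ := exists_generator_of_isQuarticModel
    (κ := ι.symm) ι.apply_symm_apply ι.symm_apply_apply hι hι' hY hp h0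
  · have h1 : ∀ i, ∃ u, dehom _ (p i) = v * u ∧ poleOrder u ≤ 4 := by
      intro i
      have h2 : dehom _ (p i) ∈ Ideal.span {v} := hI ▸ Ideal.subset_span ⟨i, rfl⟩
      obtain ⟨u, hu⟩ := Ideal.mem_span_singleton.1 h2
      refine ⟨u, hu, ?_⟩
      by_cases hu0 : u = 0
      · simp [hu0, poleOrder]
      have h3 := hdeg i
      rw [hu, poleOrder_mul hv hu0] at h3
      omega
    choose u hu hu4 using h1
    choose M hM using fun i => exists_eq_sum_mu4Chart hc (hu4 i)
    refine ⟨1, v, one_ne_zero, hv, M, Or.inl fun i => ?_⟩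
    rw [one_mul, hu i, hM i]
  -- Negation is (x, y) ↦ (x, y + c² x), so an affine point equal to its negative has x = 0, and
  -- then y = c².
  · have hneg : y = (modelCurve (c ^ 2)).toAffine.negY x y := by
      refine eq_negY_of_symmetric (B := B) (fun x y h h' => ?_) hp hv h hI
      have h1 : (modelCurve (c ^ 2)).toAffine.negY x y = y + c ^ 2 * x := by
        simp [WeierstrassCurve.Affine.negY, modelCurve, CharTwo.neg_eq, CharTwo.sub_eq_add]
      have h2 := hB x y (affine_mem_curve h) (h1 ▸ affine_mem_curve h')
      simp only [h1]
      exact h2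
    have hx : x = 0 := by
      have h1 : c ^ 2 * x = 0 := by
        simp only [WeierstrassCurve.Affine.negY, modelCurve] at hneg
        grind
      simpa [hc] using h1
    have hy : y = c ^ 2 := by
      rw [equation_modelCurve_iff, hx] at h
      have : (y - c ^ 2) ^ 2 = 0 := by grind
      exact sub_eq_zero.1 (pow_eq_zero_iff two_ne_zero |>.1 this)
    have hmem : ∀ i, ∀ z ∈ XYIdeal (modelCurve (c ^ 2)).toAffine x (Polynomial.C y),
        ∃ u, dehom _ (p i) * z = v * u := by
      intro i z hz
      have h2 : dehom _ (p i) * z ∈ Ideal.span {v} :=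
        hI ▸ Ideal.mul_mem_mul (Ideal.subset_span ⟨i, rfl⟩) hz
      exact Ideal.mem_span_singleton.1 h2
    have h1 : ∀ i, ∃ u, xFun _ * dehom _ (p i) = v * u ∧ poleOrder u ≤ 5 ∧ evalAt h u = 0 := by
      intro i
      obtain ⟨u, hu⟩ := hmem i (xFun _) ((evalAt_eq_zero_iff h _).1 (by rw [evalAt_xFun, hx]))
      obtain ⟨u', hu'⟩ := hmem i (yFun _ - algebraMap K _ y) (by simp [← evalAt_eq_zero_iff h])
      refine ⟨u, by rw [mul_comm, hu], ?_, ?_⟩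
      · by_cases hu0 : u = 0
        · simp [hu0, poleOrder]
        have hf0 : dehom (modelCurve (c ^ 2)).toAffine (p i) ≠ 0 := by
          intro h2
          rw [h2, zero_mul] at hu
          exact mul_ne_zero hv hu0 hu.symm
        have h3 := hdeg i
        have h4 := congrArg poleOrder hu
        rw [poleOrder_mul hv hu0, poleOrder_mul hf0 xFun_ne_zero, poleOrder_xFun] at h4
        omega
      -- With e = c² and f = `dehom _ (p i)`, the functions x f/v = u and (y − e) f/v = u' are
      -- regular. Multiplying x u' = (y − e) u by y + e x + e and cancelling x by means of the curve
      -- equation gives (y + e x + e) u' = (x² − e²) u. At (0, e) the left side is zero and x² − e²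
      -- is not, so u vanishes there.
      · have h3 : xFun _ * u' = (yFun _ - algebraMap K _ y) * u := by
          refine mul_left_cancel₀ hv ?_
          linear_combination (yFun _ - algebraMap K _ y) * hu - xFun _ * hu'
        have h4 := modelCurve_equation_xy (c ^ 2)
        have h5 : (yFun _ + algebraMap K _ (c ^ 2) * xFun _ + algebraMap K _ (c ^ 2)) * u' =
            (xFun _ ^ 2 - algebraMap K _ (c ^ 2) ^ 2) * u := by
          refine mul_left_cancel₀ (xFun_ne_zero (W := (modelCurve (c ^ 2)).toAffine)) ?_
          rw [hy] at h3
          linear_combination (yFun _ + algebraMap K _ (c ^ 2) * xFun _ + algebraMap K _ (c ^ 2)) *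
            h3 + u * h4
        have h6 := congrArg (evalAt h) h5
        simp only [map_mul, map_add, map_sub, map_pow, evalAt_xFun, evalAt_yFun,
          AlgHom.commutes] at h6
        generalize evalAt h u = a at *
        simpa [hc, hx, hy, CharTwo.add_self_eq_zero] using h6
    choose u hu hu5 hu0 using h1
    choose M hM using fun i => exists_eq_sum_z4Chart he (hu5 i) h hx
      (by rw [hy, CharTwo.neg_eq]) (hu0 i)
    refine ⟨xFun _, v, xFun_ne_zero, hv, M, Or.inr fun i => ?_⟩
    rw [hu i, hM i]

variable {k K : Type*} [Field k] [Field K] [Algebra k K]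

lemma map_mu4Chart (c : k) (i : Fin 2) (j : Fin 4) :
    map (algebraMap k K) (mu4Chart c i j) = mu4Chart (algebraMap k K c) i j := by
  fin_cases i <;> fin_cases j <;> simp [mu4Chart]

lemma map_z4Chart (e : k) (i : Fin 3) (j : Fin 4) :
    map (algebraMap k K) (z4Chart e i j) = z4Chart (algebraMap k K e) i j := by
  fin_cases i <;> fin_cases j <;> simp [z4Chart]

variable [IsAlgClosed K] [CharP K 2]

/-- A symmetric quartic model of the model curve is linearly equivalent to one of the two normal
forms. -/
lemma isInducedByLinear_or_of_modelCurve {c : k} (hc : c ≠ 0) {Y : Set (PSpace K 3)}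
    {ι : Iso k (curve K (modelCurve (c ^ 2))) Y} (hY : IsQuarticModel Y)
    {B : Matrix.GeneralLinearGroup (Fin 4) K}
    (hB : ∀ x y (h : Projectivization.mk K ![x, y, 1] (affine_ne_zero x y) ∈
        curve K (modelCurve (c ^ 2)))
      (h' : Projectivization.mk K ![x, y + algebraMap k K c ^ 2 * x, 1] (affine_ne_zero _ _) ∈
        curve K (modelCurve (c ^ 2))),
      (ι.toEquiv ⟨_, h'⟩ : PSpace K 3) = linAut B (ι.toEquiv ⟨_, h⟩))
    {φ : Iso k (curve K (modelCurve (c ^ 2))) (z4Curve K (c ^ 2))}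
    (hφ : Represents φ.toEquiv 2 (z4Chart (c ^ 2) 0))
    {ψ : Iso k (curve K (modelCurve (c ^ 2))) (mu4Curve K c)}
    (hψ : Represents ψ.toEquiv 2 (mu4Chart c 0)) :
    IsInducedByLinear ι φ ∨ IsInducedByLinear ι ψ := by
  have hc' : algebraMap k K c ≠ 0 := (map_ne_zero _).2 hc
  have hX : curve K (modelCurve (c ^ 2)) = curve K (modelCurve (algebraMap k K c ^ 2)) := by
    rw [curve_baseChange, baseChange_modelCurve, map_pow]
  obtain ⟨d, p, hp, hp0⟩ := isMorphism_iff.1 ι.isMorphism_toFun _ infinity_ne_zero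
    infinity_mem_curve
  have hp0' : evalTuple (fun i => map (algebraMap k K) (p i)) (![0, 1, 0] : Fin 3 → K) ≠ 0 := by
    rwa [evalTuple_map]
  have key := exists_relation hc' hX ι.isMorphism_toFun.map ι.isMorphism_invFun.map hY hB hp.map
    infinity_ne_zero infinity_mem_curve hp0'
  rw [← map_pow] at key
  obtain ⟨hli, s, v, hs, hv, M, h | h⟩ := key
  · simp only [← map_mu4Chart] at h
    exact Or.inr (isInducedByLinear_of_relation hp hψ hli hs hv h)
  · simp only [← map_z4Chart] at h
    exact Or.inl (isInducedByLinear_of_relation hp hφ hli hs hv h)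

end QuarticModel

/-! ### Changes of Weierstrass coordinates as isomorphisms -/

section VariableChange

variable {k K : Type*} [Field k] [Field K] [Algebra k K]

/-- The linear forms of an admissible change of variables. -/
def variableChangeForms (C : WeierstrassCurve.VariableChange k) : Fin 3 → MvPolynomial (Fin 3) k :=
  ![MvPolynomial.C ((C.u : k) ^ 2) * X 0 + MvPolynomial.C C.r * X 2,
    MvPolynomial.C ((C.u : k) ^ 3) * X 1 + MvPolynomial.C ((C.u : k) ^ 2 * C.s) * X 0 +
      MvPolynomial.C C.t * X 2, X 2]

lemma evalTuple_variableChangeForms (C : WeierstrassCurve.VariableChange k) (v : Fin 3 → K) :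
    evalTuple (variableChangeForms C) v =
      ![algebraMap k K C.u ^ 2 * v 0 + algebraMap k K C.r * v 2,
        algebraMap k K C.u ^ 3 * v 1 + algebraMap k K C.u ^ 2 * algebraMap k K C.s * v 0 +
          algebraMap k K C.t * v 2, v 2] := by
  ext i
  fin_cases i <;> simp [evalTuple, variableChangeForms]

lemma evalTuple_variableChangeForms_inv (C : WeierstrassCurve.VariableChange k) (v : Fin 3 → K) :
    evalTuple (variableChangeForms C⁻¹) (evalTuple (variableChangeForms C) v) = v := by
  have hu : algebraMap k K C.u ≠ 0 := (map_ne_zero _).2 C.u.ne_zero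
  rw [evalTuple_variableChangeForms, evalTuple_variableChangeForms, WeierstrassCurve.VariableChange.inv_def]
  ext i
  fin_cases i <;> simp <;> field_simp <;> ring

lemma isAtlas_variableChangeForms (W : WeierstrassCurve k)
    (C : WeierstrassCurve.VariableChange k) :
    IsAtlas (curve K (C • W)) (curve K W) (fun _ : Unit => 1) (fun _ => variableChangeForms C) where
  isHomogeneous _ i := by
    apply isHomogeneous_of_aeval_scale
    fin_cases i <;> simp [variableChangeForms, algebraMap_eq] <;> ring
  covers v hv _ := ⟨(), fun h => hv (by
    rw [← evalTuple_variableChangeForms_inv C v, h, evalTuple_variableChangeForms]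
    simp)⟩
  compatible v _ _ _ _ := prop2_self _
  mapsTo v hv hX _ h := by
    have hu : algebraMap k K C.u ≠ 0 := (map_ne_zero _).2 C.u.ne_zero
    rw [mk_mem_curve_iff, WeierstrassCurve.variableChange_def] at hX
    rw [mk_mem_curve_iff, evalTuple_variableChangeForms]
    clear h
    have h2 : algebraMap k K 2 = 2 := map_ofNat _ 2
    have h3 : algebraMap k K 3 = 3 := map_ofNat _ 3
    simp [h2, h3] at hX ⊢
    field_simp at hX
    linear_combination hX

lemma exists_iso_variableChange (W : WeierstrassCurve k) (C : WeierstrassCurve.VariableChange k) :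
    ∃ φ : Iso k (curve K (C • W)) (curve K W), Represents φ.toEquiv 1 (variableChangeForms C) := by
  have h1 := isAtlas_variableChangeForms (K := K) W C
  have h2 := isAtlas_variableChangeForms (K := K) (C • W) C⁻¹
  rw [inv_smul_smul] at h2
  have hinv : ∀ v : Fin 3 → K,
      evalTuple (variableChangeForms C) (evalTuple (variableChangeForms C⁻¹) v) = v := fun v => by
    simpa using evalTuple_variableChangeForms_inv C⁻¹ v
  have hne : ∀ (C : WeierstrassCurve.VariableChange k) {v : Fin 3 → K}, v ≠ 0 →
      evalTuple (variableChangeForms C) v ≠ 0 := fun C v hv h => hv (by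
    rw [← evalTuple_variableChangeForms_inv C v, h, evalTuple_variableChangeForms]
    simp)
  obtain ⟨φ, hφ⟩ := h1.exists_iso h2
    (fun v hv _ => ⟨(), (), hne _ hv, hne _ (hne _ hv), by
      rw [evalTuple_variableChangeForms_inv]; exact prop2_self v⟩)
    (fun v hv _ => ⟨(), (), hne _ hv, hne _ (hne _ hv), by
      rw [hinv]; exact prop2_self v⟩)
  exact ⟨φ, hφ ()⟩

end VariableChange

/-! ### Reduction of a curve with a point of order four to the model -/

section OrderFour

variable {k : Type*} [Field k] [CharP k 2] [DecidableEq k] (E : WeierstrassCurve k)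

/-- The coordinates of a point of order four: the tangent is not vertical and meets the curve in a
point of order two. -/
lemma exists_slope_of_addOrderOf_eq_four {T : E.toAffine.Point} (hT : addOrderOf T = 4) :
    ∃ x y h, T = .some x y h ∧ ∃ l, E.a₁ * x + E.a₃ ≠ 0 ∧
      l * (E.a₁ * x + E.a₃) = x ^ 2 + E.a₄ + E.a₁ * y ∧
      E.a₁ * (l ^ 2 + E.a₁ * l + E.a₂) + E.a₃ = 0 := by
  have h2 : (2 : ℕ) • T ≠ 0 := fun h => by
    have := addOrderOf_dvd_of_nsmul_eq_zero h
    rw [hT] at this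
    exact absurd (Nat.le_of_dvd two_pos this) (by norm_num)
  have h4 : (2 : ℕ) • T = -((2 : ℕ) • T) := by
    rw [eq_neg_iff_add_eq_zero, ← add_nsmul]
    have h := addOrderOf_nsmul_eq_zero T
    rwa [hT] at h
  rw [two_nsmul] at h2 h4
  cases T with
  | zero => exact absurd (add_zero 0) h2
  | some x y h =>
  have hy : y ≠ E.toAffine.negY x y := fun hy =>
    h2 (WeierstrassCurve.Affine.Point.add_self_of_Y_eq hy)
  rw [WeierstrassCurve.Affine.Point.add_self_of_Y_ne hy,
    WeierstrassCurve.Affine.Point.neg_some] at h4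
  simp only [WeierstrassCurve.Affine.Point.some.injEq, true_and] at h4
  have hD : y - E.toAffine.negY x y = E.a₁ * x + E.a₃ := by
    simp only [WeierstrassCurve.Affine.negY]
    grind
  have hD0 : E.a₁ * x + E.a₃ ≠ 0 := hD ▸ sub_ne_zero.2 hy
  refine ⟨x, y, h, rfl, E.toAffine.slope x x y y, hD0, ?_, ?_⟩
  · rw [WeierstrassCurve.Affine.slope_of_Y_ne rfl hy, hD, div_mul_cancel₀ _ hD0]
    grind
  · simp only [WeierstrassCurve.Affine.negY, WeierstrassCurve.Affine.addX] at h4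
    generalize E.toAffine.addY x x y _ = Y at h4
    generalize E.toAffine.slope x x y y = l at *
    grind

lemma exists_variableChange [E.IsElliptic] {T : E.toAffine.Point} (hT : addOrderOf T = 4) {c : k}
    (hc : E.j = c ^ 8) : c ≠ 0 ∧ ∃ (x y : k) (h : E.toAffine.Nonsingular x y), T = .some x y h ∧
      ∃ C : WeierstrassCurve.VariableChange k, C • E = modelCurve (c ^ 2) ∧
        x = (C.u : k) ^ 2 * c ^ 2 + C.r ∧
        y = (C.u : k) ^ 3 * c ^ 2 + (C.u : k) ^ 2 * C.s * c ^ 2 + C.t := by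
  obtain ⟨x, y, h, rfl, l, hD, hl, h2⟩ := exists_slope_of_addOrderOf_eq_four E hT
  have ha₁ : E.a₁ ≠ 0 := by
    intro h0
    rw [h0] at hD h2
    simp at hD h2
    exact hD h2
  have hj : E.a₁ ^ 12 = c ^ 8 * E.Δ := by
    rw [← hc, WeierstrassCurve.j, mul_right_comm, ← WeierstrassCurve.coe_Δ', Units.inv_mul, one_mul,
      WeierstrassCurve.c₄, WeierstrassCurve.b₂, WeierstrassCurve.b₄]
    grind
  have hc0 : c ≠ 0 := by
    rintro rfl
    simp [ha₁] at hj
  refine ⟨hc0, x, y, h, rfl, ?_⟩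
  -- The translation r = a₃/a₁ is the abscissa of 2T and kills a₃. The shear s is the slope l of the
  -- tangent at T, and then a₂ vanishes because l² + a₁ l + a₂ is also the abscissa of 2T. The value
  -- of t kills a₄, and u scales a₁ to c².
  let C : WeierstrassCurve.VariableChange k :=
    ⟨Units.mk0 (E.a₁ / c ^ 2) (div_ne_zero ha₁ (pow_ne_zero 2 hc0)), E.a₃ / E.a₁, l,
      (E.a₄ + l * E.a₃ + (E.a₃ / E.a₁) ^ 2) / E.a₁ + E.a₃ / E.a₁ * l⟩
  have e₁ : (C • E).a₁ = c ^ 2 := by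
    rw [WeierstrassCurve.variableChange_a₁]
    simp [C, CharTwo.two_eq_zero, ha₁]
  have e₂ : (C • E).a₂ = 0 := by
    rw [WeierstrassCurve.variableChange_a₂]
    have : E.a₂ - l * E.a₁ + 3 * (E.a₃ / E.a₁) - l ^ 2 = 0 := by
      field_simp
      grind
    simp only [C, this, mul_zero]
  have e₃ : (C • E).a₃ = 0 := by
    rw [WeierstrassCurve.variableChange_a₃]
    have : E.a₃ + E.a₃ / E.a₁ * E.a₁ = 0 := by
      rw [div_mul_cancel₀ _ ha₁, CharTwo.add_self_eq_zero]
    simp only [C, this, CharTwo.two_eq_zero, zero_mul, add_zero, mul_zero]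
  have e₄ : (C • E).a₄ = 0 := by
    rw [WeierstrassCurve.variableChange_a₄]
    have : ∀ r, E.a₄ - l * E.a₃ + 2 * r * E.a₂ -
        ((E.a₄ + l * E.a₃ + r ^ 2) / E.a₁ + r * l + r * l) * E.a₁ + 3 * r ^ 2 -
          2 * l * ((E.a₄ + l * E.a₃ + r ^ 2) / E.a₁ + r * l) = 0 := by
      intro r
      field_simp
      grind
    simp only [C, this, mul_zero]
  have e₆ : (C • E).a₆ = c ^ 4 := by
    -- In characteristic 2 the j-invariant is a₁¹²/Δ; with all other coefficients normalized, this
    -- relation determines a₆.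
    have hj' : (C • E).a₁ ^ 12 = c ^ 8 * (C • E).Δ := by
      rw [WeierstrassCurve.variableChange_Δ, WeierstrassCurve.variableChange_a₁,
        CharTwo.two_eq_zero, zero_mul, add_zero, mul_pow, hj]
      ring
    rw [WeierstrassCurve.Δ, WeierstrassCurve.b₂, WeierstrassCurve.b₄, WeierstrassCurve.b₆,
      WeierstrassCurve.b₈, e₁, e₂, e₃, e₄] at hj'
    generalize (C • E).a₆ = a at *
    have h3 : c ^ 20 * (a - c ^ 4) = 0 := by
      clear e₁ e₂ e₃ e₄ hc hj hl h2 hD hT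
      clear C
      grind
    simpa [hc0, sub_eq_zero] using h3
  have hCE : C • E = modelCurve (c ^ 2) := by
    ext <;> simp only [e₁, e₂, e₃, e₄, e₆, modelCurve]
    ring
  refine ⟨C, hCE, ?_⟩
  obtain ⟨x', hx'⟩ : ∃ x', x = (C.u : k) ^ 2 * x' + C.r := ⟨(x - C.r) / C.u ^ 2, by field_simp; ring⟩
  obtain ⟨y', hy'⟩ : ∃ y', y = (C.u : k) ^ 3 * y' + (C.u : k) ^ 2 * C.s * x' + C.t :=
    ⟨(y - C.t - C.u ^ 2 * C.s * x') / C.u ^ 3, by field_simp; ring⟩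
  have hu : (C.u : k) * c ^ 2 = E.a₁ := by
    simp [C, hc0]
  have hr : C.r * E.a₁ = E.a₃ := div_mul_cancel₀ _ ha₁
  have ht : C.t * E.a₁ = E.a₄ + C.r ^ 2 := by
    change ((E.a₄ + l * E.a₃ + (E.a₃ / E.a₁) ^ 2) / E.a₁ + E.a₃ / E.a₁ * l) * E.a₁ =
      E.a₄ + (E.a₃ / E.a₁) ^ 2
    field_simp
    grind
  have hu0 : (C.u : k) ≠ 0 := C.u.ne_zero
  have hs : C.s = l := rfl
  have heq : y' ^ 2 + c ^ 2 * x' * y' = x' ^ 3 + c ^ 4 := by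
    have h3 := isAtlas_variableChangeForms (K := k) (C • E) C⁻¹
    rw [inv_smul_smul, hCE] at h3
    have h4 : evalTuple (variableChangeForms C) ![x', y', 1] = ![x, y, 1] := by
      rw [evalTuple_variableChangeForms, hx', hy']
      simp
    have h5 : evalTuple (variableChangeForms C⁻¹) ![x, y, 1] = ![x', y', 1] := by
      rw [← h4, evalTuple_variableChangeForms_inv]
    have h6 := h3.mapsTo ![x, y, 1] (affine_ne_zero x y) (by
      rw [affine_mem_curve_iff]
      simpa [WeierstrassCurve.baseChange] using h.1) () (by
        rw [h5]
        exact affine_ne_zero x' y')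
    rw [mk_mem_modelCurve_iff, h5] at h6
    simp at h6
    linear_combination h6
  -- The shear makes the tangent at T horizontal, which reads x'² = c² y'. The curve equation then
  -- reduces to y'² = c⁴, so both coordinates equal c².
  have htan : x' ^ 2 = c ^ 2 * y' := by
    have h3 : (C.u : k) ^ 4 * (x' ^ 2 - c ^ 2 * y') = 0 := by
      rw [hs] at hy'
      generalize (C.u : k) = u at *
      generalize C.r = r at *
      generalize C.t = t at *
      clear hCE e₁ e₂ e₃ e₄ e₆ h2 hj hc heq hD
      grind
    simpa [hu0, sub_eq_zero] using h3
  have hx : x' = c ^ 2 := by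
    have h3 : (x' - c ^ 2) ^ 4 = 0 := by
      clear hCE e₁ e₂ e₃ e₄ e₆ h2 hj hc hx' hy' ht hr hu hl hD
      grind
    exact sub_eq_zero.1 (pow_eq_zero_iff four_ne_zero |>.1 h3)
  have hy : y' = c ^ 2 := by
    rw [hx] at htan
    exact (mul_left_cancel₀ (pow_ne_zero 2 hc0) (by linear_combination htan)).symm
  exact ⟨by rw [hx', hx], by rw [hy', hx, hy]⟩

end OrderFour

/-! ### Transport from the model to the given curve -/

section Transport

variable {k K : Type*} [Field k] [Field K] [Algebra k K]

lemma Represents.variableChange_infinity {E W : WeierstrassCurve k}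
    {C : WeierstrassCurve.VariableChange k} {θ : curve K W → curve K E}
    (h : Represents θ 1 (variableChangeForms C)) :
    θ ⟨_, infinity_mem_curve⟩ = ratPoint K E 0 := by
  have hu : algebraMap k K C.u ≠ 0 := (map_ne_zero _).2 C.u.ne_zero
  have h0 : evalTuple (variableChangeForms C) (![0, 1, 0] : Fin 3 → K) ≠ 0 := fun h => by
    have := congrFun h 1
    simp [evalTuple_variableChangeForms, hu] at this
  refine Subtype.ext ((h.eq_mk _ infinity_ne_zero infinity_mem_curve h0).trans ?_)
  refine (mk_eq_mk_iff_prop2 _ infinity_ne_zero).2 ?_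
  rw [evalTuple_variableChangeForms]
  apply prop2_fin_three <;> simp

lemma Represents.variableChange_affine {E W : WeierstrassCurve k}
    {C : WeierstrassCurve.VariableChange k} {θ : curve K W → curve K E}
    (h : Represents θ 1 (variableChangeForms C)) {x y X Y : K}
    (hxy : Projectivization.mk K ![x, y, 1] (affine_ne_zero x y) ∈ curve K W)
    (hX : X = algebraMap k K C.u ^ 2 * x + algebraMap k K C.r)
    (hY : Y = algebraMap k K C.u ^ 3 * y + algebraMap k K C.u ^ 2 * algebraMap k K C.s * x +
      algebraMap k K C.t) :
    (θ ⟨_, hxy⟩ : PSpace K 2) = Projectivization.mk K ![X, Y, 1] (affine_ne_zero X Y) := by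
  have h0 : evalTuple (variableChangeForms C) ![x, y, 1] = ![X, Y, 1] := by
    rw [evalTuple_variableChangeForms, hX, hY]
    simp
  rw [h.eq_mk _ (affine_ne_zero x y) hxy (h0 ▸ affine_ne_zero X Y)]
  simp only [h0]

lemma Iso.trans_toEquiv_apply {l m n : ℕ} {X : Set (PSpace K l)} {Y : Set (PSpace K m)}
    {Z : Set (PSpace K n)} (φ : Iso k X Y) (ψ : Iso k Y Z) (P : X) :
    (φ.trans ψ).toEquiv P = ψ.toEquiv (φ.toEquiv P) := rfl

lemma Iso.symm_toEquiv {m n : ℕ} {X : Set (PSpace K m)} {Y : Set (PSpace K n)} (φ : Iso k X Y) :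
    φ.symm.toEquiv = φ.toEquiv.symm := rfl

lemma IsInducedByLinear.of_trans {E W : WeierstrassCurve k} {Y Z : Set (PSpace K 3)}
    {θ : Iso k (curve K W) (curve K E)} {ι : Iso k (curve K E) Y} {φ : Iso k (curve K W) Z}
    (h : IsInducedByLinear (θ.trans ι) φ) : IsInducedByLinear ι (θ.symm.trans φ) := by
  obtain ⟨A, hA⟩ := h
  refine ⟨A, fun P => ?_⟩
  rw [Iso.trans_toEquiv_apply, Iso.symm_toEquiv, hA, Iso.trans_toEquiv_apply,
    Equiv.apply_symm_apply]

lemma Iso.eq_of_curve [IsAlgClosed K] [CharP K 2] {E : WeierstrassCurve k} {e : k} (he : e ≠ 0)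
    (θ : Iso k (curve K (modelCurve e)) (curve K E)) {P Q : curve K E}
    (hP : (θ.toEquiv.symm P : PSpace K 2) = Projectivization.mk K ![0, 1, 0] infinity_ne_zero)
    (hQ : (θ.toEquiv.symm Q : PSpace K 2) =
      Projectivization.mk K ![algebraMap k K e, algebraMap k K e, 1] (affine_ne_zero _ _))
    {n : ℕ} {Z : Set (PSpace K n)} (φ ψ : Iso k (curve K E) Z)
    (h0 : φ.toEquiv P = ψ.toEquiv P) (hT : φ.toEquiv Q = ψ.toEquiv Q) : φ = ψ := by
  have hval : ∀ (φ : Iso k (curve K E) Z) R,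
      (θ.trans φ).toEquiv (θ.toEquiv.symm R) = φ.toEquiv R := fun φ R => by
    rw [Iso.trans_toEquiv_apply, Equiv.apply_symm_apply]
  have key : θ.trans φ = θ.trans ψ :=
    Iso.eq_of_modelCurve he _ _ hP hQ (by rw [hval, hval, h0]) (by rw [hval, hval, hT])
  refine Iso.ext (Equiv.ext fun R => ?_)
  rw [← hval φ, ← hval ψ, key]

/-- The classification of symmetric quartic models over a field of characteristic two, with an
arbitrary algebraically closed extension as the field of points. -/
theorem normalForms_of_addOrderOf_eq_four [IsAlgClosed K] [CharP k 2] [DecidableEq k]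
    (E : WeierstrassCurve k) [E.IsElliptic]
    (T : E.toAffine.Point) (hT : addOrderOf T = 4) (c : k) (hc : E.j = c ^ 8) :
    (IsSmoothCompleteIntersection K (z4Forms (c ^ 2)) ∧
      ∃! φ : Iso k (curve K E) (z4Curve K (c ^ 2)), IsZ4Marked T φ) ∧
    (IsSmoothCompleteIntersection K (mu4Forms c) ∧
      ∃! ψ : Iso k (curve K E) (mu4Curve K c), IsMu4Marked T ψ) ∧
    ∀ (Y : Set (PSpace K 3)) (ι : Iso k (curve K E) Y), IsQuarticModel Y → IsSymmetric ι →
      (∃ φ : Iso k (curve K E) (z4Curve K (c ^ 2)), IsZ4Marked T φ ∧ IsInducedByLinear ι φ) ∨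
      (∃ ψ : Iso k (curve K E) (mu4Curve K c), IsMu4Marked T ψ ∧ IsInducedByLinear ι ψ) := by
  obtain ⟨hc0, x, y, h, rfl, C, hC, hx, hy⟩ := exists_variableChange E hT hc
  have : CharP K 2 := charP_of_injective_algebraMap (algebraMap k K).injective 2
  have he : c ^ 2 ≠ 0 := pow_ne_zero 2 hc0
  have hθ := exists_iso_variableChange (K := K) E C
  rw [hC] at hθ
  obtain ⟨θ, hθ⟩ := hθ
  have hP : (θ.toEquiv.symm (ratPoint K E 0) : PSpace K 2) =
      Projectivization.mk K ![0, 1, 0] infinity_ne_zero := by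
    rw [← hθ.variableChange_infinity, Equiv.symm_apply_apply]
  have hself : Projectivization.mk K ![algebraMap k K (c ^ 2), algebraMap k K (c ^ 2), 1]
      (affine_ne_zero _ _) ∈ curve K (modelCurve (c ^ 2)) := by
    rw [mk_mem_modelCurve_iff]
    simp
    ring
  have hQ : (θ.toEquiv.symm (ratPoint K E (.some x y h)) : PSpace K 2) =
      Projectivization.mk K ![algebraMap k K (c ^ 2), algebraMap k K (c ^ 2), 1]
        (affine_ne_zero _ _) := by
    have h1 : θ.toEquiv ⟨_, hself⟩ = ratPoint K E (.some x y h) :=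
      Subtype.ext (hθ.variableChange_affine hself (by simp [hx]) (by simp [hy]))
    rw [← h1, Equiv.symm_apply_apply]
  obtain ⟨φ, hφ⟩ := exists_iso_z4Curve (K := K) he
  obtain ⟨ψ, hψ⟩ := exists_iso_mu4Curve (K := K) hc0
  have hφm : IsZ4Marked (.some x y h) (θ.symm.trans φ) := by
    constructor <;> rw [Iso.trans_toEquiv_apply, Iso.symm_toEquiv]
    exacts [(hφ 1).z4Chart_infinity hP, (hφ 0).z4Chart_self he hQ]
  have hψm : IsMu4Marked (.some x y h) (θ.symm.trans ψ) := by
    constructor <;> rw [Iso.trans_toEquiv_apply, Iso.symm_toEquiv]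
    exacts [(hψ 1).mu4Chart_infinity hP, (hψ 0).mu4Chart_self hc0 hQ]
  refine ⟨⟨isSmooth_z4Forms he, _, hφm, fun φ' hφ' => ?_⟩,
    ⟨isSmooth_mu4Forms hc0, _, hψm, fun ψ' hψ' => ?_⟩, fun Y ι hY hι => ?_⟩
  · exact Iso.eq_of_curve he θ hP hQ _ _ (Subtype.ext (hφ'.1.trans hφm.1.symm))
      (Subtype.ext (hφ'.2.trans hφm.2.symm))
  · exact Iso.eq_of_curve he θ hP hQ _ _ (Subtype.ext (hψ'.1.trans hψm.1.symm))
      (Subtype.ext (hψ'.2.trans hψm.2.symm))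
  · obtain ⟨B, hB⟩ := hι
    have ha₁ : E.a₁ = C.u * c ^ 2 := by
      have h1 := congrArg WeierstrassCurve.a₁ hC
      rw [WeierstrassCurve.variableChange_a₁, CharTwo.two_eq_zero, zero_mul, add_zero] at h1
      exact (Units.inv_mul_eq_iff_eq_mul C.u).1 h1
    have ha₃ : E.a₃ = C.r * E.a₁ := by
      have h1 := congrArg WeierstrassCurve.a₃ hC
      rw [WeierstrassCurve.variableChange_a₃, CharTwo.two_eq_zero, zero_mul, add_zero] at h1
      exact CharTwo.add_eq_zero.1 ((mul_eq_zero.1 h1).resolve_left (by simp))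
    have hell : WeierstrassCurve.IsElliptic (E.baseChange K).toAffine :=
      inferInstanceAs (E.map (algebraMap k K)).IsElliptic
    -- The change of coordinates commutes with negation, by the values of a₁ and a₃ just found. The
    -- matrix that realizes [−1] for `ι` therefore also realizes negation on the model.
    have hB' : ∀ x y (h : Projectivization.mk K ![x, y, 1] (affine_ne_zero x y) ∈
          curve K (modelCurve (c ^ 2)))
        (h' : Projectivization.mk K ![x, y + algebraMap k K c ^ 2 * x, 1] (affine_ne_zero _ _) ∈
          curve K (modelCurve (c ^ 2))),
        ((θ.trans ι).toEquiv ⟨_, h'⟩ : PSpace K 3) = linAut B ((θ.trans ι).toEquiv ⟨_, h⟩) := by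
      intro x y h h'
      have h1 := hθ.variableChange_affine h rfl rfl
      have h2 := h1 ▸ (θ.toEquiv ⟨_, h⟩).2
      have hns := WeierstrassCurve.Affine.equation_iff_nonsingular.1 (affine_mem_curve_iff.1 h2)
      have h3 : θ.toEquiv ⟨_, h⟩ = geomPoint K E (.some _ _ hns) := Subtype.ext h1
      have h4 : θ.toEquiv ⟨_, h'⟩ = geomPoint K E (-.some _ _ hns) := by
        rw [WeierstrassCurve.Affine.Point.neg_some]
        refine Subtype.ext (hθ.variableChange_affine h' rfl ?_)
        have e₁ : (E.baseChange K).toAffine.a₁ = algebraMap k K C.u * algebraMap k K c ^ 2 := by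
          rw [← map_pow, ← map_mul, ← ha₁]
          rfl
        have e₃ : (E.baseChange K).toAffine.a₃ =
            algebraMap k K C.r * (algebraMap k K C.u * algebraMap k K c ^ 2) := by
          rw [← map_pow, ← map_mul, ← map_mul, ← ha₁, ← ha₃]
          rfl
        rw [Algebra.algebraMap_self, RingHom.id_apply, WeierstrassCurve.Affine.negY, e₁, e₃]
        generalize algebraMap k K C.u = u
        generalize algebraMap k K c = c
        grind
      rw [Iso.trans_toEquiv_apply, Iso.trans_toEquiv_apply, h3, h4]
      exact hB _
    rcases isInducedByLinear_or_of_modelCurve hc0 hY hB' (hφ 0) (hψ 0) with h1 | h1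
    · exact Or.inl ⟨_, hφm, h1.of_trans⟩
    · exact Or.inr ⟨_, hψm, h1.of_trans⟩

end Transport

end NormalForm

end

theorem mainTheorem1 {k : Type*} [Field k] [CharP k 2] [DecidableEq k]
    (E : WeierstrassCurve k) [E.IsElliptic]
    (T : E.toAffine.Point) (hT : addOrderOf T = 4) (c : k) (hc : E.j = c ^ 8) :
    (NormalForm.IsSmoothCompleteIntersection (AlgebraicClosure k)
        (NormalForm.z4Forms (c ^ 2)) ∧
      ∃! φ : NormalForm.Iso k (NormalForm.curve (AlgebraicClosure k) E)
        (NormalForm.z4Curve (AlgebraicClosure k) (c ^ 2)), NormalForm.IsZ4Marked T φ) ∧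
    (NormalForm.IsSmoothCompleteIntersection (AlgebraicClosure k)
        (NormalForm.mu4Forms c) ∧
      ∃! ψ : NormalForm.Iso k (NormalForm.curve (AlgebraicClosure k) E)
        (NormalForm.mu4Curve (AlgebraicClosure k) c), NormalForm.IsMu4Marked T ψ) ∧
    ∀ (Y : Set (NormalForm.PSpace (AlgebraicClosure k) 3))
      (ι : NormalForm.Iso k (NormalForm.curve (AlgebraicClosure k) E) Y),
      NormalForm.IsQuarticModel Y → NormalForm.IsSymmetric ι →
        (∃ φ : NormalForm.Iso k (NormalForm.curve (AlgebraicClosure k) E)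
            (NormalForm.z4Curve (AlgebraicClosure k) (c ^ 2)),
          NormalForm.IsZ4Marked T φ ∧ NormalForm.IsInducedByLinear ι φ) ∨
        (∃ ψ : NormalForm.Iso k (NormalForm.curve (AlgebraicClosure k) E)
            (NormalForm.mu4Curve (AlgebraicClosure k) c),
          NormalForm.IsMu4Marked T ψ ∧ NormalForm.IsInducedByLinear ι ψ) := 
  NormalForm.normalForms_of_addOrderOf_eq_four E T hT c hc
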